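/- Let $N\ge 1$, let $\Omega\subset\mathbb{R}^N$ be a nonempty bounded open set (not necessarily connected), and let $Q=1$ on $\Omega$, $Q=-1$ on $\mathbb{R}^N\smallsetminus\Omega$. Let $2<p<2^*$, where $2^*=\frac{2N}{N-2}$ if $N\ge 3$ and $2^*=\infty$ if $N=1,2$. For $\varepsilon>0$ put $Q_\varepsilon(x)=Q(x/\varepsilon)$ and consider $$-\Delta v+v=Q_\varepsilon(x)|v|^{p-2}v,\qquad v\in H^1(\mathbb{R}^N),\tag{1}$$ and the limit problem $$-\Delta w=Q(x)|w|^{p-2}w,\qquad w\in E:=D^{1,2}(\mathbb{R}^N)\cap L^p(\mathbb{R}^N),\tag{2}$$ where $E$ is the space of all $w\in L^p(\mathbb{R}^N)$ with weak gradient in $L^2(\mathbb{R}^N)$, normed by $\|w\|_E^2=\int_{\mathbb{R}^N}|\nabla w|^2+\big(\int_{\mathbb{R}^N}|w|^p\big)^{2/p}$. Solutions are the critical points of the associated energies $$I_\varepsilon(v)=\tfrac12\int_{\mathbb{R}^N}(|\nabla v|^2+v^2)-\tfrac1p\int_{\mathbb{R}^N}Q_\varepsilon|v|^p\ \text{ on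 } H^1(\mathbb{R}^N),\qquad J_0(w)=\tfrac12\int_{\mathbb{R}^N}|\nabla w|^2-\tfrac1p\int_{\mathbb{R}^N}Q|w|^p\ \text{ on } E.$$ For an energy $J$ on a space $X$ of these, let $\mathcal N=\{u\in X: u\ne 0,\ J'(u)u=0\}$ and let the nodal Nehari set be $\mathcal E=\{u\in\mathcal N: u^+\in\mathcal N,\ u^-\in\mathcal N\}$, where $u^+=\max\{u,0\}$ and $u^-=\min\{u,0\}$. A least energy nodal solution is a minimizer of $J$ on $\mathcal E$. Let $\varepsilon_n>0$, $\varepsilon_n\to 0$. Then for each $n$ problem (1) with $\varepsilon=\varepsilon_n$ has a least energy nodal solution. Moreover, let $v_n$ be any least energy nodal solution of (1) with $\varepsilon=\varepsilon_n$, $n\in\mathbb{N}$, and set $u_n(x):=\varepsilon_n^{\frac{2}{p-2}}v_n(\varepsilon_n x)$. Then each $v_n$ is indeed a solution of (1) and, after passing to a subsequence, $(u_n)$ converges strongly in $E$ to a least energy nodal solution of (2), which is indeed a solution of (2). Furthermore, for every $\varrho>0$, $$\lim_{n\to\infty}\frac{\int_{|x|\le\varrho}(|\nabla v_n|^2+v_n^2)}{\int_{\mathbb{R}^N}(|\nabla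 v_n|^2+v_n^2)}=1\qquad\text{and}\qquad \lim_{n\to\infty}\frac{\int_{|x|\le\varrho}|v_n|^p}{\int_{\mathbb{R}^N}|v_n|^p}=1.$$ -/

import Mathlib

open MeasureTheory Filter Topology
open scoped ContDiff

namespace NodalCore

/-- `g` is the weak (distributional) gradient of `u` on `ℝᴺ`. -/
structure HasWeakGradient {N : ℕ} (u : EuclideanSpace ℝ (Fin N) → ℝ)
    (g : EuclideanSpace ℝ (Fin N) → EuclideanSpace ℝ (Fin N)) : Prop where
  locallyIntegrable : LocallyIntegrable u volume
  locallyIntegrable_grad : LocallyIntegrable g volume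
  integral_eq : ∀ φ : EuclideanSpace ℝ (Fin N) → ℝ, ContDiff ℝ ∞ φ → HasCompactSupport φ →
    ∫ x, u x • gradient φ x = -∫ x, φ x • g x

/-- The weak gradient is unique up to a null set. -/
theorem HasWeakGradient.ae_eq {N : ℕ} {u : EuclideanSpace ℝ (Fin N) → ℝ}
    {g g' : EuclideanSpace ℝ (Fin N) → EuclideanSpace ℝ (Fin N)}
    (h : HasWeakGradient u g) (h' : HasWeakGradient u g') : g =ᵐ[volume] g' :=
  ae_eq_of_integral_contDiff_smul_eq h.locallyIntegrable_grad h'.locallyIntegrable_grad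
    fun φ hφ hc => neg_injective ((h.integral_eq φ hφ hc).symm.trans (h'.integral_eq φ hφ hc))

open Classical in
/-- The weak gradient `∇u` (a representative; the zero field if `u` has no weak gradient). -/
noncomputable def weakGrad {N : ℕ} (u : EuclideanSpace ℝ (Fin N) → ℝ) :
    EuclideanSpace ℝ (Fin N) → EuclideanSpace ℝ (Fin N) :=
  if h : ∃ g, HasWeakGradient u g then h.choose else 0

/-- `u ∈ H¹(ℝᴺ)`. -/
def MemH1 {N : ℕ} (u : EuclideanSpace ℝ (Fin N) → ℝ) : Prop :=
  MemLp u 2 volume ∧ ∃ g, HasWeakGradient u g ∧ MemLp g 2 volume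

/-- `u ∈ E = D^{1,2}(ℝᴺ) ∩ Lᵖ(ℝᴺ)`: functions in `Lᵖ` with weak gradient in `L²`.
For `N ≥ 3` and `2 < p < 2N/(N-2)` such a function lies in `L^{2N/(N-2)}` by Sobolev's inequality;
in every dimension this is the completion of the test functions for the norm of `E`. -/
def MemE {N : ℕ} (p : ℝ) (u : EuclideanSpace ℝ (Fin N) → ℝ) : Prop :=
  MemLp u (ENNReal.ofReal p) volume ∧ ∃ g, HasWeakGradient u g ∧ MemLp g 2 volume

/-- The norm of `E`, `‖u‖_E² = ∫ |∇u|² + (∫ |u|ᵖ)^{2/p}`. -/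
noncomputable def normE {N : ℕ} (p : ℝ) (u : EuclideanSpace ℝ (Fin N) → ℝ) : ℝ :=
  Real.sqrt ((∫ x, ‖weakGrad u x‖ ^ 2) + (∫ x, |u x| ^ p) ^ (2 / p))

/-- Strong convergence in the normed space `E`. -/
def TendstoInE {N : ℕ} (p : ℝ) (u : ℕ → EuclideanSpace ℝ (Fin N) → ℝ)
    (w : EuclideanSpace ℝ (Fin N) → ℝ) : Prop :=
  (∀ n, MemE p (u n)) ∧ MemE p w ∧ Tendsto (fun n => normE p (u n - w)) atTop (𝓝 0)

open Classical in
/-- `Q = 1` on `Ω` and `Q = -1` on the complement of `Ω`. -/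
noncomputable def Q {N : ℕ} (Ω : Set (EuclideanSpace ℝ (Fin N)))
    (x : EuclideanSpace ℝ (Fin N)) : ℝ :=
  if x ∈ Ω then 1 else -1

/-- `Q_ε(x) = Q(x / ε)`. -/
noncomputable def Qε {N : ℕ} (Ω : Set (EuclideanSpace ℝ (Fin N))) (ε : ℝ)
    (x : EuclideanSpace ℝ (Fin N)) : ℝ :=
  Q Ω (ε⁻¹ • x)

/-- The energy functional of the equation `-Δu + μ u = q |u|^{p-2} u`. -/
noncomputable def energy {N : ℕ} (μ : ℝ) (q : EuclideanSpace ℝ (Fin N) → ℝ) (p : ℝ)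
    (u : EuclideanSpace ℝ (Fin N) → ℝ) : ℝ :=
  1 / 2 * (∫ x, (‖weakGrad u x‖ ^ 2 + μ * u x ^ 2)) - 1 / p * ∫ x, q x * |u x| ^ p

/-- The derivative of the energy functional at `u` in the direction `φ`. -/
noncomputable def energyDeriv {N : ℕ} (μ : ℝ) (q : EuclideanSpace ℝ (Fin N) → ℝ) (p : ℝ)
    (u φ : EuclideanSpace ℝ (Fin N) → ℝ) : ℝ :=
  (∫ x, (inner ℝ (weakGrad u x) (weakGrad φ x) + μ * (u x * φ x)))
    - ∫ x, q x * (|u x| ^ (p - 2) * u x) * φ x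

/-- `u ∈ X` is a (weak) solution of `-Δu + μ u = q |u|^{p-2} u` in the function space `X`. -/
def IsSolution {N : ℕ} (X : (EuclideanSpace ℝ (Fin N) → ℝ) → Prop) (μ : ℝ)
    (q : EuclideanSpace ℝ (Fin N) → ℝ) (p : ℝ) (u : EuclideanSpace ℝ (Fin N) → ℝ) : Prop :=
  X u ∧ ∀ φ, X φ → energyDeriv μ q p u φ = 0

/-- The Nehari manifold in the function space `X`. -/
def nehari {N : ℕ} (X : (EuclideanSpace ℝ (Fin N) → ℝ) → Prop) (μ : ℝ)
    (q : EuclideanSpace ℝ (Fin N) → ℝ) (p : ℝ) : Set (EuclideanSpace ℝ (Fin N) → ℝ) :=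
  {u | X u ∧ ¬ u =ᵐ[volume] 0 ∧ energyDeriv μ q p u u = 0}

/-- The nodal Nehari set: `u`, `u⁺ = max{u,0}` and `u⁻ = min{u,0}` lie on the Nehari manifold. -/
def nodalNehari {N : ℕ} (X : (EuclideanSpace ℝ (Fin N) → ℝ) → Prop) (μ : ℝ)
    (q : EuclideanSpace ℝ (Fin N) → ℝ) (p : ℝ) : Set (EuclideanSpace ℝ (Fin N) → ℝ) :=
  {u | u ∈ nehari X μ q p ∧ (fun x => max (u x) 0) ∈ nehari X μ q p ∧
    (fun x => min (u x) 0) ∈ nehari X μ q p}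

/-- `u` minimizes the energy on the nodal Nehari set. -/
def IsLeastEnergyNodal {N : ℕ} (X : (EuclideanSpace ℝ (Fin N) → ℝ) → Prop) (μ : ℝ)
    (q : EuclideanSpace ℝ (Fin N) → ℝ) (p : ℝ) (u : EuclideanSpace ℝ (Fin N) → ℝ) : Prop :=
  u ∈ nodalNehari X μ q p ∧ ∀ w ∈ nodalNehari X μ q p, energy μ q p u ≤ energy μ q p w

/-- The rescaling `u(x) = ε^{2/(p-2)} v(ε x)`. -/
noncomputable def rescale {N : ℕ} (p ε : ℝ) (v : EuclideanSpace ℝ (Fin N) → ℝ)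
    (x : EuclideanSpace ℝ (Fin N)) : ℝ :=
  ε ^ (2 / (p - 2)) * v (ε • x)

end NodalCore

/-! The rescaling turns (1) into -Δu + ε²u = Q|u|^{p-2}u and multiplies both parts of the energy by
one common factor. The proof therefore treats one family of problems with mass μ ≥ 0, on the spaces
`MemS μ p`: constant μ gives existence, μ = ε_n² → 0 gives the asymptotics, and μ = 0 is the limit
problem.

One analytic estimate carries the argument: ‖u - φ_R * u‖_p ≤ C(R) ‖∇u‖_2 for a mollifier of radius
R (`HasWeakGradient.lintegral_sub_moll_rpow_le`). Subcriticality of p makes C(R) finite and lets it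
tend to 0 with R. Small R yields local compactness in L^p (`MemE.exists_subseq`). Large R yields an
a priori bound: averages over large balls are uniformly small, and ∫Q|u|^p ≥ 0 forces at least half
of the L^p mass of u into the bounded set Ω, so that ∫|u|^p is controlled by the Dirichlet integral
alone (`Setup.exists_const`). This holds in every dimension and uniformly in μ, without any control
in L².

Compactness on Nehari sets then rests on ∫Q|u|^p = 2∫_Ω|u|^p - ∫|u|^p. The Ω term passes to the
limit, and every other term in the Nehari identity is lower semicontinuous with the favourable sign.
A limit u₀ thus satisfies quad(u₀) ≤ a ≤ pot(u₀), where a > 0 is the limit of the quadratic parts,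
and the factor projecting it onto the Nehari set is at most 1. Applied separately to positive and
negative parts, this produces a nodal function whose energy does not exceed the limit energy; if the
energies agree, no projection was needed and the convergence is strong
(`Setup.exists_subseq_nodal`).

Existence follows by applying this to a minimizing sequence. For μ_n → 0 the missing inequality is
that the least energies do not jump up in the limit. A competitor for μ = 0 need not lie in L², but
its truncations (u - δ)⁺ do and are almost as good (`Setup.eventually_exists_nodal`).

Minimizers are critical points although the nodal Nehari set need not be a manifold: if the
derivative in a direction φ were negative, an intermediate value argument would find a point of the
set near u with smaller energy (`Setup.energyDeriv_nonneg`). Concentration is strong convergence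
read on balls of radius ρ/ε_n → ∞. -/

namespace NodalCore

open scoped ENNReal NNReal

set_option linter.unusedSectionVars false

/-! ### Integral inequalities for averages over dilated kernels -/

section Averaging

variable {E : Type*} [NormedAddCommGroup E] [InnerProductSpace ℝ E] [FiniteDimensional ℝ E]
  [MeasurableSpace E] [BorelSpace E]

theorem lintegral_comp_sub_smul (h : E → ℝ≥0∞) (hh : Measurable h) (x : E) {c : ℝ} (hc : c ≠ 0) :
    ∫⁻ z, h (x - c • z) = ENNReal.ofReal (|c|⁻¹ ^ Module.finrank ℝ E) * ∫⁻ z, h z := by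
  have h1 : ∫⁻ z, h (x - c • z) = ∫⁻ z, h (x - z) ∂(Measure.map (fun z : E => c • z) volume) := by
    rw [lintegral_map (f := fun z => h (x - z)) (by fun_prop) (by fun_prop)]
  rw [h1, Measure.map_addHaar_smul _ hc, lintegral_smul_measure, lintegral_sub_left_eq_self h x,
    smul_eq_mul]
  congr 2
  rw [abs_inv, abs_pow, inv_pow]

/-- Jensen's inequality for a kernel of mass at most one; it is Hölder's inequality for the
factorization k = k^{1/q} k^{1/p}. -/
theorem rpow_lintegral_mul_le (k h : E → ℝ≥0∞) (hk : Measurable k) (hh : Measurable h)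
    (hk1 : ∫⁻ z, k z ≤ 1) {p : ℝ} (hp : 1 < p) :
    (∫⁻ z, k z * h z) ^ p ≤ ∫⁻ z, k z * h z ^ p := by
  have hp0 : 0 < p := by linarith
  set q := p / (p - 1) with hq
  have hpq : q.HolderConjugate p := (Real.HolderConjugate.conjExponent hp).symm
  have hq0 : 0 < q := div_pos (by linarith) (by linarith)
  have := ENNReal.lintegral_mul_le_Lp_mul_Lq volume hpq
    (f := fun z => k z ^ (1 / q)) (g := fun z => k z ^ (1 / p) * h z)
    (by fun_prop) (by fun_prop)
  have e1 : ∀ z, ((fun z => k z ^ (1 / q)) * fun z => k z ^ (1 / p) * h z) z = k z * h z := by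
    intro z
    simp only [Pi.mul_apply]
    rw [← mul_assoc, ← ENNReal.rpow_add_of_nonneg _ _ (by positivity) (by positivity)]
    simp [hpq.inv_add_inv_eq_one]
  have e2 : ∀ r : ℝ, 0 < r → ∀ z, (k z ^ (1 / r)) ^ r = k z := by
    intro r hr z
    rw [← ENNReal.rpow_mul, one_div_mul_cancel hr.ne', ENNReal.rpow_one]
  simp only [e1, ENNReal.mul_rpow_of_nonneg _ _ hp0.le, e2 q hq0, e2 p hp0] at this
  calc (∫⁻ z, k z * h z) ^ p
      ≤ ((∫⁻ z, k z) ^ (1 / q) * (∫⁻ z, k z * h z ^ p) ^ (1 / p)) ^ p := by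
        gcongr
    _ ≤ (1 * (∫⁻ z, k z * h z ^ p) ^ (1 / p)) ^ p := by
        gcongr
        exact ENNReal.rpow_le_one hk1 (by positivity)
    _ = _ := by rw [one_mul, ← ENNReal.rpow_mul, one_div_mul_cancel hp0.ne', ENNReal.rpow_one]

theorem lintegral_lintegral_mul_comp_sub_smul (k h : E → ℝ≥0∞) (hk : Measurable k)
    (hh : Measurable h) (hk1 : ∫⁻ z, k z ≤ 1) (c : ℝ) :
    ∫⁻ x, ∫⁻ z, k z * h (x - c • z) ≤ ∫⁻ x, h x := by
  rw [lintegral_lintegral_swap (by fun_prop)]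
  calc ∫⁻ z, ∫⁻ x, k z * h (x - c • z) = ∫⁻ z, k z * ∫⁻ x, h x := by
        refine lintegral_congr fun z => ?_
        rw [lintegral_const_mul _ (by fun_prop), lintegral_sub_right_eq_self h]
    _ = (∫⁻ z, k z) * ∫⁻ x, h x := by rw [lintegral_mul_const _ hk]
    _ ≤ 1 * ∫⁻ x, h x := by gcongr
    _ = _ := one_mul _

/-- An `L² → Lᵖ` bound for averages with a bounded kernel. -/
theorem lintegral_average_rpow_le (k h : E → ℝ≥0∞) (hk : Measurable k) (hh : Measurable h)
    (hk1 : ∫⁻ z, k z ≤ 1) {K : ℝ≥0∞} (hK : ∀ z, k z ≤ K) {c p : ℝ} (hc : c ≠ 0) (hp : 2 < p) :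
    ∫⁻ x, (∫⁻ z, k z * h (x - c • z)) ^ p ≤
      (K * ENNReal.ofReal (|c|⁻¹ ^ Module.finrank ℝ E)) ^ ((p - 2) / 2) *
        (∫⁻ x, h x ^ (2 : ℝ)) ^ (p / 2) := by
  set I := ∫⁻ x, h x ^ (2 : ℝ) with hI
  set L := K * ENNReal.ofReal (|c|⁻¹ ^ Module.finrank ℝ E) with hL
  have hsq : ∀ x, (∫⁻ z, k z * h (x - c • z)) ^ (2 : ℝ) ≤ ∫⁻ z, k z * h (x - c • z) ^ (2 : ℝ) :=
    fun x => rpow_lintegral_mul_le k (fun z => h (x - c • z)) hk (by fun_prop) hk1 (by norm_num)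
  -- The p-th power is written as the square to the power (p-2)/2, times the square. The first
  -- factor is bounded uniformly in x because the kernel is bounded; only the second is integrated.
  have hsup : ∀ x, (∫⁻ z, k z * h (x - c • z)) ^ (2 : ℝ) ≤ L * I := by
    intro x
    refine (hsq x).trans ?_
    calc ∫⁻ z, k z * h (x - c • z) ^ (2 : ℝ) ≤ ∫⁻ z, K * h (x - c • z) ^ (2 : ℝ) := by
          gcongr with z; exact hK z
      _ = L * I := by
          rw [lintegral_const_mul _ (by fun_prop),
            lintegral_comp_sub_smul (fun y => h y ^ (2 : ℝ)) (by fun_prop) x hc, hL, mul_assoc]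
  calc ∫⁻ x, (∫⁻ z, k z * h (x - c • z)) ^ p
      ≤ ∫⁻ x, (L * I) ^ ((p - 2) / 2) * ∫⁻ z, k z * h (x - c • z) ^ (2 : ℝ) := by
        gcongr with x
        have : (∫⁻ z, k z * h (x - c • z)) ^ p = ((∫⁻ z, k z * h (x - c • z)) ^ (2 : ℝ))
            ^ ((p - 2) / 2) * (∫⁻ z, k z * h (x - c • z)) ^ (2 : ℝ) := by
          rw [← ENNReal.rpow_mul, ← ENNReal.rpow_add_of_nonneg _ _ (by linarith) (by norm_num)]
          congr 1; ring
        rw [this]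
        gcongr
        · exact hsup x
        · exact hsq x
    _ = (L * I) ^ ((p - 2) / 2) * ∫⁻ x, ∫⁻ z, k z * h (x - c • z) ^ (2 : ℝ) := by
        rw [lintegral_const_mul]
        fun_prop
    _ ≤ (L * I) ^ ((p - 2) / 2) * I := by
        gcongr
        exact lintegral_lintegral_mul_comp_sub_smul k (fun y => h y ^ (2 : ℝ)) hk (by fun_prop)
          hk1 c
    _ = _ := by
        rw [ENNReal.mul_rpow_of_nonneg _ _ (by linarith), mul_assoc]
        congr 1
        nth_rw 2 [← ENNReal.rpow_one I]
        rw [← ENNReal.rpow_add_of_nonneg _ _ (by linarith) (by norm_num)]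
        congr 1; ring

/-- A weighted Minkowski inequality for a one-parameter family with an integrable singularity. -/
theorem lintegral_lintegral_Ioc_rpow_le (G : ℝ → E → ℝ≥0∞)
    (hG : Measurable (Function.uncurry G)) {p a : ℝ} (hp : 1 < p) {B : ℝ≥0∞}
    (hB : ∀ t ∈ Set.Ioc (0 : ℝ) 1, ∫⁻ x, G t x ^ p ≤ B * ENNReal.ofReal (t ^ (-(a * p)))) :
    ∫⁻ x, (∫⁻ t in Set.Ioc (0 : ℝ) 1, G t x) ^ p ≤
      B * (∫⁻ t in Set.Ioc (0 : ℝ) 1, ENNReal.ofReal (t ^ (-a))) ^ p := by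
  set ν := (volume : Measure ℝ).restrict (Set.Ioc (0 : ℝ) 1) with hν
  set S := ∫⁻ t in Set.Ioc (0 : ℝ) 1, ENNReal.ofReal (t ^ (-a)) with hS
  set q := p / (p - 1) with hq
  have hpq : q.HolderConjugate p := (Real.HolderConjugate.conjExponent hp).symm
  have hq0 : 0 < q := div_pos (by linarith) (by linarith)
  have hp0 : 0 < p := by linarith
  have hGx : ∀ x, Measurable fun t => G t x := fun x => hG.comp measurable_prodMk_right
  have hGt : ∀ t, Measurable fun x => G t x := fun t => hG.comp measurable_prodMk_left
  -- Hölder in t with the weight t^{-a}: one factor yields the integral S, the other keeps G with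
  -- the compensating weight t^{a(p-1)}.
  have key : ∀ x, (∫⁻ t, G t x ∂ν) ^ p ≤
      S ^ (p - 1) * ∫⁻ t, ENNReal.ofReal (t ^ (a * (p - 1))) * G t x ^ p ∂ν := by
    intro x
    have := ENNReal.lintegral_mul_le_Lp_mul_Lq ν hpq
      (f := fun t => ENNReal.ofReal (t ^ (-a / q))) (g := fun t => ENNReal.ofReal (t ^ (a / q)) * G t x)
      (by fun_prop) (by fun_prop)
    have e1 : ∫⁻ t, ((fun t => ENNReal.ofReal (t ^ (-a / q))) * fun t =>
        ENNReal.ofReal (t ^ (a / q)) * G t x) t ∂ν = ∫⁻ t, G t x ∂ν := by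
      refine setLIntegral_congr_fun measurableSet_Ioc fun t ht => ?_
      simp only [Pi.mul_apply]
      rw [← mul_assoc, ← ENNReal.ofReal_mul (by have := ht.1; positivity), ← Real.rpow_add ht.1]
      simp [neg_div]
    have e2 : ∫⁻ t, ENNReal.ofReal (t ^ (-a / q)) ^ q ∂ν = S := by
      refine setLIntegral_congr_fun measurableSet_Ioc fun t ht => ?_
      have := ht.1
      rw [ENNReal.ofReal_rpow_of_pos (by positivity), ← Real.rpow_mul this.le]
      congr 2; field_simp
    have e3 : ∫⁻ t, (ENNReal.ofReal (t ^ (a / q)) * G t x) ^ p ∂ν =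
        ∫⁻ t, ENNReal.ofReal (t ^ (a * (p - 1))) * G t x ^ p ∂ν := by
      refine setLIntegral_congr_fun measurableSet_Ioc fun t ht => ?_
      have := ht.1
      rw [ENNReal.mul_rpow_of_nonneg _ _ hp0.le, ENNReal.ofReal_rpow_of_pos (by positivity),
        ← Real.rpow_mul this.le]
      congr 3
      have : p - 1 ≠ 0 := by linarith
      rw [hq]; field_simp
    rw [e1, e2, e3] at this
    calc (∫⁻ t, G t x ∂ν) ^ p ≤ (S ^ (1 / q) *
          (∫⁻ t, ENNReal.ofReal (t ^ (a * (p - 1))) * G t x ^ p ∂ν) ^ (1 / p)) ^ p := by gcongr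
      _ = _ := by
        rw [ENNReal.mul_rpow_of_nonneg _ _ hp0.le, ← ENNReal.rpow_mul, ← ENNReal.rpow_mul]
        have h1 : 1 / q * p = p - 1 := by
          have : p - 1 ≠ 0 := by linarith
          rw [hq]; field_simp
        have h2 : 1 / p * p = 1 := by field_simp
        rw [h1, h2, ENNReal.rpow_one]
  calc ∫⁻ x, (∫⁻ t, G t x ∂ν) ^ p
      ≤ ∫⁻ x, S ^ (p - 1) * ∫⁻ t, ENNReal.ofReal (t ^ (a * (p - 1))) * G t x ^ p ∂ν := by
        gcongr with x; exact key x
    _ = S ^ (p - 1) * ∫⁻ x, ∫⁻ t, ENNReal.ofReal (t ^ (a * (p - 1))) * G t x ^ p ∂ν := by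
        rw [lintegral_const_mul]
        refine Measurable.lintegral_prod_right' (f := fun z : E × ℝ =>
          ENNReal.ofReal (z.2 ^ (a * (p - 1))) * G z.2 z.1 ^ p) ?_
        have : Measurable fun z : E × ℝ => G z.2 z.1 := hG.comp measurable_swap
        fun_prop
    _ = S ^ (p - 1) * ∫⁻ t, (∫⁻ x, ENNReal.ofReal (t ^ (a * (p - 1))) * G t x ^ p) ∂ν := by
        rw [lintegral_lintegral_swap]
        have : Measurable fun z : E × ℝ => G z.2 z.1 := hG.comp measurable_swap
        apply Measurable.aemeasurable
        simp only [Function.uncurry_def]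
        fun_prop
    _ ≤ S ^ (p - 1) * ∫⁻ t, B * ENNReal.ofReal (t ^ (-a)) ∂ν := by
        refine mul_le_mul_right (setLIntegral_mono' measurableSet_Ioc fun t ht => ?_) _
        have h0 := ht.1
        rw [lintegral_const_mul _ ((hGt t).pow_const p)]
        calc ENNReal.ofReal (t ^ (a * (p - 1))) * ∫⁻ x, G t x ^ p
            ≤ ENNReal.ofReal (t ^ (a * (p - 1))) * (B * ENNReal.ofReal (t ^ (-(a * p)))) := by
              gcongr; exact hB t ht
          _ = _ := by
              rw [mul_left_comm, ← ENNReal.ofReal_mul (by positivity), ← Real.rpow_add h0]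
              congr 3; ring
    _ = _ := by
        rw [lintegral_const_mul _ (by fun_prop), ← hS, mul_left_comm]
        congr 1
        nth_rw 2 [← ENNReal.rpow_one S]
        rw [← ENNReal.rpow_add_of_nonneg _ _ (by linarith) (by norm_num)]
        congr 1; ring

end Averaging

/-! ### Mollifiers and the gradient estimate for smooth functions -/

section Mollification

variable {E : Type*} [NormedAddCommGroup E] [InnerProductSpace ℝ E] [FiniteDimensional ℝ E]
  [MeasurableSpace E] [BorelSpace E]
variable {F : Type*} [NormedAddCommGroup F] [NormedSpace ℝ F]

/-- The mollification of `u` by a normed bump function. -/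
noncomputable def moll (φ : ContDiffBump (0 : E)) (u : E → F) (x : E) : F :=
  ∫ z, φ.normed volume z • u (x - z)

theorem moll_eq_convolution (φ : ContDiffBump (0 : E)) (u : E → F) :
    moll φ u = convolution (φ.normed volume) u (ContinuousLinearMap.lsmul ℝ ℝ) volume := rfl

theorem moll_congr_ae (φ : ContDiffBump (0 : E)) {u u' : E → F} (h : u =ᵐ[volume] u') :
    moll φ u = moll φ u' := by
  ext x
  refine integral_congr_ae ?_
  have : (fun z => u (x - z)) =ᵐ[volume] fun z => u' (x - z) :=
    (quasiMeasurePreserving_sub_left volume x).ae_eq_comp h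
  filter_upwards [this] with z hz
  rw [hz]

/-- The kernel of a normed bump function with values in `[0, ∞]`. -/
noncomputable def bumpKernel (φ : ContDiffBump (0 : E)) (z : E) : ℝ≥0∞ :=
  ENNReal.ofReal (φ.normed volume z)

/-- An upper bound for normed bump functions of outer radius `R`. -/
noncomputable def kernelBound (E : Type*) [NormedAddCommGroup E] [InnerProductSpace ℝ E]
    [MeasurableSpace E] [BorelSpace E] [FiniteDimensional ℝ E] (R : ℝ) : ℝ≥0∞ :=
  ENNReal.ofReal (2 ^ Module.finrank ℝ E / volume.real (Metric.closedBall (0 : E) R))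

theorem measurable_bumpKernel (φ : ContDiffBump (0 : E)) : Measurable (bumpKernel φ) :=
  (φ.continuous_normed (μ := volume)).measurable.ennreal_ofReal

theorem bumpKernel_ne_top (φ : ContDiffBump (0 : E)) (z : E) : bumpKernel φ z ≠ ⊤ :=
  ENNReal.ofReal_ne_top

theorem kernelBound_ne_top (R : ℝ) : kernelBound E R ≠ ⊤ := ENNReal.ofReal_ne_top

theorem lintegral_bumpKernel (φ : ContDiffBump (0 : E)) : ∫⁻ z, bumpKernel φ z = 1 := by
  unfold bumpKernel
  rw [← ofReal_integral_eq_lintegral_ofReal φ.integrable_normed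
    (ae_of_all _ fun z => φ.nonneg_normed z), φ.integral_normed]
  simp

theorem bumpKernel_le (φ : ContDiffBump (0 : E)) (hφ : φ.rOut ≤ 2 * φ.rIn) (z : E) :
    bumpKernel φ z ≤ kernelBound E φ.rOut :=
  ENNReal.ofReal_le_ofReal (φ.normed_le_div_measure_closedBall_rOut volume 2 hφ z)

theorem enorm_normed (φ : ContDiffBump (0 : E)) (z : E) :
    ‖φ.normed volume z‖ₑ = bumpKernel φ z :=
  Real.enorm_eq_ofReal (φ.nonneg_normed z)

theorem enorm_moll_le (φ : ContDiffBump (0 : E)) (u : E → F) (x : E) :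
    ‖moll φ u x‖ₑ ≤ ∫⁻ z, bumpKernel φ z * ‖u (x - z)‖ₑ := by
  refine (enorm_integral_le_lintegral_enorm _).trans_eq (lintegral_congr fun z => ?_)
  rw [enorm_smul, enorm_normed]

theorem enorm_moll_rpow_le (φ : ContDiffBump (0 : E)) {u : E → F}
    (hu : AEStronglyMeasurable u volume) {p : ℝ} (hp : 1 < p) (x : E) :
    ‖moll φ u x‖ₑ ^ p ≤ ∫⁻ z, bumpKernel φ z * ‖u (x - z)‖ₑ ^ p := by
  have hae : (fun z => u (x - z)) =ᵐ[volume] fun z => hu.mk u (x - z) :=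
    (quasiMeasurePreserving_sub_left volume x).ae_eq_comp hu.ae_eq_mk
  have hm : Measurable fun z => ‖hu.mk u z‖ₑ := hu.stronglyMeasurable_mk.enorm
  calc ‖moll φ u x‖ₑ ^ p = ‖moll φ (hu.mk u) x‖ₑ ^ p := by rw [moll_congr_ae φ hu.ae_eq_mk]
    _ ≤ (∫⁻ z, bumpKernel φ z * ‖hu.mk u (x - z)‖ₑ) ^ p := by
        gcongr; exact enorm_moll_le φ _ x
    _ ≤ ∫⁻ z, bumpKernel φ z * ‖hu.mk u (x - z)‖ₑ ^ p :=
        rpow_lintegral_mul_le _ _ (measurable_bumpKernel φ)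
          (hm.comp (measurable_const.sub measurable_id)) (lintegral_bumpKernel φ).le hp
    _ = _ := by
        refine lintegral_congr_ae ?_
        filter_upwards [hae] with z hz
        simp only [hz]

theorem enorm_moll_rpow_le_bound (φ : ContDiffBump (0 : E)) (hφ : φ.rOut ≤ 2 * φ.rIn) {u : E → F}
    (hu : AEStronglyMeasurable u volume) {p : ℝ} (hp : 1 < p) (x : E) :
    ‖moll φ u x‖ₑ ^ p ≤ kernelBound E φ.rOut * ∫⁻ z, ‖u z‖ₑ ^ p := by
  refine (enorm_moll_rpow_le φ hu hp x).trans ?_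
  calc ∫⁻ z, bumpKernel φ z * ‖u (x - z)‖ₑ ^ p
      ≤ ∫⁻ z, kernelBound E φ.rOut * ‖u (x - z)‖ₑ ^ p := by
        gcongr with z; exact bumpKernel_le φ hφ z
    _ = _ := by
        rw [lintegral_const_mul' _ _ (kernelBound_ne_top _),
          lintegral_sub_left_eq_self (fun z => ‖u z‖ₑ ^ p) x]

theorem lintegral_moll_rpow_le (φ : ContDiffBump (0 : E)) {u : E → F}
    (hu : AEStronglyMeasurable u volume) {p : ℝ} (hp : 1 < p) :
    ∫⁻ x, ‖moll φ u x‖ₑ ^ p ≤ ∫⁻ x, ‖u x‖ₑ ^ p := by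
  have hm : Measurable fun z => ‖hu.mk u z‖ₑ := hu.stronglyMeasurable_mk.enorm
  rw [moll_congr_ae φ hu.ae_eq_mk]
  calc ∫⁻ x, ‖moll φ (hu.mk u) x‖ₑ ^ p
      ≤ ∫⁻ x, ∫⁻ z, bumpKernel φ z * ‖hu.mk u (x - (1 : ℝ) • z)‖ₑ ^ p := by
        gcongr with x
        simpa using enorm_moll_rpow_le φ hu.stronglyMeasurable_mk.aestronglyMeasurable hp x
    _ ≤ ∫⁻ x, ‖hu.mk u x‖ₑ ^ p :=
        lintegral_lintegral_mul_comp_sub_smul _ (fun y => ‖hu.mk u y‖ₑ ^ p)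
          (measurable_bumpKernel φ) (hm.pow_const p) (lintegral_bumpKernel φ).le 1
    _ = _ := by
        refine lintegral_congr_ae ?_
        filter_upwards [hu.ae_eq_mk] with z hz
        simp only [hz]

/-- The half of the embedding H¹ ⊂ L^p that needs no derivative: mollification at a fixed scale maps
L² into L^p. -/
theorem lintegral_moll_rpow_le_of_sq (φ : ContDiffBump (0 : E)) (hφ : φ.rOut ≤ 2 * φ.rIn)
    {u : E → F} (hu : AEStronglyMeasurable u volume) {p : ℝ} (hp : 2 < p) :
    ∫⁻ x, ‖moll φ u x‖ₑ ^ p ≤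
      kernelBound E φ.rOut ^ ((p - 2) / 2) * (∫⁻ x, ‖u x‖ₑ ^ (2 : ℝ)) ^ (p / 2) := by
  have hm : Measurable fun z => ‖hu.mk u z‖ₑ := hu.stronglyMeasurable_mk.enorm
  rw [moll_congr_ae φ hu.ae_eq_mk]
  calc ∫⁻ x, ‖moll φ (hu.mk u) x‖ₑ ^ p
      ≤ ∫⁻ x, (∫⁻ z, bumpKernel φ z * ‖hu.mk u (x - (1 : ℝ) • z)‖ₑ) ^ p := by
        gcongr with x
        simpa using enorm_moll_le φ _ x
    _ ≤ _ := lintegral_average_rpow_le _ (fun y => ‖hu.mk u y‖ₑ) (measurable_bumpKernel φ) hm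
          (lintegral_bumpKernel φ).le (bumpKernel_le φ hφ) one_ne_zero hp
    _ = _ := by
        simp only [abs_one, inv_one, one_pow, ENNReal.ofReal_one, mul_one]
        congr 2
        refine lintegral_congr_ae ?_
        filter_upwards [hu.ae_eq_mk] with z hz
        simp only [hz]

theorem enorm_sub_le_lintegral_fderiv {f : E → ℝ} (hf : ContDiff ℝ 1 f) (x z : E) :
    ‖f x - f (x - z)‖ₑ ≤
      ∫⁻ t in Set.Ioc (0 : ℝ) 1, ‖fderiv ℝ f (x - t • z)‖ₑ * ‖z‖ₑ := by
  have hd : ∀ t ∈ Set.uIcc (0 : ℝ) 1, HasDerivAt (fun t : ℝ => f (x - t • z))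
      (fderiv ℝ f (x - t • z) (-z)) t := by
    intro t _
    have h1 : HasDerivAt (fun t : ℝ => x - t • z) (-z) t := by
      simpa using ((hasDerivAt_id t).smul_const z).const_sub x
    exact ((hf.differentiable one_ne_zero) (x - t • z)).hasFDerivAt.comp_hasDerivAt t h1
  have hc : Continuous fun t : ℝ => fderiv ℝ f (x - t • z) (-z) := by
    have := hf.continuous_fderiv one_ne_zero
    fun_prop
  have := intervalIntegral.integral_eq_sub_of_hasDerivAt hd (hc.intervalIntegrable 0 1)
  simp only [one_smul, zero_smul, sub_zero] at this
  rw [← enorm_neg, neg_sub, ← this, intervalIntegral.integral_of_le zero_le_one]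
  refine (enorm_integral_le_lintegral_enorm _).trans (lintegral_mono fun t => ?_)
  refine (ContinuousLinearMap.le_opENorm _ _).trans_eq ?_
  rw [enorm_neg]

/-- The fundamental theorem of calculus on the segment from x to x - z is averaged over z, with ‖z‖
at most the outer radius on the support of the kernel. For fixed t the inner integral is an average
of |∇f| at scale t, to which `lintegral_average_rpow_le` applies. -/
theorem enorm_sub_moll_le_of_contDiff (φ : ContDiffBump (0 : E)) {f : E → ℝ} (hf : ContDiff ℝ 1 f)
    (x : E) : ‖f x - moll φ f x‖ₑ ≤ ∫⁻ t in Set.Ioc (0 : ℝ) 1,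
      ENNReal.ofReal φ.rOut * ∫⁻ z, bumpKernel φ z * ‖fderiv ℝ f (x - t • z)‖ₑ := by
  have hcf := hf.continuous_fderiv one_ne_zero
  have hmf : Measurable fun y => ‖fderiv ℝ f y‖ₑ := hcf.enorm.measurable
  have hmk := measurable_bumpKernel φ
  have hint : Integrable fun z => φ.normed volume z • f (x - z) :=
    Continuous.integrable_of_hasCompactSupport
      (φ.continuous_normed.smul (hf.continuous.comp (continuous_const.sub continuous_id)))
      (φ.hasCompactSupport_normed.smul_right)
  have h1 : f x - moll φ f x = ∫ z, φ.normed volume z • (f x - f (x - z)) := by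
    simp_rw [smul_sub]
    rw [integral_sub (φ.integrable_normed.smul_const _) hint, integral_smul_const,
      φ.integral_normed, one_smul]
    rfl
  rw [h1]
  calc ‖∫ z, φ.normed volume z • (f x - f (x - z))‖ₑ
      ≤ ∫⁻ z, bumpKernel φ z * ‖f x - f (x - z)‖ₑ := by
        refine (enorm_integral_le_lintegral_enorm _).trans_eq (lintegral_congr fun z => ?_)
        rw [enorm_smul, enorm_normed]
    _ ≤ ∫⁻ z, ∫⁻ t in Set.Ioc (0 : ℝ) 1,
          ENNReal.ofReal φ.rOut * (bumpKernel φ z * ‖fderiv ℝ f (x - t • z)‖ₑ) := by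
        gcongr with z
        by_cases hz : z ∈ Metric.ball (0 : E) φ.rOut
        · have hz' : ‖z‖ₑ ≤ ENNReal.ofReal φ.rOut := by
            rw [← ofReal_norm]
            exact ENNReal.ofReal_le_ofReal (mem_ball_zero_iff.1 hz).le
          calc bumpKernel φ z * ‖f x - f (x - z)‖ₑ
              ≤ bumpKernel φ z * ∫⁻ t in Set.Ioc (0 : ℝ) 1, ‖fderiv ℝ f (x - t • z)‖ₑ * ‖z‖ₑ := by
                gcongr; exact enorm_sub_le_lintegral_fderiv hf x z
            _ = ∫⁻ t in Set.Ioc (0 : ℝ) 1, bumpKernel φ z * (‖fderiv ℝ f (x - t • z)‖ₑ * ‖z‖ₑ) := by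
                rw [lintegral_const_mul' _ _ (bumpKernel_ne_top φ z)]
            _ ≤ _ := by
                refine lintegral_mono fun t => ?_
                rw [mul_comm (ENNReal.ofReal φ.rOut), mul_assoc]
                gcongr
        · have : bumpKernel φ z = 0 := by
            have h0 : z ∉ Function.support (φ.normed volume) := by rwa [φ.support_normed_eq]
            simp [bumpKernel, Function.notMem_support.1 h0]
          simp [this]
    _ = ∫⁻ t in Set.Ioc (0 : ℝ) 1, ∫⁻ z,
          ENNReal.ofReal φ.rOut * (bumpKernel φ z * ‖fderiv ℝ f (x - t • z)‖ₑ) := by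
        rw [lintegral_lintegral_swap]
        apply Measurable.aemeasurable
        simp only [Function.uncurry_def]
        have : Measurable fun a : E × ℝ => ‖fderiv ℝ f (x - a.2 • a.1)‖ₑ :=
          hmf.comp (by fun_prop)
        fun_prop
    _ = _ := by
        refine lintegral_congr fun t => ?_
        rw [lintegral_const_mul' _ _ ENNReal.ofReal_ne_top]

/-- The exponent of the singularity in the mollification estimate. -/
noncomputable def singExp (n : ℕ) (p : ℝ) : ℝ := n * (p - 2) / (2 * p)

/-- The constant in the mollification estimate at scale `R`. -/
noncomputable def mollConst (E : Type*) [NormedAddCommGroup E] [InnerProductSpace ℝ E]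
    [MeasurableSpace E] [BorelSpace E] [FiniteDimensional ℝ E] (p R : ℝ) : ℝ≥0∞ :=
  ENNReal.ofReal R ^ p * kernelBound E R ^ ((p - 2) / 2) *
    (∫⁻ t in Set.Ioc (0 : ℝ) 1,
      ENNReal.ofReal (t ^ (-(singExp (Module.finrank ℝ E) p)))) ^ p

/-- The L² → L^p bound at scale t costs t^{-N(p-2)/2} in the p-th power, that is t^{-ap} with a =
`singExp`. Minkowski's inequality in t leaves the integral of t^{-a} over (0, 1], which is finite
when a < 1. -/
theorem lintegral_sub_moll_rpow_le_of_contDiff (φ : ContDiffBump (0 : E))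
    (hφ : φ.rOut ≤ 2 * φ.rIn) {f : E → ℝ} (hf : ContDiff ℝ 1 f) {p : ℝ} (hp : 2 < p) :
    ∫⁻ x, ‖f x - moll φ f x‖ₑ ^ p ≤
      mollConst E p φ.rOut * (∫⁻ x, ‖fderiv ℝ f x‖ₑ ^ (2 : ℝ)) ^ (p / 2) := by
  have hcf := hf.continuous_fderiv one_ne_zero
  have hmf : Measurable fun y => ‖fderiv ℝ f y‖ₑ := hcf.enorm.measurable
  have hmk := measurable_bumpKernel φ
  have hp0 : 0 < p := by linarith
  set I := ∫⁻ x, ‖fderiv ℝ f x‖ₑ ^ (2 : ℝ) with hI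
  have := lintegral_lintegral_Ioc_rpow_le (a := singExp (Module.finrank ℝ E) p) (p := p)
    (fun t x => ENNReal.ofReal φ.rOut * ∫⁻ z, bumpKernel φ z * ‖fderiv ℝ f (x - t • z)‖ₑ)
    (B := ENNReal.ofReal φ.rOut ^ p * kernelBound E φ.rOut ^ ((p - 2) / 2) * I ^ (p / 2))
    (by
      simp only [Function.uncurry_def]
      refine Measurable.const_mul ?_ _
      refine Measurable.lintegral_prod_right' (f := fun a : (ℝ × E) × E =>
        bumpKernel φ a.2 * ‖fderiv ℝ f (a.1.2 - a.1.1 • a.2)‖ₑ) ?_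
      have : Measurable fun a : (ℝ × E) × E => ‖fderiv ℝ f (a.1.2 - a.1.1 • a.2)‖ₑ :=
        hmf.comp (by fun_prop)
      fun_prop)
    (by linarith)
    (by
      intro t ht
      simp_rw [ENNReal.mul_rpow_of_nonneg _ _ hp0.le]
      rw [lintegral_const_mul' _ _ (ENNReal.rpow_ne_top_of_nonneg hp0.le ENNReal.ofReal_ne_top),
        mul_assoc, mul_assoc]
      gcongr
      refine (lintegral_average_rpow_le _ _ hmk hmf (lintegral_bumpKernel φ).le
        (bumpKernel_le φ hφ) ht.1.ne' hp).trans_eq ?_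
      rw [ENNReal.mul_rpow_of_nonneg _ _ (by linarith), mul_assoc, mul_comm (ENNReal.ofReal _ ^ _)]
      congr 2
      have h0 := ht.1
      rw [ENNReal.ofReal_rpow_of_pos (by positivity), abs_of_pos h0, ← Real.rpow_natCast,
        ← Real.rpow_mul (by positivity), Real.inv_rpow h0.le, ← Real.rpow_neg h0.le]
      congr 2
      unfold singExp
      field_simp)
  calc ∫⁻ x, ‖f x - moll φ f x‖ₑ ^ p
      ≤ ∫⁻ x, (∫⁻ t in Set.Ioc (0 : ℝ) 1,
        ENNReal.ofReal φ.rOut * ∫⁻ z, bumpKernel φ z * ‖fderiv ℝ f (x - t • z)‖ₑ) ^ p := by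
        gcongr with x
        exact enorm_sub_moll_le_of_contDiff φ hf x
    _ ≤ _ := this
    _ = _ := by unfold mollConst; ring

theorem kernelBound_eq (hE : 1 ≤ Module.finrank ℝ E) {R : ℝ} (hR : 0 < R) : kernelBound E R =
    ENNReal.ofReal (2 ^ Module.finrank ℝ E / volume.real (Metric.ball (0 : E) 1) *
      R⁻¹ ^ Module.finrank ℝ E) := by
  have : Nontrivial E := Module.nontrivial_of_finrank_pos (R := ℝ) (by omega)
  unfold kernelBound
  rw [measureReal_def, Measure.addHaar_closedBall _ _ hR.le, ENNReal.toReal_mul,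
    ENNReal.toReal_ofReal (by positivity), ← measureReal_def]
  congr 1
  rw [inv_pow]; field_simp

/-- Averages over large balls are uniformly small; this later allows a multiple of the full L^p mass
to be absorbed. -/
theorem tendsto_kernelBound_atTop (hE : 1 ≤ Module.finrank ℝ E) :
    Tendsto (kernelBound E) atTop (𝓝 0) := by
  have h1 : Tendsto (fun R : ℝ => ENNReal.ofReal (2 ^ Module.finrank ℝ E /
      volume.real (Metric.ball (0 : E) 1) * R⁻¹ ^ Module.finrank ℝ E)) atTop (𝓝 0) := by
    rw [← ENNReal.ofReal_zero]
    refine ENNReal.tendsto_ofReal ?_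
    have := (tendsto_inv_atTop_zero (𝕜 := ℝ)).pow (Module.finrank ℝ E)
    rw [zero_pow (by omega)] at this
    simpa using this.const_mul (2 ^ Module.finrank ℝ E / volume.real (Metric.ball (0 : E) 1))
  refine h1.congr' ?_
  filter_upwards [eventually_gt_atTop 0] with R hR
  rw [kernelBound_eq hE hR]

theorem lintegral_Ioc_rpow_ne_top {a : ℝ} (ha : a < 1) :
    ∫⁻ t in Set.Ioc (0 : ℝ) 1, ENNReal.ofReal (t ^ (-a)) ≠ ⊤ := by
  have h := intervalIntegral.intervalIntegrable_rpow' (a := 0) (b := 1) (r := -a) (by linarith)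
  rw [intervalIntegrable_iff_integrableOn_Ioc_of_le zero_le_one] at h
  exact (Integrable.lintegral_lt_top h).ne

theorem mollConst_ne_top {p R : ℝ} (hp : 2 < p) (ha : singExp (Module.finrank ℝ E) p < 1) :
    mollConst E p R ≠ ⊤ := by
  unfold mollConst
  refine ENNReal.mul_ne_top (ENNReal.mul_ne_top ?_ ?_) ?_
  · exact ENNReal.rpow_ne_top_of_nonneg (by linarith) ENNReal.ofReal_ne_top
  · exact ENNReal.rpow_ne_top_of_nonneg (by linarith) (kernelBound_ne_top _)
  · exact ENNReal.rpow_ne_top_of_nonneg (by linarith) (lintegral_Ioc_rpow_ne_top ha)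

/-- The constant is a fixed multiple of R to the power p - N(p-2)/2 = p(1 - a), and a < 1 makes this
exponent positive. -/
theorem tendsto_mollConst (hE : 1 ≤ Module.finrank ℝ E) {p : ℝ} (hp : 2 < p)
    (ha : singExp (Module.finrank ℝ E) p < 1) :
    Tendsto (mollConst E p) (𝓝[>] 0) (𝓝 0) := by
  set n := Module.finrank ℝ E with hn
  set b := 2 ^ n / volume.real (Metric.ball (0 : E) 1) with hb
  have hb0 : 0 ≤ b := by positivity
  have hpos : 0 < p - n * (p - 2) / 2 := by
    unfold singExp at ha
    rw [div_lt_one (by linarith)] at ha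
    linarith
  have h1 : Tendsto (fun R : ℝ => ENNReal.ofReal (R ^ (p - n * (p - 2) / 2) * b ^ ((p - 2) / 2)) *
      (∫⁻ t in Set.Ioc (0 : ℝ) 1, ENNReal.ofReal (t ^ (-(singExp n p)))) ^ p) (𝓝[>] 0) (𝓝 0) := by
    rw [← zero_mul ((∫⁻ t in Set.Ioc (0 : ℝ) 1, ENNReal.ofReal (t ^ (-(singExp n p)))) ^ p)]
    refine ENNReal.Tendsto.mul_const ?_ (Or.inr
      (ENNReal.rpow_ne_top_of_nonneg (by linarith) (lintegral_Ioc_rpow_ne_top ha)))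
    rw [← ENNReal.ofReal_zero]
    refine ENNReal.tendsto_ofReal ?_
    have h2 : Tendsto (fun R : ℝ => R ^ (p - n * (p - 2) / 2)) (𝓝[>] 0) (𝓝 0) := by
      have := (Real.continuousAt_rpow_const 0 (p - n * (p - 2) / 2) (Or.inr hpos.le)).tendsto
      rw [Real.zero_rpow hpos.ne'] at this
      exact this.mono_left nhdsWithin_le_nhds
    simpa using h2.mul_const (b ^ ((p - 2) / 2))
  refine h1.congr' ?_
  filter_upwards [self_mem_nhdsWithin] with R hR
  have hR' : 0 < R := hR
  unfold mollConst
  congr 1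
  rw [kernelBound_eq hE hR', ENNReal.ofReal_rpow_of_pos hR',
    ENNReal.ofReal_rpow_of_nonneg (by positivity) (by linarith),
    ← ENNReal.ofReal_mul (by positivity)]
  congr 1
  rw [Real.mul_rpow hb0 (by positivity), ← Real.rpow_natCast, ← Real.rpow_mul (by positivity),
    Real.inv_rpow hR'.le, ← Real.rpow_neg hR'.le, mul_left_comm, ← Real.rpow_add hR', mul_comm]
  congr 2
  ring

/-- A bump function of outer radius `R`. -/
noncomputable def stdBump (E : Type*) [NormedAddCommGroup E] [InnerProductSpace ℝ E]
    (R : ℝ) (hR : 0 < R) : ContDiffBump (0 : E) :=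
  ⟨R / 2, R, by linarith, by linarith⟩

theorem stdBump_rOut_le (R : ℝ) (hR : 0 < R) :
    (stdBump E R hR).rOut ≤ 2 * (stdBump E R hR).rIn := by
  change R ≤ 2 * (R / 2)
  linarith

/-- A sequence of bump functions shrinking to the origin. -/
noncomputable def bumpSeq (E : Type*) [NormedAddCommGroup E] [InnerProductSpace ℝ E] (n : ℕ) :
    ContDiffBump (0 : E) :=
  stdBump E (1 / ((n : ℝ) + 1)) (by positivity)

theorem bumpSeq_rOut_le (n : ℕ) : (bumpSeq E n).rOut ≤ 2 * (bumpSeq E n).rIn :=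
  stdBump_rOut_le _ _

theorem tendsto_bumpSeq_rOut : Tendsto (fun n => (bumpSeq E n).rOut) atTop (𝓝[>] 0) := by
  refine tendsto_nhdsWithin_iff.2 ⟨tendsto_one_div_add_atTop_nhds_zero_nat, ?_⟩
  exact Eventually.of_forall fun n => (bumpSeq E n).rOut_pos

theorem tendsto_moll_bumpSeq_ae [CompleteSpace F] {u : E → F} (hu : LocallyIntegrable u volume) :
    ∀ᵐ x, Tendsto (fun n => moll (bumpSeq E n) u x) atTop (𝓝 (u x)) :=
  ContDiffBump.ae_convolution_tendsto_right_of_locallyIntegrable (K := 2)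
    (tendsto_nhdsWithin_iff.1 tendsto_bumpSeq_rOut).1
    (Eventually.of_forall bumpSeq_rOut_le) hu

theorem tendsto_moll_bumpSeq_of_continuous [CompleteSpace F] {u : E → F} (hu : Continuous u)
    (x : E) : Tendsto (fun n => moll (bumpSeq E n) u x) atTop (𝓝 (u x)) :=
  ContDiffBump.convolution_tendsto_right_of_continuous
    (tendsto_nhdsWithin_iff.1 tendsto_bumpSeq_rOut).1 hu x

theorem continuous_moll (φ : ContDiffBump (0 : E)) {u : E → F}
    (hu : LocallyIntegrable u volume) : Continuous (moll φ u) := by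
  rw [moll_eq_convolution]
  exact φ.hasCompactSupport_normed.continuous_convolution_left _ φ.continuous_normed hu

theorem contDiff_moll (φ : ContDiffBump (0 : E)) {u : E → F}
    (hu : LocallyIntegrable u volume) {n : ℕ∞} : ContDiff ℝ n (moll φ u) := by
  rw [moll_eq_convolution]
  exact φ.hasCompactSupport_normed.contDiff_convolution_left _ φ.contDiff_normed hu

/-- Needed when the smooth estimate is applied to mollifications of u: moll φ (moll ψ u) becomes a
mollification of the continuous function moll φ u, hence converges at every point as ψ shrinks. -/
theorem moll_comm (φ ψ : ContDiffBump (0 : E)) {u : E → ℝ} (hu : LocallyIntegrable u volume) :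
    moll φ (moll ψ u) = moll ψ (moll φ u) := by
  have hun : LocallyIntegrable (fun x => ‖u x‖) volume := fun x =>
    let ⟨s, hs, h⟩ := hu x
    ⟨s, hs, h.norm⟩
  have assoc : ∀ φ ψ : ContDiffBump (0 : E),
      convolution (convolution (φ.normed volume) (ψ.normed volume)
        (ContinuousLinearMap.lsmul ℝ ℝ) volume) u (ContinuousLinearMap.lsmul ℝ ℝ) volume =
      moll φ (moll ψ u) := by
    intro φ ψ
    ext x
    rw [moll_eq_convolution φ, moll_eq_convolution ψ]
    refine convolution_assoc (ContinuousLinearMap.lsmul ℝ ℝ) (ContinuousLinearMap.lsmul ℝ ℝ)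
      (ContinuousLinearMap.lsmul ℝ ℝ) (ContinuousLinearMap.lsmul ℝ ℝ) (fun a b c => by simp [mul_assoc])
      φ.continuous_normed.aestronglyMeasurable ψ.continuous_normed.aestronglyMeasurable
      hu.aestronglyMeasurable ?_ ?_ ?_
    · exact ae_of_all _ (φ.hasCompactSupport_normed.convolutionExists_left _ φ.continuous_normed
        ψ.continuous_normed.locallyIntegrable)
    · exact ae_of_all _ (ψ.hasCompactSupport_normed.norm.convolutionExists_left _
        ψ.continuous_normed.norm hun)
    · refine φ.hasCompactSupport_normed.norm.convolutionExists_left _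
        φ.continuous_normed.norm (Continuous.locallyIntegrable ?_) x
      exact ψ.hasCompactSupport_normed.norm.continuous_convolution_left _
        ψ.continuous_normed.norm hun
  rw [← assoc φ ψ, ← assoc ψ φ]
  congr 1
  ext x
  simp only [convolution_def]
  rw [← integral_sub_left_eq_self _ volume x]
  simp [mul_comm]

end Mollification

/-! ### Calculus of weak gradients -/

section WeakGradient

/-- The Euclidean space `ℝᴺ`. -/
abbrev Euc (N : ℕ) := EuclideanSpace ℝ (Fin N)

variable {N : ℕ}

theorem HasWeakGradient.congr {u u' : Euc N → ℝ} {g g' : Euc N → Euc N} (h : HasWeakGradient u g)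
    (hu : u =ᵐ[volume] u') (hg : g =ᵐ[volume] g') : HasWeakGradient u' g' where
  locallyIntegrable := h.locallyIntegrable.congr hu
  locallyIntegrable_grad := h.locallyIntegrable_grad.congr hg
  integral_eq φ hφ hc := by
    have h1 : ∫ x, u' x • gradient φ x = ∫ x, u x • gradient φ x :=
      integral_congr_ae (by filter_upwards [hu] with x hx; rw [hx])
    have h2 : ∫ x, φ x • g' x = ∫ x, φ x • g x :=
      integral_congr_ae (by filter_upwards [hg] with x hx; rw [hx])
    rw [h1, h2, h.integral_eq φ hφ hc]

theorem weakGrad_spec {u : Euc N → ℝ} {g : Euc N → Euc N} (h : HasWeakGradient u g) :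
    HasWeakGradient u (weakGrad u) := by
  unfold weakGrad
  rw [dif_pos ⟨g, h⟩]
  exact (⟨g, h⟩ : ∃ g, HasWeakGradient u g).choose_spec

theorem HasWeakGradient.weakGrad_ae {u : Euc N → ℝ} {g : Euc N → Euc N}
    (h : HasWeakGradient u g) : weakGrad u =ᵐ[volume] g :=
  (weakGrad_spec h).ae_eq h

theorem gradient_eq_toDual_symm (f : Euc N → ℝ) :
    gradient f = fun x => (InnerProductSpace.toDual ℝ (Euc N)).symm (fderiv ℝ f x) := rfl

theorem continuous_gradient {f : Euc N → ℝ} (hf : ContDiff ℝ 1 f) : Continuous (gradient f) :=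
  (InnerProductSpace.toDual ℝ (Euc N)).symm.continuous.comp (hf.continuous_fderiv one_ne_zero)

theorem hasCompactSupport_gradient {f : Euc N → ℝ} (hf : HasCompactSupport f) :
    HasCompactSupport (gradient f) :=
  (hf.fderiv ℝ).comp_left (g := (InnerProductSpace.toDual ℝ (Euc N)).symm) (map_zero _)

theorem norm_gradient (f : Euc N → ℝ) (x : Euc N) : ‖gradient f x‖ = ‖fderiv ℝ f x‖ :=
  LinearIsometryEquiv.norm_map _ _

theorem integrable_smul_gradient {u : Euc N → ℝ} (hu : LocallyIntegrable u volume)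
    {φ : Euc N → ℝ} (hφ : ContDiff ℝ ∞ φ) (hc : HasCompactSupport φ) :
    Integrable fun x => u x • gradient φ x :=
  hu.integrable_smul_right_of_hasCompactSupport (continuous_gradient (hφ.of_le (by simp)))
    (hasCompactSupport_gradient hc)

theorem integrable_smul_grad {g : Euc N → Euc N} (hg : LocallyIntegrable g volume)
    {φ : Euc N → ℝ} (hφ : Continuous φ) (hc : HasCompactSupport φ) :
    Integrable fun x => φ x • g x :=
  hg.integrable_smul_left_of_hasCompactSupport hφ hc

theorem HasWeakGradient.add {u u' : Euc N → ℝ} {g g' : Euc N → Euc N} (h : HasWeakGradient u g)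
    (h' : HasWeakGradient u' g') : HasWeakGradient (u + u') (g + g') where
  locallyIntegrable := h.locallyIntegrable.add h'.locallyIntegrable
  locallyIntegrable_grad := h.locallyIntegrable_grad.add h'.locallyIntegrable_grad
  integral_eq φ hφ hc := by
    simp only [Pi.add_apply, add_smul, smul_add]
    rw [integral_add (integrable_smul_gradient h.locallyIntegrable hφ hc)
      (integrable_smul_gradient h'.locallyIntegrable hφ hc),
      integral_add (integrable_smul_grad h.locallyIntegrable_grad hφ.continuous hc)
      (integrable_smul_grad h'.locallyIntegrable_grad hφ.continuous hc),
      h.integral_eq φ hφ hc, h'.integral_eq φ hφ hc, neg_add]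

theorem HasWeakGradient.const_smul {u : Euc N → ℝ} {g : Euc N → Euc N} (h : HasWeakGradient u g)
    (c : ℝ) : HasWeakGradient (c • u) (c • g) where
  locallyIntegrable := h.locallyIntegrable.smul c
  locallyIntegrable_grad := h.locallyIntegrable_grad.smul c
  integral_eq φ hφ hc := by
    simp only [Pi.smul_apply, smul_assoc]
    rw [integral_smul, h.integral_eq φ hφ hc, smul_neg, ← integral_smul]
    simp_rw [smul_comm c]

theorem HasWeakGradient.neg {u : Euc N → ℝ} {g : Euc N → Euc N} (h : HasWeakGradient u g) :
    HasWeakGradient (-u) (-g) := by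
  simpa using h.const_smul (-1)

theorem HasWeakGradient.sub {u u' : Euc N → ℝ} {g g' : Euc N → Euc N} (h : HasWeakGradient u g)
    (h' : HasWeakGradient u' g') : HasWeakGradient (u - u') (g - g') := by
  simpa [sub_eq_add_neg] using h.add h'.neg

theorem hasWeakGradient_of_contDiff {f : Euc N → ℝ} (hf : ContDiff ℝ 1 f) :
    HasWeakGradient f (gradient f) where
  locallyIntegrable := hf.continuous.locallyIntegrable
  locallyIntegrable_grad := (continuous_gradient hf).locallyIntegrable
  integral_eq φ hφ hc := by
    have hφ1 : ContDiff ℝ 1 φ := hφ.of_le (by simp)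
    have hcf := hf.continuous
    have hcφ := hφ1.continuous
    have hf' := hf.continuous_fderiv one_ne_zero
    have hφ' := hφ1.continuous_fderiv one_ne_zero
    refine ext_inner_left ℝ fun v => ?_
    rw [inner_neg_right, ← integral_inner
      (integrable_smul_gradient hcf.locallyIntegrable hφ hc), ← integral_inner
      (integrable_smul_grad (continuous_gradient hf).locallyIntegrable hφ.continuous hc)]
    simp only [inner_smul_right, inner_gradient_right, starRingEnd_apply, star_trivial]
    simp_rw [mul_comm (φ _)]
    refine integral_mul_fderiv_eq_neg_fderiv_mul_of_integrable ?_ ?_ ?_ ?_ ?_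
    · exact Continuous.integrable_of_hasCompactSupport (by fun_prop) (hc.mul_left)
    · refine Continuous.integrable_of_hasCompactSupport (by fun_prop) ?_
      exact HasCompactSupport.mul_left (f := f) (f' := fun x => fderiv ℝ φ x v)
        ((hc.fderiv ℝ).comp_left (g := fun L : Euc N →L[ℝ] ℝ => L v) (by simp))
    · exact Continuous.integrable_of_hasCompactSupport (by fun_prop) (hc.mul_left)
    · exact fun x _ => hf.differentiable one_ne_zero x
    · exact fun x _ => hφ1.differentiable one_ne_zero x

theorem HasWeakGradient.sub_const {u : Euc N → ℝ} {g : Euc N → Euc N} (h : HasWeakGradient u g)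
    (c : ℝ) : HasWeakGradient (fun x => u x - c) g := by
  have h1 : HasWeakGradient (fun _ : Euc N => c) (gradient fun _ : Euc N => c) :=
    hasWeakGradient_of_contDiff contDiff_const
  have h2 : (gradient fun _ : Euc N => c) = 0 := by ext1 x; exact gradient_fun_const x c
  rw [h2] at h1
  have h3 := h.sub h1
  rwa [sub_zero] at h3

/-- The weak gradient of a convolution with a test function. -/
theorem HasWeakGradient.integral_fderiv_mul_comp_sub {u : Euc N → ℝ} {g : Euc N → Euc N}
    (h : HasWeakGradient u g) {ρ : Euc N → ℝ} (hρs : ContDiff ℝ ∞ ρ) (hρc : HasCompactSupport ρ)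
    (x v : Euc N) :
    ∫ t, fderiv ℝ ρ t v * u (x - t) = inner ℝ v (∫ t, ρ t • g (x - t)) := by
  have hρ1 : ContDiff ℝ 1 ρ := hρs.of_le (by simp)
  have hψ : ContDiff ℝ ∞ fun y => ρ (x - y) := hρs.comp (contDiff_const.sub contDiff_id)
  have hψc : HasCompactSupport fun y => ρ (x - y) :=
    hρc.comp_homeomorph (Homeomorph.subLeft x)
  have hgr : ∀ y, gradient (fun y => ρ (x - y)) y = -gradient ρ (x - y) := by
    intro y
    refine HasGradientAt.gradient ?_
    rw [hasGradientAt_iff_hasFDerivAt, map_neg, toDual_gradient]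
    have h1 := (hρ1.differentiable one_ne_zero (x - y)).hasFDerivAt
    have h2 : HasFDerivAt (fun y : Euc N => x - y) (-ContinuousLinearMap.id ℝ (Euc N)) y :=
      (hasFDerivAt_id y).const_sub x
    have h3 := h1.comp y h2
    have h4 : (fderiv ℝ ρ (x - y)).comp (-ContinuousLinearMap.id ℝ (Euc N)) =
        -fderiv ℝ ρ (x - y) := by ext v; simp
    rw [h4] at h3
    exact h3
  have hw := h.integral_eq _ hψ hψc
  simp only [hgr, smul_neg, integral_neg, neg_inj] at hw
  have e1 : ∫ t, ρ t • g (x - t) = ∫ y, ρ (x - y) • g y := by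
    rw [← integral_sub_left_eq_self _ volume x]
    simp
  have hi1 : Integrable fun y => u y • gradient ρ (x - y) := by
    have := integrable_smul_gradient h.locallyIntegrable hψ hψc
    simp only [hgr, smul_neg] at this
    simpa using this.neg
  rw [e1, ← hw, ← integral_inner hi1, ← integral_sub_left_eq_self _ volume x]
  refine integral_congr_ae (ae_of_all _ fun y => ?_)
  simp only [sub_sub_cancel, inner_smul_right, inner_gradient_right, starRingEnd_apply,
    star_trivial]
  ring

/-- Mollification commutes with the weak gradient. -/
theorem HasWeakGradient.gradient_moll {u : Euc N → ℝ} {g : Euc N → Euc N}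
    (h : HasWeakGradient u g) (φ : ContDiffBump (0 : Euc N)) :
    gradient (moll φ u) = moll φ g := by
  ext1 x
  have hρ1 : ContDiff ℝ 1 (φ.normed volume) := φ.contDiff_normed
  have hρc : HasCompactSupport (φ.normed volume) := φ.hasCompactSupport_normed
  have hd := hρc.hasFDerivAt_convolution_left (ContinuousLinearMap.lsmul ℝ ℝ) hρ1
    h.locallyIntegrable x
  have hint := (hρc.fderiv ℝ).convolutionExists_left
    ((ContinuousLinearMap.lsmul ℝ ℝ).precompL (Euc N))
    (hρ1.continuous_fderiv one_ne_zero) h.locallyIntegrable x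
  rw [← moll_eq_convolution] at hd
  refine ext_inner_left ℝ fun v => ?_
  rw [inner_gradient_right, hd.fderiv, convolution_def, ContinuousLinearMap.integral_apply hint]
  simp only [ContinuousLinearMap.precompL_apply, ContinuousLinearMap.lsmul_apply, smul_eq_mul,
    starRingEnd_apply, star_trivial]
  exact h.integral_fderiv_mul_comp_sub φ.contDiff_normed hρc x v

/-- A limit of weakly differentiable functions in the sense of distributions. -/
theorem hasWeakGradient_of_tendsto {ι : Type*} {l : Filter ι} [l.NeBot] {u : ι → Euc N → ℝ}
    {g : ι → Euc N → Euc N} (h : ∀ i, HasWeakGradient (u i) (g i)) {u₀ : Euc N → ℝ}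
    {g₀ : Euc N → Euc N} (hu₀ : LocallyIntegrable u₀ volume) (hg₀ : LocallyIntegrable g₀ volume)
    (hu : ∀ φ : Euc N → ℝ, ContDiff ℝ ∞ φ → HasCompactSupport φ →
      Tendsto (fun i => ∫ x, u i x • gradient φ x) l (𝓝 (∫ x, u₀ x • gradient φ x)))
    (hg : ∀ φ : Euc N → ℝ, ContDiff ℝ ∞ φ → HasCompactSupport φ →
      Tendsto (fun i => ∫ x, φ x • g i x) l (𝓝 (∫ x, φ x • g₀ x))) :
    HasWeakGradient u₀ g₀ where
  locallyIntegrable := hu₀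
  locallyIntegrable_grad := hg₀
  integral_eq φ hφ hc := by
    refine tendsto_nhds_unique (hu φ hφ hc) ?_
    simp_rw [(h _).integral_eq φ hφ hc]
    exact (hg φ hφ hc).neg

end WeakGradient

/-! ### The mollification estimate for weakly differentiable functions -/

section MollificationEstimate

variable {N : ℕ}

/-- The mollification estimate: `‖u - u * φ‖_p ≤ C ‖∇u‖_2`. -/
theorem HasWeakGradient.lintegral_sub_moll_rpow_le {u : Euc N → ℝ} {g : Euc N → Euc N}
    (h : HasWeakGradient u g) (φ : ContDiffBump (0 : Euc N)) (hφ : φ.rOut ≤ 2 * φ.rIn)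
    {p : ℝ} (hp : 2 < p) :
    ∫⁻ x, ‖u x - moll φ u x‖ₑ ^ p ≤
      mollConst (Euc N) p φ.rOut * (∫⁻ x, ‖g x‖ₑ ^ (2 : ℝ)) ^ (p / 2) := by
  have hp0 : 0 < p := by linarith
  have hlu := h.locallyIntegrable
  -- The estimate is known for the smooth functions f n, whose gradients are mollifications of g and
  -- so have no larger L² norm. Fatou's lemma transfers it to u.
  set f : ℕ → Euc N → ℝ := fun n => moll (bumpSeq (Euc N) n) u with hf
  have hfc : ∀ n, ContDiff ℝ 1 (f n) := fun n => contDiff_moll _ hlu (n := 1)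
  have hbound : ∀ n, ∫⁻ x, ‖f n x - moll φ (f n) x‖ₑ ^ p ≤
      mollConst (Euc N) p φ.rOut * (∫⁻ x, ‖g x‖ₑ ^ (2 : ℝ)) ^ (p / 2) := by
    intro n
    refine (lintegral_sub_moll_rpow_le_of_contDiff φ hφ (hfc n) hp).trans ?_
    refine mul_le_mul_right (ENNReal.rpow_le_rpow ?_ (by linarith)) _
    calc ∫⁻ x, ‖fderiv ℝ (f n) x‖ₑ ^ (2 : ℝ) = ∫⁻ x, ‖moll (bumpSeq (Euc N) n) g x‖ₑ ^ (2 : ℝ) := by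
          refine lintegral_congr fun x => ?_
          rw [← h.gradient_moll, ← ofReal_norm, ← ofReal_norm, norm_gradient]
      _ ≤ _ := lintegral_moll_rpow_le _ h.locallyIntegrable_grad.aestronglyMeasurable
          (by norm_num)
  have hlim : ∀ᵐ x, Tendsto (fun n => ‖f n x - moll φ (f n) x‖ₑ ^ p) atTop
      (𝓝 (‖u x - moll φ u x‖ₑ ^ p)) := by
    filter_upwards [tendsto_moll_bumpSeq_ae hlu] with x hx
    have h2 : Tendsto (fun n => moll φ (f n) x) atTop (𝓝 (moll φ u x)) := by
      simp only [hf, fun n => moll_comm φ (bumpSeq (Euc N) n) hlu]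
      exact tendsto_moll_bumpSeq_of_continuous (continuous_moll φ hlu) x
    exact ((ENNReal.continuous_rpow_const.tendsto _).comp
      ((hx.sub h2).enorm))
  calc ∫⁻ x, ‖u x - moll φ u x‖ₑ ^ p
      = ∫⁻ x, liminf (fun n => ‖f n x - moll φ (f n) x‖ₑ ^ p) atTop := by
        refine lintegral_congr_ae ?_
        filter_upwards [hlim] with x hx
        exact hx.liminf_eq.symm
    _ ≤ liminf (fun n => ∫⁻ x, ‖f n x - moll φ (f n) x‖ₑ ^ p) atTop := by
        refine lintegral_liminf_le fun n => ?_
        have : Continuous fun x => f n x - moll φ (f n) x :=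
          (hfc n).continuous.sub (continuous_moll φ (hfc n).continuous.locallyIntegrable)
        exact this.enorm.measurable.pow_const p
    _ ≤ _ := by
        refine (liminf_le_liminf (Eventually.of_forall hbound)).trans ?_
        simp

end MollificationEstimate

/-! ### Convergence of norms implies strong convergence -/

section RieszConvergence

/-- Almost everywhere convergence together with convergence of the `L^q` norms implies strong
convergence. -/
theorem tendsto_lintegral_sub_rpow {α F : Type*} [MeasurableSpace α] {μ : Measure α}
    [NormedAddCommGroup F] {f : ℕ → α → F} {f₀ : α → F} {q : ℝ} (hq : 1 ≤ q)
    (hf : ∀ n, AEStronglyMeasurable (f n) μ) (hf₀ : AEStronglyMeasurable f₀ μ)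
    (hfin : ∫⁻ x, ‖f₀ x‖ₑ ^ q ∂μ ≠ ⊤)
    (hae : ∀ᵐ x ∂μ, Tendsto (fun n => f n x) atTop (𝓝 (f₀ x)))
    (hnorm : Tendsto (fun n => ∫⁻ x, ‖f n x‖ₑ ^ q ∂μ) atTop (𝓝 (∫⁻ x, ‖f₀ x‖ₑ ^ q ∂μ))) :
    Tendsto (fun n => ∫⁻ x, ‖f n x - f₀ x‖ₑ ^ q ∂μ) atTop (𝓝 0) := by
  have hq0 : 0 < q := by linarith
  set D := ∫⁻ x, ‖f₀ x‖ₑ ^ q ∂μ with hD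
  set c : ℝ≥0∞ := 2 ^ (q - 1) with hc
  have hctop : c ≠ ⊤ := ENNReal.rpow_ne_top_of_nonneg (by linarith) (by simp)
  -- Fatou's lemma is applied to b n - d n ≥ 0, which tends almost everywhere to 2c|f₀|^q. As the
  -- integrals of b n converge to that of this limit, nothing is left for the integrals of d n.
  set b : ℕ → α → ℝ≥0∞ := fun n x => c * (‖f n x‖ₑ ^ q + ‖f₀ x‖ₑ ^ q) with hb
  set d : ℕ → α → ℝ≥0∞ := fun n x => ‖f n x - f₀ x‖ₑ ^ q with hd
  have hdb : ∀ n x, d n x ≤ b n x := by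
    intro n x
    calc ‖f n x - f₀ x‖ₑ ^ q ≤ (‖f n x‖ₑ + ‖f₀ x‖ₑ) ^ q := by
          gcongr; exact enorm_sub_le
      _ ≤ _ := ENNReal.rpow_add_le_mul_rpow_add_rpow _ _ hq
  have hmf : ∀ n, AEMeasurable (fun x => ‖f n x‖ₑ ^ q) μ := fun n => (hf n).enorm.pow_const q
  have hmf₀ : AEMeasurable (fun x => ‖f₀ x‖ₑ ^ q) μ := hf₀.enorm.pow_const q
  have hmd : ∀ n, AEMeasurable (d n) μ := fun n => ((hf n).sub hf₀).enorm.pow_const q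
  have hmb : ∀ n, AEMeasurable (b n) μ := fun n => ((hmf n).add hmf₀).const_mul c
  have hB : ∀ n, ∫⁻ x, b n x ∂μ = c * ((∫⁻ x, ‖f n x‖ₑ ^ q ∂μ) + D) := by
    intro n
    rw [lintegral_const_mul' _ _ hctop, lintegral_add_left' (hmf n)]
  have hsum : ∀ n, ∫⁻ x, (b n x - d n x) ∂μ + ∫⁻ x, d n x ∂μ = ∫⁻ x, b n x ∂μ := by
    intro n
    rw [← lintegral_add_right' _ (hmd n)]
    exact lintegral_congr fun x => tsub_add_cancel_of_le (hdb n x)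
  have hBlim : Tendsto (fun n => ∫⁻ x, b n x ∂μ) atTop (𝓝 (c * (D + D))) := by
    simp_rw [hB]
    exact ENNReal.Tendsto.const_mul (hnorm.add tendsto_const_nhds) (Or.inr hctop)
  have hXtop : c * (D + D) ≠ ⊤ := ENNReal.mul_ne_top hctop (by simp [hfin])
  have hfatou : c * (D + D) ≤ liminf (fun n => ∫⁻ x, (b n x - d n x) ∂μ) atTop := by
    calc c * (D + D) = ∫⁻ x, liminf (fun n => b n x - d n x) atTop ∂μ := by
          rw [hD, ← lintegral_add_left' hmf₀, ← lintegral_const_mul' _ _ hctop]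
          refine lintegral_congr_ae ?_
          filter_upwards [hae] with x hx
          have h1 : Tendsto (fun n => ‖f n x‖ₑ ^ q) atTop (𝓝 (‖f₀ x‖ₑ ^ q)) :=
            (ENNReal.continuous_rpow_const.tendsto _).comp hx.enorm
          have h2 : Tendsto (fun n => d n x) atTop (𝓝 0) := by
            have : Tendsto (fun n => f n x - f₀ x) atTop (𝓝 0) := by
              simpa using hx.sub_const (f₀ x)
            have := (ENNReal.continuous_rpow_const (y := q)).tendsto _ |>.comp this.enorm
            simp only [enorm_zero, ENNReal.zero_rpow_of_pos hq0] at this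
            exact this
          have h3 : Tendsto (fun n => b n x - d n x) atTop
              (𝓝 (c * (‖f₀ x‖ₑ ^ q + ‖f₀ x‖ₑ ^ q) - 0)) :=
            ENNReal.Tendsto.sub (ENNReal.Tendsto.const_mul (h1.add tendsto_const_nhds)
              (Or.inr hctop)) h2 (Or.inr (by simp))
          rw [tsub_zero] at h3
          exact h3.liminf_eq.symm
      _ ≤ _ := lintegral_liminf_le' fun n => (hmb n).sub (hmd n)
  rw [ENNReal.tendsto_nhds_zero]
  intro ε hε
  rcases eq_or_ne ε ⊤ with rfl | hεt
  · simp
  have hε2 : ε / 2 ≠ 0 := by simp [hε.ne']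
  have hε2t : ε / 2 ≠ ⊤ := ENNReal.div_ne_top hεt (by simp)
  have ev1 : ∀ᶠ n in atTop, c * (D + D) ≤ ∫⁻ x, (b n x - d n x) ∂μ + ε / 2 := by
    rcases le_or_gt (c * (D + D)) (ε / 2) with hle | hlt
    · exact Eventually.of_forall fun n => hle.trans le_add_self
    · have : c * (D + D) - ε / 2 < liminf (fun n => ∫⁻ x, (b n x - d n x) ∂μ) atTop :=
        (ENNReal.sub_lt_self hXtop (ne_bot_of_gt hlt) hε2).trans_le hfatou
      filter_upwards [eventually_lt_of_lt_liminf this] with n hn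
      exact tsub_le_iff_right.1 hn.le
  have ev2 : ∀ᶠ n in atTop, ∫⁻ x, b n x ∂μ ≤ c * (D + D) + ε / 2 :=
    (hBlim.eventually_lt_const (ENNReal.lt_add_right hXtop hε2)).mono fun n hn => hn.le
  filter_upwards [ev1, ev2] with n h1 h2
  have h3 : ∫⁻ x, b n x ∂μ ≠ ⊤ := ne_top_of_le_ne_top (by simp [hXtop, hε2t]) h2
  have h4 : ∫⁻ x, (b n x - d n x) ∂μ ≠ ⊤ :=
    ne_top_of_le_ne_top h3 (by rw [← hsum n]; exact le_self_add)
  have h5 : ∫⁻ x, (b n x - d n x) ∂μ + ∫⁻ x, d n x ∂μ ≤ ∫⁻ x, (b n x - d n x) ∂μ + ε := by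
    rw [hsum n]
    calc ∫⁻ x, b n x ∂μ ≤ c * (D + D) + ε / 2 := h2
      _ ≤ ∫⁻ x, (b n x - d n x) ∂μ + ε / 2 + ε / 2 := by gcongr
      _ = _ := by rw [add_assoc, ENNReal.add_halves]
  exact (ENNReal.add_le_add_iff_left h4).1 h5

/-- The norms converge: Fatou bounds the lower limit from below, and mollification does not increase
the norm. -/
theorem tendsto_lintegral_moll_sub_rpow {E F : Type*} [NormedAddCommGroup E]
    [InnerProductSpace ℝ E] [FiniteDimensional ℝ E] [MeasurableSpace E] [BorelSpace E]
    [NormedAddCommGroup F] [NormedSpace ℝ F] [CompleteSpace F] {g : E → F}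
    (hg : LocallyIntegrable g volume) {q : ℝ} (hq : 1 < q)
    (hfin : ∫⁻ x, ‖g x‖ₑ ^ q ≠ ⊤) :
    Tendsto (fun n => ∫⁻ x, ‖moll (bumpSeq E n) g x - g x‖ₑ ^ q) atTop (𝓝 0) := by
  refine tendsto_lintegral_sub_rpow hq.le (fun n => (continuous_moll _ hg).aestronglyMeasurable)
    hg.aestronglyMeasurable hfin (tendsto_moll_bumpSeq_ae hg) ?_
  refine tendsto_of_le_liminf_of_limsup_le ?_ ?_
  · calc ∫⁻ x, ‖g x‖ₑ ^ q = ∫⁻ x, liminf (fun n => ‖moll (bumpSeq E n) g x‖ₑ ^ q) atTop := by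
          refine lintegral_congr_ae ?_
          filter_upwards [tendsto_moll_bumpSeq_ae hg] with x hx
          exact (((ENNReal.continuous_rpow_const (y := q)).tendsto _).comp hx.enorm).liminf_eq.symm
      _ ≤ _ := lintegral_liminf_le fun n => (continuous_moll _ hg).enorm.measurable.pow_const q
  · refine (limsup_le_limsup (Eventually.of_forall fun n =>
      lintegral_moll_rpow_le (bumpSeq E n) hg.aestronglyMeasurable hq)).trans ?_
    simp

end RieszConvergence

/-! ### Conversions between `MemLp` and lower integrals -/

section Integrals

theorem lintegral_rpow_ne_top_of_memLp {α F : Type*} [MeasurableSpace α] {μ : Measure α}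
    [NormedAddCommGroup F] {f : α → F} {p : ℝ} (hp : 0 < p)
    (hf : MemLp f (ENNReal.ofReal p) μ) : ∫⁻ x, ‖f x‖ₑ ^ p ∂μ ≠ ⊤ := by
  have := lintegral_rpow_enorm_lt_top_of_eLpNorm_lt_top (by simpa using hp) (by simp)
    hf.eLpNorm_lt_top
  rw [ENNReal.toReal_ofReal hp.le] at this
  exact this.ne

theorem memLp_of_lintegral_rpow_ne_top {α F : Type*} [MeasurableSpace α] {μ : Measure α}
    [NormedAddCommGroup F] {f : α → F} {p : ℝ} (hp : 0 < p) (hm : AEStronglyMeasurable f μ)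
    (hf : ∫⁻ x, ‖f x‖ₑ ^ p ∂μ ≠ ⊤) : MemLp f (ENNReal.ofReal p) μ := by
  refine ⟨hm, ?_⟩
  rw [eLpNorm_lt_top_iff_lintegral_rpow_enorm_lt_top (by simpa using hp) (by simp),
    ENNReal.toReal_ofReal hp.le]
  exact hf.lt_top

theorem ofReal_two : ENNReal.ofReal 2 = 2 := by simp

theorem lintegral_sq_ne_top_of_memLp {α F : Type*} [MeasurableSpace α] {μ : Measure α}
    [NormedAddCommGroup F] {f : α → F} (hf : MemLp f 2 μ) : ∫⁻ x, ‖f x‖ₑ ^ (2 : ℝ) ∂μ ≠ ⊤ :=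
  lintegral_rpow_ne_top_of_memLp two_pos (by rwa [ofReal_two])

theorem memLp_two_of_lintegral_sq_ne_top {α F : Type*} [MeasurableSpace α] {μ : Measure α}
    [NormedAddCommGroup F] {f : α → F} (hm : AEStronglyMeasurable f μ)
    (hf : ∫⁻ x, ‖f x‖ₑ ^ (2 : ℝ) ∂μ ≠ ⊤) : MemLp f 2 μ := by
  rw [← ofReal_two]
  exact memLp_of_lintegral_rpow_ne_top two_pos hm hf

theorem tendsto_lintegral_mul_of_rpow {α : Type*} [MeasurableSpace α] {μ : Measure α}
    {h : ℕ → α → ℝ≥0∞} {k : α → ℝ≥0∞} {p q : ℝ} (hpq : p.HolderConjugate q)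
    (hm : ∀ n, AEMeasurable (h n) μ) (hk : AEMeasurable k μ) (hkf : ∫⁻ x, k x ^ q ∂μ ≠ ⊤)
    (hh : Tendsto (fun n => ∫⁻ x, h n x ^ p ∂μ) atTop (𝓝 0)) :
    Tendsto (fun n => ∫⁻ x, h n x * k x ∂μ) atTop (𝓝 0) := by
  have h1 : Tendsto (fun n => (∫⁻ x, h n x ^ p ∂μ) ^ (1 / p) * (∫⁻ x, k x ^ q ∂μ) ^ (1 / q))
      atTop (𝓝 0) := by
    have h2 := ((ENNReal.continuous_rpow_const (y := 1 / p)).tendsto _).comp hh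
    have hp0 : 0 < 1 / p := one_div_pos.2 hpq.pos
    simp only [ENNReal.zero_rpow_of_pos hp0] at h2
    have := ENNReal.Tendsto.mul_const (b := (∫⁻ x, k x ^ q ∂μ) ^ (1 / q)) h2
      (Or.inr (ENNReal.rpow_ne_top_of_nonneg (one_div_nonneg.2 hpq.symm.nonneg) hkf))
    rwa [zero_mul] at this
  exact tendsto_of_tendsto_of_tendsto_of_le_of_le tendsto_const_nhds h1 (fun _ => zero_le)
    fun n => ENNReal.lintegral_mul_le_Lp_mul_Lq μ hpq (hm n) hk

theorem lintegral_rpow_ne_top_of_hasCompactSupport {E F : Type*} [NormedAddCommGroup E]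
    [MeasurableSpace E] [BorelSpace E] [NormedAddCommGroup F] [SecondCountableTopology F]
    {μ : Measure E} [IsFiniteMeasureOnCompacts μ]
    {f : E → F} (hf : Continuous f) (hc : HasCompactSupport f) {p : ℝ} (hp : 0 < p) :
    ∫⁻ x, ‖f x‖ₑ ^ p ∂μ ≠ ⊤ :=
  lintegral_rpow_ne_top_of_memLp hp (hf.memLp_of_hasCompactSupport hc)

end Integrals

/-! ### The chain rule, absolute value and positive part -/

section ChainRule

variable {N : ℕ}

/-- The chain rule concerns functions with gradient in L² and mentions no p; an auxiliary
subcritical exponent makes mollifications of such functions converge strongly. The choice 2 +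
1/(N+1) is subcritical in every dimension. -/
theorem exists_exponent (N : ℕ) : ∃ p : ℝ, 2 < p ∧ singExp N p < 1 := by
  have h0 : (0 : ℝ) < (N : ℝ) + 1 := by positivity
  refine ⟨2 + 1 / ((N : ℝ) + 1), by linarith [one_div_pos.2 h0], ?_⟩
  unfold singExp
  rw [div_lt_one (by positivity)]
  have : (N : ℝ) * (1 / ((N : ℝ) + 1)) ≤ 1 := by
    rw [mul_one_div, div_le_one h0]; linarith
  have := one_div_pos.2 h0
  nlinarith

theorem finrank_euc (N : ℕ) : Module.finrank ℝ (Euc N) = N := finrank_euclideanSpace_fin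

theorem tendsto_lintegral_sub_moll (hN : 1 ≤ N) {u : Euc N → ℝ} {g : Euc N → Euc N}
    (h : HasWeakGradient u g) (hg : MemLp g 2 volume) {p : ℝ} (hp : 2 < p) (ha : singExp N p < 1) :
    Tendsto (fun n => ∫⁻ x, ‖u x - moll (bumpSeq (Euc N) n) u x‖ₑ ^ p) atTop (𝓝 0) := by
  have hfin := lintegral_sq_ne_top_of_memLp hg
  have h1 : Tendsto (fun n => mollConst (Euc N) p (bumpSeq (Euc N) n).rOut *
      (∫⁻ x, ‖g x‖ₑ ^ (2 : ℝ)) ^ (p / 2)) atTop (𝓝 0) := by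
    have h2 := (tendsto_mollConst (E := Euc N) (by rwa [finrank_euc]) hp
      (by rwa [finrank_euc])).comp (tendsto_bumpSeq_rOut (E := Euc N))
    have := ENNReal.Tendsto.mul_const (b := (∫⁻ x, ‖g x‖ₑ ^ (2 : ℝ)) ^ (p / 2)) h2
      (Or.inr (ENNReal.rpow_ne_top_of_nonneg (by linarith) hfin))
    rwa [zero_mul] at this
  exact tendsto_of_tendsto_of_tendsto_of_le_of_le tendsto_const_nhds h1 (fun _ => zero_le)
    fun n => h.lintegral_sub_moll_rpow_le _ (bumpSeq_rOut_le n) hp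

theorem lipschitz_of_deriv_le_one {F : ℝ → ℝ} (hF : ContDiff ℝ 1 F) (hF' : ∀ s, |deriv F s| ≤ 1)
    (s t : ℝ) : |F s - F t| ≤ |s - t| := by
  have := Convex.norm_image_sub_le_of_norm_deriv_le (f := F) (C := 1) (s := Set.univ) (x := t)
    (y := s) (fun x _ => hF.differentiable one_ne_zero x) (fun x _ => hF' x) convex_univ
    trivial trivial
  simpa using this

theorem locallyIntegrable_of_le {F G : Type*} [NormedAddCommGroup F] [NormedAddCommGroup G]
    {u : Euc N → F} {v : Euc N → G}
    (hu : LocallyIntegrable u volume) (hv : AEStronglyMeasurable v volume)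
    (h : ∀ x, ‖v x‖ ≤ ‖u x‖) : LocallyIntegrable v volume :=
  hu.mono hv (ae_of_all _ h)

/-- The chain rule for weak gradients in `L²`. -/
theorem HasWeakGradient.comp (hN : 1 ≤ N) {u : Euc N → ℝ} {g : Euc N → Euc N}
    (h : HasWeakGradient u g) (hg : MemLp g 2 volume) {F : ℝ → ℝ} (hF : ContDiff ℝ 1 F)
    (hF' : ∀ s, |deriv F s| ≤ 1) :
    HasWeakGradient (fun x => F (u x)) (fun x => deriv F (u x) • g x) := by
  obtain ⟨p, hp, ha⟩ := exists_exponent N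
  have hp0 : 0 < p := by linarith
  have hlu := h.locallyIntegrable
  have hlg := h.locallyIntegrable_grad
  have hmu := hlu.aestronglyMeasurable
  have hmg := hlg.aestronglyMeasurable
  have hdc : Continuous (deriv F) := hF.continuous_deriv le_rfl
  have hF0 := hF.continuous
  set f : ℕ → Euc N → ℝ := fun n => moll (bumpSeq (Euc N) n) u with hf
  have hfc : ∀ n, ContDiff ℝ 1 (f n) := fun n => contDiff_moll _ hlu (n := 1)
  have hfcc : ∀ n, Continuous (f n) := fun n => (hfc n).continuous
  have hgcc : ∀ n, Continuous (moll (bumpSeq (Euc N) n) g) := fun n => continuous_moll _ hlg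
  have hgrad : ∀ n, HasWeakGradient (fun x => F (f n x))
      (fun x => deriv F (f n x) • moll (bumpSeq (Euc N) n) g x) := by
    intro n
    have h1 := hasWeakGradient_of_contDiff (hF.comp (hfc n))
    have h2 : gradient (F ∘ f n) = fun x => deriv F (f n x) • moll (bumpSeq (Euc N) n) g x := by
      ext1 x
      refine HasGradientAt.gradient ?_
      rw [hasGradientAt_iff_hasFDerivAt, map_smul, ← h.gradient_moll, toDual_gradient]
      exact ((hF.differentiable one_ne_zero (f n x)).hasDerivAt).comp_hasFDerivAt x
        ((hfc n).differentiable one_ne_zero x).hasFDerivAt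
    rwa [h2] at h1
  have hFu : AEStronglyMeasurable (fun x => F (u x)) volume := hF0.comp_aestronglyMeasurable hmu
  have hFdu : AEStronglyMeasurable (fun x => deriv F (u x)) volume :=
    hdc.comp_aestronglyMeasurable hmu
  have hl1 : LocallyIntegrable (fun x => F (u x)) volume := by
    have h1 : LocallyIntegrable (fun x => F (u x) - F 0) volume := by
      refine locallyIntegrable_of_le hlu (hFu.sub aestronglyMeasurable_const) fun x => ?_
      simpa using lipschitz_of_deriv_le_one hF hF' (u x) 0
    have h2 := h1.add (locallyIntegrable_const (F 0))
    have e : ((fun x => F (u x) - F 0) + fun _ => F 0) = fun x => F (u x) := by ext x; simp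
    rwa [e] at h2
  have hl2 : LocallyIntegrable (fun x => deriv F (u x) • g x) volume := by
    refine locallyIntegrable_of_le hlg (hFdu.smul hmg) fun x => ?_
    rw [norm_smul]
    exact mul_le_of_le_one_left (norm_nonneg _) (hF' _)
  have hae := tendsto_moll_bumpSeq_ae hlu
  refine hasWeakGradient_of_tendsto (l := atTop) hgrad hl1 hl2 ?_ ?_
  · intro φ hφ hc
    have hφg : Continuous (gradient φ) := continuous_gradient (hφ.of_le (by simp))
    have hφgc := hasCompactSupport_gradient hc
    refine tendsto_integral_of_L1 _ (integrable_smul_gradient hl1 hφ hc).aestronglyMeasurable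
      (Eventually.of_forall fun n =>
        integrable_smul_gradient (hgrad n).locallyIntegrable hφ hc) ?_
    have hpq := Real.HolderConjugate.conjExponent (p := p) (by linarith)
    have key := tendsto_lintegral_mul_of_rpow (h := fun n x => ‖u x - f n x‖ₑ)
      (k := fun x => ‖gradient φ x‖ₑ) hpq
      (fun n => (hmu.sub (hfcc n).aestronglyMeasurable).enorm)
      hφg.enorm.measurable.aemeasurable
      (lintegral_rpow_ne_top_of_hasCompactSupport hφg hφgc hpq.symm.pos)
      (tendsto_lintegral_sub_moll hN h hg hp ha)
    refine tendsto_of_tendsto_of_tendsto_of_le_of_le tendsto_const_nhds key (fun _ => zero_le)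
      fun n => lintegral_mono fun x => ?_
    rw [← sub_smul, enorm_smul]
    refine mul_le_mul_left ?_ _
    rw [← ofReal_norm, ← ofReal_norm]
    refine ENNReal.ofReal_le_ofReal ?_
    rw [Real.norm_eq_abs, Real.norm_eq_abs, abs_sub_comm (u x)]
    exact lipschitz_of_deriv_le_one hF hF' _ _
  · intro φ hφ hc
    have hφc := hφ.continuous
    have hmd : ∀ n, AEStronglyMeasurable (fun x => deriv F (f n x)) volume := fun n =>
      (hdc.comp (hfcc n)).aestronglyMeasurable
    refine tendsto_integral_of_L1 _ (integrable_smul_grad hl2 hφc hc).aestronglyMeasurable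
      (Eventually.of_forall fun n =>
        integrable_smul_grad (hgrad n).locallyIntegrable_grad hφc hc) ?_
    -- The error splits in two: the gradients converge in L² while F' is bounded by 1, and F'(f n) -
    -- F'(u) tends to 0 almost everywhere against the fixed integrable function φ g.
    have key1 := tendsto_lintegral_mul_of_rpow
      (h := fun n x => ‖moll (bumpSeq (Euc N) n) g x - g x‖ₑ)
      (k := fun x => ‖φ x‖ₑ) Real.HolderConjugate.two_two
      (fun n => ((hgcc n).aestronglyMeasurable.sub hmg).enorm)
      hφc.enorm.measurable.aemeasurable
      (lintegral_rpow_ne_top_of_hasCompactSupport hφc hc two_pos)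
      (tendsto_lintegral_moll_sub_rpow hlg (by norm_num) (lintegral_sq_ne_top_of_memLp hg))
    have hφgi := integrable_smul_grad hlg hφc hc
    have key2 : Tendsto (fun n => ∫⁻ x, ‖deriv F (f n x) - deriv F (u x)‖ₑ * ‖φ x • g x‖ₑ) atTop
        (𝓝 (∫⁻ _ : Euc N, 0)) := by
      refine tendsto_lintegral_of_dominated_convergence' (fun x => 2 * ‖φ x • g x‖ₑ) ?_ ?_ ?_ ?_
      · exact fun n => ((hmd n).sub hFdu).enorm.mul hφgi.aestronglyMeasurable.enorm
      · intro n
        refine ae_of_all _ fun x => mul_le_mul_left ?_ _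
        rw [← ofReal_norm, ← ofReal_two]
        refine ENNReal.ofReal_le_ofReal ?_
        have h1 := hF' (f n x)
        have h2 := hF' (u x)
        have h3 := norm_sub_le (deriv F (f n x)) (deriv F (u x))
        simp only [Real.norm_eq_abs] at h3 ⊢
        linarith
      · rw [lintegral_const_mul' _ _ (by simp)]
        exact ENNReal.mul_ne_top (by simp) hφgi.hasFiniteIntegral.ne
      · filter_upwards [hae] with x hx
        have h1 : Tendsto (fun n => deriv F (f n x) - deriv F (u x)) atTop (𝓝 0) := by
          simpa using ((hdc.tendsto (u x)).comp hx).sub_const (deriv F (u x))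
        have h2 := ENNReal.Tendsto.mul_const (b := ‖φ x • g x‖ₑ) h1.enorm (Or.inr (by simp))
        simpa using h2
    have key := key1.add key2
    simp only [lintegral_zero, add_zero] at key
    refine tendsto_of_tendsto_of_tendsto_of_le_of_le tendsto_const_nhds key (fun _ => zero_le)
      fun n => ?_
    refine le_trans (lintegral_mono fun x => ?_) (lintegral_add_left'
      (f := fun x => ‖moll (bumpSeq (Euc N) n) g x - g x‖ₑ * ‖φ x‖ₑ)
      (((hgcc n).aestronglyMeasurable.sub hmg).enorm.mul
        hφc.enorm.measurable.aemeasurable) _).le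
    have e : φ x • deriv F (f n x) • moll (bumpSeq (Euc N) n) g x - φ x • deriv F (u x) • g x =
        (φ x * deriv F (f n x)) • (moll (bumpSeq (Euc N) n) g x - g x) +
        (deriv F (f n x) - deriv F (u x)) • φ x • g x := by
      module
    rw [e]
    refine (enorm_add_le _ _).trans (add_le_add ?_ (enorm_smul _ _).le)
    rw [enorm_smul, mul_comm]
    refine mul_le_mul_right ?_ _
    rw [← ofReal_norm, ← ofReal_norm]
    refine ENNReal.ofReal_le_ofReal ?_
    rw [norm_mul]
    exact mul_le_of_le_one_right (norm_nonneg _) (hF' _)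

/-- Passing to the limit in the chain rule by dominated convergence. -/
theorem HasWeakGradient.comp_limit (hN : 1 ≤ N) {u : Euc N → ℝ} {g : Euc N → Euc N}
    (h : HasWeakGradient u g) (hg : MemLp g 2 volume) {F : ℕ → ℝ → ℝ}
    (hF : ∀ n, ContDiff ℝ 1 (F n)) (hF' : ∀ n s, |deriv (F n) s| ≤ 1) {F₀ G₀ : ℝ → ℝ}
    (hFb : ∀ n s, |F n s| ≤ |s| + 2)
    (hF₀ : ∀ s, Tendsto (fun n => F n s) atTop (𝓝 (F₀ s)))
    (hG₀ : ∀ s, Tendsto (fun n => deriv (F n) s) atTop (𝓝 (G₀ s))) :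
    HasWeakGradient (fun x => F₀ (u x)) (fun x => G₀ (u x) • g x) := by
  have hlu := h.locallyIntegrable
  have hlg := h.locallyIntegrable_grad
  have hmu := hlu.aestronglyMeasurable
  have hmg := hlg.aestronglyMeasurable
  have hseq := fun n => h.comp hN hg (hF n) (hF' n)
  have hm1 : AEStronglyMeasurable (fun x => F₀ (u x)) volume :=
    aestronglyMeasurable_of_tendsto_ae atTop
      (fun n => (hF n).continuous.comp_aestronglyMeasurable hmu)
      (ae_of_all _ fun x => hF₀ (u x))
  have hm2 : AEStronglyMeasurable (fun x => G₀ (u x)) volume :=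
    aestronglyMeasurable_of_tendsto_ae atTop
      (fun n => ((hF n).continuous_deriv le_rfl).comp_aestronglyMeasurable hmu)
      (ae_of_all _ fun x => hG₀ (u x))
  have hb : LocallyIntegrable (fun x => |u x| + 2) volume :=
    LocallyIntegrable.add (locallyIntegrable_of_le hlu hmu.norm fun x => by simp)
      (locallyIntegrable_const 2)
  have hb0 : ∀ x, ‖|u x| + 2‖ = |u x| + 2 := fun x => abs_of_nonneg (by positivity)
  have hl1 : LocallyIntegrable (fun x => F₀ (u x)) volume := by
    refine locallyIntegrable_of_le hb hm1 fun x => ?_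
    rw [hb0]
    exact le_of_tendsto (hF₀ (u x)).abs (Eventually.of_forall fun n => hFb n _)
  have hl2 : LocallyIntegrable (fun x => G₀ (u x) • g x) volume := by
    refine locallyIntegrable_of_le hlg (hm2.smul hmg) fun x => ?_
    rw [norm_smul]
    exact mul_le_of_le_one_left (norm_nonneg _)
      (le_of_tendsto (hG₀ (u x)).abs (Eventually.of_forall fun n => hF' n _))
  refine hasWeakGradient_of_tendsto (l := atTop) hseq hl1 hl2 ?_ ?_
  · intro φ hφ hc
    refine tendsto_integral_of_dominated_convergence (fun x => ‖(|u x| + 2) • gradient φ x‖)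
      (fun n => (integrable_smul_gradient (hseq n).locallyIntegrable hφ hc).aestronglyMeasurable)
      (integrable_smul_gradient hb hφ hc).norm ?_ ?_
    · intro n
      refine ae_of_all _ fun x => ?_
      rw [norm_smul, norm_smul, hb0]
      exact mul_le_mul_of_nonneg_right (hFb n _) (norm_nonneg _)
    · exact ae_of_all _ fun x => (hF₀ (u x)).smul_const _
  · intro φ hφ hc
    refine tendsto_integral_of_dominated_convergence (fun x => ‖φ x • g x‖)
      (fun n => (integrable_smul_grad (hseq n).locallyIntegrable_grad
        hφ.continuous hc).aestronglyMeasurable)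
      (integrable_smul_grad hlg hφ.continuous hc).norm ?_ ?_
    · intro n
      refine ae_of_all _ fun x => ?_
      rw [norm_smul, norm_smul, norm_smul]
      exact mul_le_mul_of_nonneg_left
        (mul_le_of_le_one_left (norm_nonneg _) (hF' n _)) (norm_nonneg _)
    · exact ae_of_all _ fun x => ((hG₀ (u x)).smul_const _).const_smul _

theorem hasDerivAt_sqrt_sq_add {d : ℝ} (hd : 0 < d) (s : ℝ) :
    HasDerivAt (fun s => Real.sqrt (s ^ 2 + d ^ 2)) (s / Real.sqrt (s ^ 2 + d ^ 2)) s := by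
  have h0 : s ^ 2 + d ^ 2 ≠ 0 := by positivity
  have h1 : HasDerivAt (fun s => s ^ 2 + d ^ 2) (2 * s) s := by
    simpa using (hasDerivAt_pow 2 s).add_const (d ^ 2)
  convert h1.sqrt h0 using 1
  field_simp

/-- The approximants √(s² + d²) have derivatives bounded by 1 that converge to the sign at every
point, including the value 0 at s = 0. -/
theorem HasWeakGradient.abs (hN : 1 ≤ N) {u : Euc N → ℝ} {g : Euc N → Euc N}
    (h : HasWeakGradient u g) (hg : MemLp g 2 volume) :
    HasWeakGradient (fun x => |u x|) (fun x => Real.sign (u x) • g x) := by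
  have hd : ∀ n : ℕ, (0 : ℝ) < 1 / ((n : ℝ) + 1) := fun n => by positivity
  have hd1 : ∀ n : ℕ, 1 / ((n : ℝ) + 1) ≤ (1 : ℝ) := fun n => by
    rw [div_le_one (by positivity)]; linarith [(Nat.cast_nonneg n : (0 : ℝ) ≤ n)]
  have hlim : Tendsto (fun n : ℕ => 1 / ((n : ℝ) + 1)) atTop (𝓝 0) :=
    tendsto_one_div_add_atTop_nhds_zero_nat
  have hsq : ∀ s : ℝ, Tendsto (fun n : ℕ => Real.sqrt (s ^ 2 + (1 / ((n : ℝ) + 1)) ^ 2)) atTop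
      (𝓝 |s|) := by
    intro s
    have := ((hlim.pow 2).const_add (s ^ 2)).sqrt
    simpa [Real.sqrt_sq_eq_abs] using this
  refine h.comp_limit hN hg (F := fun n s => Real.sqrt (s ^ 2 + (1 / ((n : ℝ) + 1)) ^ 2))
    (F₀ := fun s => |s|) (G₀ := Real.sign) ?_ ?_ ?_ ?_ ?_
  · intro n
    refine ContDiff.sqrt (by fun_prop) fun s => ?_
    have := hd n
    positivity
  · intro n s
    rw [(hasDerivAt_sqrt_sq_add (hd n) s).deriv, abs_div, abs_of_nonneg (Real.sqrt_nonneg _)]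
    refine div_le_one_of_le₀ ?_ (Real.sqrt_nonneg _)
    rw [← Real.sqrt_sq_eq_abs]
    exact Real.sqrt_le_sqrt (by linarith [sq_nonneg (1 / ((n : ℝ) + 1))])
  · intro n s
    rw [abs_of_nonneg (Real.sqrt_nonneg _)]
    refine Real.sqrt_le_iff.2 ⟨by positivity, ?_⟩
    have := hd n
    have := hd1 n
    have := abs_nonneg s
    have := sq_abs s
    nlinarith
  · exact hsq
  · intro s
    simp only [fun n : ℕ => (hasDerivAt_sqrt_sq_add (hd n) s).deriv]
    rcases eq_or_ne s 0 with rfl | hs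
    · simp
    · have := (tendsto_const_nhds (x := s)).div (hsq s) (abs_ne_zero.2 hs)
      have e : Real.sign s = s / |s| := by
        rcases lt_or_gt_of_ne hs with h0 | h0
        · rw [Real.sign_of_neg h0, abs_of_neg h0]; field_simp
        · rw [Real.sign_of_pos h0, abs_of_pos h0]; field_simp
      rw [e]
      exact this

theorem hasDerivAt_mul_arctan_div {d : ℝ} (hd : 0 < d) (s : ℝ) :
    HasDerivAt (fun s => d * Real.arctan (s / d)) (1 / (1 + (s / d) ^ 2)) s := by
  have h1 : HasDerivAt (fun s => s / d) (1 / d) s := (hasDerivAt_id s).div_const d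
  have h2 := (h1.arctan).const_mul d
  have e : d * (1 / (1 + (s / d) ^ 2) * (1 / d)) = 1 / (1 + (s / d) ^ 2) := by
    rw [mul_left_comm, mul_one_div_cancel hd.ne', mul_one]
  rwa [e] at h2

/-- The functions d·arctan(s/d) tend uniformly to 0 while their derivatives tend to the indicator of
{0}. In the limit, the zero function has weak gradient g on {u = 0} and 0 elsewhere, so uniqueness
of weak gradients gives the claim. -/
theorem HasWeakGradient.ae_eq_zero (hN : 1 ≤ N) {u : Euc N → ℝ} {g : Euc N → Euc N}
    (h : HasWeakGradient u g) (hg : MemLp g 2 volume) : ∀ᵐ x, u x = 0 → g x = 0 := by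
  have hd : ∀ n : ℕ, (0 : ℝ) < 1 / ((n : ℝ) + 1) := fun n => by positivity
  have hd1 : ∀ n : ℕ, 1 / ((n : ℝ) + 1) ≤ (1 : ℝ) := fun n => by
    rw [div_le_one (by positivity)]; linarith [(Nat.cast_nonneg n : (0 : ℝ) ≤ n)]
  have hlim : Tendsto (fun n : ℕ => 1 / ((n : ℝ) + 1)) atTop (𝓝 0) :=
    tendsto_one_div_add_atTop_nhds_zero_nat
  have hbd : ∀ (n : ℕ) (s : ℝ), |1 / ((n : ℝ) + 1) * Real.arctan (s / (1 / ((n : ℝ) + 1)))| ≤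
      1 / ((n : ℝ) + 1) * 2 := by
    intro n s
    rw [abs_mul, abs_of_pos (hd n)]
    refine mul_le_mul_of_nonneg_left ?_ (hd n).le
    rw [abs_le]
    constructor <;> linarith [Real.arctan_lt_pi_div_two (s / (1 / ((n : ℝ) + 1))),
      Real.neg_pi_div_two_lt_arctan (s / (1 / ((n : ℝ) + 1))), Real.pi_lt_four]
  have key := h.comp_limit hN hg
    (F := fun n s => 1 / ((n : ℝ) + 1) * Real.arctan (s / (1 / ((n : ℝ) + 1))))
    (F₀ := fun _ => 0) (G₀ := fun s => if s = 0 then 1 else 0)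
    (fun n => contDiff_const.mul ((contDiff_id.div_const _).arctan))
    (fun n s => by
      rw [(hasDerivAt_mul_arctan_div (hd n) s).deriv, abs_of_nonneg (by positivity)]
      exact div_le_one_of_le₀ (by linarith [sq_nonneg (s / (1 / ((n : ℝ) + 1)))]) (by positivity))
    (fun n s => (hbd n s).trans (by
      have := hd1 n
      have := abs_nonneg s
      linarith))
    (fun s => squeeze_zero_norm (hbd · s) (by simpa using hlim.mul_const 2))
    (fun s => by
      simp only [fun n : ℕ => (hasDerivAt_mul_arctan_div (hd n) s).deriv]
      rcases eq_or_ne s 0 with rfl | hs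
      · simp
      · simp only [hs, if_false]
        refine Tendsto.div_atTop tendsto_const_nhds (tendsto_atTop_add_const_left _ _ ?_)
        have h1 : ∀ n : ℕ, (s / (1 / ((n : ℝ) + 1))) ^ 2 = s ^ 2 * ((n : ℝ) + 1) ^ 2 := by
          intro n; field_simp
        simp only [h1]
        refine Tendsto.const_mul_atTop (by positivity) ?_
        exact (tendsto_pow_atTop two_ne_zero).comp
          (tendsto_atTop_add_const_right _ _ tendsto_natCast_atTop_atTop))
  have hzero : HasWeakGradient (fun _ : Euc N => (0 : ℝ)) 0 := by
    have := h.sub h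
    rw [sub_self, sub_self] at this
    exact this
  filter_upwards [key.ae_eq hzero] with x hx hux
  simpa [hux] using hx

/-- The weak gradient of the positive part. -/
theorem HasWeakGradient.posPart (hN : 1 ≤ N) {u : Euc N → ℝ} {g : Euc N → Euc N}
    (h : HasWeakGradient u g) (hg : MemLp g 2 volume) :
    HasWeakGradient (fun x => max (u x) 0) ({x | 0 < u x}.indicator g) := by
  have h1 := ((h.abs hN hg).add h).const_smul (1 / 2)
  refine h1.congr (ae_of_all _ fun x => ?_) ?_
  · simp only [Pi.smul_apply, Pi.add_apply, smul_eq_mul]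
    rcases le_total (u x) 0 with h0 | h0
    · rw [max_eq_right h0, abs_of_nonpos h0]; ring
    · rw [max_eq_left h0, abs_of_nonneg h0]; ring
  -- Where u = 0, half the sum of the two gradients is g/2, whereas the indicator gives 0; both
  -- vanish because g does there.
  · filter_upwards [h.ae_eq_zero hN hg] with x hx
    simp only [Pi.smul_apply, Pi.add_apply]
    rcases lt_trichotomy (u x) 0 with h0 | h0 | h0
    · simp [Real.sign_of_neg h0, h0.not_gt, Set.indicator]
    · simp [h0, hx h0, Set.indicator]
    · simp only [Real.sign_of_pos h0, Set.indicator, Set.mem_ofPred_eq, h0, if_true]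
      module

end ChainRule

/-! ### Weak compactness in L² and passage between modes of convergence -/

section WeakCompactness

/-- The sequential Banach–Alaoglu theorem, available by separability, carried to the Hilbert space
by the Riesz isometry. -/
theorem exists_subseq_inner_tendsto {H : Type*} [NormedAddCommGroup H] [InnerProductSpace ℝ H]
    [CompleteSpace H] [TopologicalSpace.SeparableSpace H] {x : ℕ → H} {C : ℝ}
    (hx : ∀ n, ‖x n‖ ≤ C) : ∃ (k : ℕ → ℕ) (x₀ : H), StrictMono k ∧
      ∀ y, Tendsto (fun n => inner ℝ y (x (k n))) atTop (𝓝 (inner ℝ y x₀)) := by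
  obtain ⟨φ, -, k, hk, hφ⟩ := WeakDual.isSeqCompact_closedBall ℝ H (0 : StrongDual ℝ H) C
    (x := fun n => StrongDual.toWeakDual (InnerProductSpace.toDual ℝ H (x n)))
    (fun n => by
      simp only [Set.mem_preimage, mem_closedBall_zero_iff]
      refine le_trans (le_of_eq ?_) (hx n)
      exact LinearIsometryEquiv.norm_map (InnerProductSpace.toDual ℝ H) (x n))
  refine ⟨k, (InnerProductSpace.toDual ℝ H).symm (WeakDual.toStrongDual φ), hk, fun y => ?_⟩
  have := ((WeakDual.eval_continuous y).tendsto φ).comp hφ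
  rw [real_inner_comm, ← InnerProductSpace.toDual_apply_apply (𝕜 := ℝ),
    LinearIsometryEquiv.apply_symm_apply]
  refine this.congr fun n => ?_
  rw [real_inner_comm]
  rfl

theorem exists_subseq_weak_L2 {α F : Type*} [MeasurableSpace α] {μ : Measure α}
    [NormedAddCommGroup F] [InnerProductSpace ℝ F] [CompleteSpace F]
    [TopologicalSpace.SeparableSpace F] [IsSeparable μ]
    {f : ℕ → α → F} (hf : ∀ n, MemLp (f n) 2 μ) {C : ℝ≥0∞} (hC : C ≠ ⊤)
    (hb : ∀ n, ∫⁻ x, ‖f n x‖ₑ ^ (2 : ℝ) ∂μ ≤ C) :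
    ∃ (k : ℕ → ℕ) (f₀ : α → F), StrictMono k ∧ MemLp f₀ 2 μ ∧
      ∀ h, MemLp h 2 μ → Tendsto (fun n => ∫ x, inner ℝ (h x) (f (k n) x) ∂μ) atTop
        (𝓝 (∫ x, inner ℝ (h x) (f₀ x) ∂μ)) := by
  have : Fact ((2 : ℝ≥0∞) ≠ ⊤) := ⟨by simp⟩
  obtain ⟨k, x₀, hk, hlim⟩ := exists_subseq_inner_tendsto (H := Lp F 2 μ)
    (x := fun n => (hf n).toLp) (C := (C ^ (1 / 2 : ℝ)).toReal) (fun n => by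
      rw [Lp.norm_toLp]
      refine ENNReal.toReal_mono (ENNReal.rpow_ne_top_of_nonneg (by norm_num) hC) ?_
      rw [eLpNorm_eq_lintegral_rpow_enorm_toReal (by simp) (by simp)]
      simp only [ENNReal.toReal_ofNat]
      exact ENNReal.rpow_le_rpow (hb n) (by norm_num))
  refine ⟨k, x₀, hk, Lp.memLp x₀, fun h hh => ?_⟩
  have := hlim hh.toLp
  simp only [L2.inner_def] at this
  have e : ∀ (w : α → F) (w' : Lp F 2 μ), w' =ᵐ[μ] w →
      ∫ x, inner ℝ ((hh.toLp h : α → F) x) (w' x) ∂μ = ∫ x, inner ℝ (h x) (w x) ∂μ := by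
    intro w w' hw
    refine integral_congr_ae ?_
    filter_upwards [hh.coeFn_toLp, hw] with x h1 h2
    rw [h1, h2]
  rw [e x₀ x₀ (ae_eq_refl _)] at this
  exact this.congr fun n => e _ _ (hf (k n)).coeFn_toLp

theorem exists_subseq_ae_of_tendsto_lintegral {α : Type*} [MeasurableSpace α] {μ : Measure α}
    {f : ℕ → α → ℝ} (hm : ∀ n, AEStronglyMeasurable (f n) μ) {p : ℝ} (hp : 0 < p)
    (h : Tendsto (fun n => ∫⁻ x, ‖f n x‖ₑ ^ p ∂μ) atTop (𝓝 0)) :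
    ∃ k : ℕ → ℕ, StrictMono k ∧ ∀ᵐ x ∂μ, Tendsto (fun n => f (k n) x) atTop (𝓝 0) := by
  have h1 : Tendsto (fun n => eLpNorm (f n - fun _ => (0 : ℝ)) (ENNReal.ofReal p) μ) atTop
      (𝓝 0) := by
    have h2 := ((ENNReal.continuous_rpow_const (y := 1 / p)).tendsto _).comp h
    simp only [ENNReal.zero_rpow_of_pos (one_div_pos.2 hp)] at h2
    refine h2.congr fun n => ?_
    rw [eLpNorm_eq_lintegral_rpow_enorm_toReal (by simpa using hp) (by simp),
      ENNReal.toReal_ofReal hp.le]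
    simp
  exact (tendstoInMeasure_of_tendsto_eLpNorm (by simpa using hp) hm
    aestronglyMeasurable_const h1).exists_seq_tendsto_ae

theorem integral_rpow_eq_toReal {α F : Type*} [MeasurableSpace α] {μ : Measure α}
    [NormedAddCommGroup F] {f : α → F} (hf : AEStronglyMeasurable f μ) {p : ℝ} (hp : 0 ≤ p) :
    ∫ x, ‖f x‖ ^ p ∂μ = (∫⁻ x, ‖f x‖ₑ ^ p ∂μ).toReal := by
  rw [integral_eq_lintegral_of_nonneg_ae (ae_of_all _ fun x => by positivity)
    ((hf.norm.aemeasurable.pow_const p).aestronglyMeasurable)]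
  congr 1
  refine lintegral_congr fun x => ?_
  rw [← ofReal_norm, ENNReal.ofReal_rpow_of_nonneg (norm_nonneg _) hp]

theorem lintegral_rpow_eq_ofReal {α F : Type*} [MeasurableSpace α] {μ : Measure α}
    [NormedAddCommGroup F] {f : α → F} {p : ℝ} (hp : 0 < p)
    (hf : MemLp f (ENNReal.ofReal p) μ) :
    ∫⁻ x, ‖f x‖ₑ ^ p ∂μ = ENNReal.ofReal (∫ x, ‖f x‖ ^ p ∂μ) := by
  rw [integral_rpow_eq_toReal hf.aestronglyMeasurable hp.le,
    ENNReal.ofReal_toReal (lintegral_rpow_ne_top_of_memLp hp hf)]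

theorem lintegral_sq_eq_ofReal {α F : Type*} [MeasurableSpace α] {μ : Measure α}
    [NormedAddCommGroup F] {f : α → F} (hf : MemLp f 2 μ) :
    ∫⁻ x, ‖f x‖ₑ ^ (2 : ℝ) ∂μ = ENNReal.ofReal (∫ x, ‖f x‖ ^ 2 ∂μ) := by
  rw [lintegral_rpow_eq_ofReal two_pos (by rwa [ofReal_two])]
  simp

theorem tendsto_integral_rpow_of_tendsto_lintegral_sub {α F : Type*} [MeasurableSpace α]
    {μ : Measure α} [NormedAddCommGroup F] {f : ℕ → α → F} {f₀ : α → F} {p : ℝ} (hp : 1 ≤ p)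
    (hf : ∀ n, MemLp (f n) (ENNReal.ofReal p) μ) (hf₀ : MemLp f₀ (ENNReal.ofReal p) μ)
    (h : Tendsto (fun n => ∫⁻ x, ‖f n x - f₀ x‖ₑ ^ p ∂μ) atTop (𝓝 0)) :
    Tendsto (fun n => ∫ x, ‖f n x‖ ^ p ∂μ) atTop (𝓝 (∫ x, ‖f₀ x‖ ^ p ∂μ)) := by
  have hp0 : 0 < p := by linarith
  have : Fact ((1 : ℝ≥0∞) ≤ ENNReal.ofReal p) := ⟨by simpa using hp⟩
  have h1 : Tendsto (fun n => (hf n).toLp) atTop (𝓝 hf₀.toLp) := by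
    rw [Lp.tendsto_Lp_iff_tendsto_eLpNorm'']
    have h2 := ((ENNReal.continuous_rpow_const (y := 1 / p)).tendsto _).comp h
    simp only [ENNReal.zero_rpow_of_pos (one_div_pos.2 hp0)] at h2
    refine h2.congr fun n => ?_
    rw [eLpNorm_eq_lintegral_rpow_enorm_toReal (by simpa using hp0) (by simp),
      ENNReal.toReal_ofReal hp0.le]
    simp
  have h2 : ∀ (w : α → F) (hw : MemLp w (ENNReal.ofReal p) μ),
      ‖hw.toLp‖ ^ p = ∫ x, ‖w x‖ ^ p ∂μ := by
    intro w hw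
    rw [integral_rpow_eq_toReal hw.aestronglyMeasurable hp0.le, Lp.norm_toLp,
      eLpNorm_eq_lintegral_rpow_enorm_toReal (by simpa using hp0) (by simp),
      ENNReal.toReal_ofReal hp0.le, ENNReal.toReal_rpow, ← ENNReal.rpow_mul,
      one_div_mul_cancel hp0.ne', ENNReal.rpow_one]
  rw [← h2 f₀ hf₀]
  simp_rw [← h2 _ (hf _)]
  exact (Real.continuousAt_rpow_const _ _ (Or.inr hp0.le)).tendsto.comp h1.norm

end WeakCompactness

/-! ### Weak limits and strong convergence in a weighted L^p space -/

section Compactness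

variable {N : ℕ}

/-- A positive integrable weight. -/
noncomputable def wt (x : Euc N) : ℝ := (1 + ‖x‖) ^ (-((N : ℝ) + 1))

theorem wt_pos (x : Euc N) : 0 < wt x := by unfold wt; positivity

theorem wt_le_one (x : Euc N) : wt x ≤ 1 :=
  Real.rpow_le_one_of_one_le_of_nonpos (by linarith [norm_nonneg x])
    (by linarith [(Nat.cast_nonneg N : (0 : ℝ) ≤ N)])

theorem continuous_wt : Continuous (wt : Euc N → ℝ) :=
  Continuous.rpow_const (by fun_prop) fun x => Or.inl (by positivity)

theorem integrable_wt : Integrable (wt : Euc N → ℝ) :=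
  integrable_one_add_norm (by rw [finrank_euc]; linarith)

theorem lintegral_wt_ne_top : ∫⁻ x : Euc N, ‖wt x‖ₑ ≠ ⊤ := integrable_wt.hasFiniteIntegral.ne

theorem enorm_wt_le_one (x : Euc N) : ‖wt x‖ₑ ≤ 1 := by
  rw [← ofReal_norm, Real.norm_of_nonneg (wt_pos x).le]
  exact ENNReal.ofReal_le_one.2 (wt_le_one x)

theorem sq_le_one_add_rpow (a : ℝ≥0∞) {p : ℝ} (hp : 2 < p) : a ^ (2 : ℝ) ≤ 1 + a ^ p := by
  rcases le_total a 1 with h | h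
  · exact (ENNReal.rpow_le_one h (by norm_num)).trans le_self_add
  · exact (ENNReal.rpow_le_rpow_of_exponent_le h hp.le).trans le_add_self

theorem rpow_add_three_le (a b c : ℝ≥0∞) {p : ℝ} (hp : 1 ≤ p) :
    (a + b + c) ^ p ≤ 2 ^ (p - 1) * 2 ^ (p - 1) * (a ^ p + b ^ p + c ^ p) := by
  have h1 : (1 : ℝ≥0∞) ≤ 2 ^ (p - 1) := by
    simpa using ENNReal.rpow_le_rpow (by norm_num : (1 : ℝ≥0∞) ≤ 2) (by linarith : 0 ≤ p - 1)
  calc (a + b + c) ^ p ≤ 2 ^ (p - 1) * ((a + b) ^ p + c ^ p) :=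
        ENNReal.rpow_add_le_mul_rpow_add_rpow _ _ hp
    _ ≤ 2 ^ (p - 1) * (2 ^ (p - 1) * (a ^ p + b ^ p) + 2 ^ (p - 1) * c ^ p) := by
        gcongr
        · exact ENNReal.rpow_add_le_mul_rpow_add_rpow _ _ hp
        · exact le_mul_of_one_le_left zero_le h1
    _ = _ := by ring

theorem hasWeakGradient_of_tendsto_inner {u : ℕ → Euc N → ℝ}
    {g : ℕ → Euc N → Euc N} (h : ∀ i, HasWeakGradient (u i) (g i)) {u₀ : Euc N → ℝ}
    {g₀ : Euc N → Euc N} (hu₀ : LocallyIntegrable u₀ volume) (hg₀ : LocallyIntegrable g₀ volume)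
    (hu : ∀ φ : Euc N → ℝ, Continuous φ → HasCompactSupport φ →
      Tendsto (fun i => ∫ x, φ x * u i x) atTop (𝓝 (∫ x, φ x * u₀ x)))
    (hg : ∀ φ : Euc N → Euc N, MemLp φ 2 volume →
      Tendsto (fun i => ∫ x, inner ℝ (φ x) (g i x)) atTop (𝓝 (∫ x, inner ℝ (φ x) (g₀ x)))) :
    HasWeakGradient u₀ g₀ where
  locallyIntegrable := hu₀
  locallyIntegrable_grad := hg₀
  integral_eq φ hφ hc := by
    have hφg : Continuous (gradient φ) := continuous_gradient (hφ.of_le (by simp))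
    have hφgc := hasCompactSupport_gradient hc
    refine ext_inner_left ℝ fun v => ?_
    have e1 : ∀ w : Euc N → ℝ, LocallyIntegrable w volume →
        inner ℝ v (∫ x, w x • gradient φ x) = ∫ x, inner ℝ v (gradient φ x) * w x := by
      intro w hw
      rw [← integral_inner (integrable_smul_gradient hw hφ hc)]
      refine integral_congr_ae (ae_of_all _ fun x => ?_)
      simp only [inner_smul_right]; ring
    have e2 : ∀ w : Euc N → Euc N, LocallyIntegrable w volume →
        inner ℝ v (∫ x, φ x • w x) = ∫ x, inner ℝ (φ x • v) (w x) := by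
      intro w hw
      rw [← integral_inner (integrable_smul_grad hw hφ.continuous hc)]
      refine integral_congr_ae (ae_of_all _ fun x => ?_)
      simp only [inner_smul_right, inner_smul_left, starRingEnd_apply, star_trivial]
    rw [inner_neg_right, e1 u₀ hu₀, e2 g₀ hg₀]
    refine tendsto_nhds_unique (hu (fun x => inner ℝ v (gradient φ x)) (by fun_prop)
      (hφgc.comp_left (g := fun y => inner ℝ v y) (by simp))) ?_
    have h3 := hg (fun x => φ x • v)
      ((hφ.continuous.smul continuous_const).memLp_of_hasCompactSupport hc.smul_right)
    refine h3.neg.congr fun i => ?_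
    rw [← e1 _ (h i).locallyIntegrable, ← e2 _ (h i).locallyIntegrable_grad,
      (h i).integral_eq φ hφ hc, inner_neg_right]

/-- Extraction of a weakly convergent subsequence from a sequence with bounded `Lᵖ` norms and
bounded Dirichlet integrals. -/
theorem exists_subseq_weak {p : ℝ} (hp : 2 < p) {u : ℕ → Euc N → ℝ} {g : ℕ → Euc N → Euc N}
    (h : ∀ n, HasWeakGradient (u n) (g n)) (hg : ∀ n, MemLp (g n) 2 volume) {M : ℝ≥0∞}
    (hM : M ≠ ⊤) (hgM : ∀ n, ∫⁻ x, ‖g n x‖ₑ ^ (2 : ℝ) ≤ M) (huM : ∀ n, ∫⁻ x, ‖u n x‖ₑ ^ p ≤ M) :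
    ∃ (k : ℕ → ℕ) (u₀ : Euc N → ℝ) (g₀ : Euc N → Euc N), StrictMono k ∧ HasWeakGradient u₀ g₀ ∧
      MemLp g₀ 2 volume ∧
      (∀ φ : Euc N → ℝ, Continuous φ → HasCompactSupport φ →
        Tendsto (fun n => ∫ x, φ x * u (k n) x) atTop (𝓝 (∫ x, φ x * u₀ x))) ∧
      (∀ φ : Euc N → Euc N, MemLp φ 2 volume →
        Tendsto (fun n => ∫ x, inner ℝ (φ x) (g (k n) x)) atTop
          (𝓝 (∫ x, inner ℝ (φ x) (g₀ x)))) := by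
  obtain ⟨k₁, g₀, hk₁, hg₀, hgl⟩ := exists_subseq_weak_L2 hg hM hgM
  have hmu := fun n => (h n).locallyIntegrable.aestronglyMeasurable
  have hwm : AEStronglyMeasurable (wt : Euc N → ℝ) volume := continuous_wt.aestronglyMeasurable
  -- Since wt ≤ 1 and s² ≤ 1 + s^p, the square of wt·u is at most wt + |u|^p. The weighted sequence
  -- is thus bounded in L², and Hilbert space compactness suffices for the functions as well as for
  -- the gradients.
  have hb : ∀ n, ∫⁻ x, ‖wt x * u (k₁ n) x‖ₑ ^ (2 : ℝ) ≤ (∫⁻ x : Euc N, ‖wt x‖ₑ) + M := by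
    intro n
    calc ∫⁻ x, ‖wt x * u (k₁ n) x‖ₑ ^ (2 : ℝ) ≤ ∫⁻ x, (‖wt x‖ₑ + ‖u (k₁ n) x‖ₑ ^ p) := by
          refine lintegral_mono fun x => ?_
          have hw := enorm_wt_le_one x
          rw [enorm_mul, ENNReal.mul_rpow_of_nonneg _ _ (by norm_num)]
          calc ‖wt x‖ₑ ^ (2 : ℝ) * ‖u (k₁ n) x‖ₑ ^ (2 : ℝ)
              ≤ ‖wt x‖ₑ * (1 + ‖u (k₁ n) x‖ₑ ^ p) := by
                refine mul_le_mul' ?_ (sq_le_one_add_rpow _ hp)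
                calc ‖wt x‖ₑ ^ (2 : ℝ) ≤ ‖wt x‖ₑ ^ (1 : ℝ) :=
                      ENNReal.rpow_le_rpow_of_exponent_ge hw (by norm_num)
                  _ = _ := ENNReal.rpow_one _
            _ = ‖wt x‖ₑ + ‖wt x‖ₑ * ‖u (k₁ n) x‖ₑ ^ p := by ring
            _ ≤ _ := by gcongr; exact mul_le_of_le_one_left zero_le hw
      _ = (∫⁻ x : Euc N, ‖wt x‖ₑ) + ∫⁻ x, ‖u (k₁ n) x‖ₑ ^ p :=
          lintegral_add_left' hwm.enorm _
      _ ≤ _ := by gcongr; exact huM _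
  have hbt : (∫⁻ x : Euc N, ‖wt x‖ₑ) + M ≠ ⊤ := by simp [hM, lintegral_wt_ne_top]
  obtain ⟨k₂, f₀, hk₂, hf₀, hfl⟩ := exists_subseq_weak_L2 (μ := (volume : Measure (Euc N)))
    (f := fun n x => wt x * u (k₁ n) x)
    (fun n => memLp_two_of_lintegral_sq_ne_top (hwm.mul (hmu _)) (ne_top_of_le_ne_top hbt (hb n)))
    hbt hb
  have hwi : Continuous fun x : Euc N => (wt x)⁻¹ :=
    continuous_wt.inv₀ fun x => (wt_pos x).ne'
  have hl : LocallyIntegrable (fun x => (wt x)⁻¹ * f₀ x) volume := by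
    rw [← locallyIntegrableOn_univ]
    exact ((locallyIntegrableOn_univ.2 (hf₀.locallyIntegrable (by norm_num))).continuousOn_mul
      hwi.continuousOn isOpen_univ.isLocallyClosed)
  have hul : ∀ φ : Euc N → ℝ, Continuous φ → HasCompactSupport φ →
      Tendsto (fun n => ∫ x, φ x * u (k₁ (k₂ n)) x) atTop
        (𝓝 (∫ x, φ x * ((wt x)⁻¹ * f₀ x))) := by
    intro φ hφ hc
    have := hfl (fun x => φ x * (wt x)⁻¹)
      ((hφ.mul hwi).memLp_of_hasCompactSupport hc.mul_right)
    simp only [RCLike.inner_apply, conj_trivial] at this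
    have e0 : ∫ x, φ x * ((wt x)⁻¹ * f₀ x) = ∫ x, f₀ x * (φ x * (wt x)⁻¹) :=
      integral_congr_ae (ae_of_all _ fun x => by ring)
    rw [e0]
    refine this.congr fun n => integral_congr_ae (ae_of_all _ fun x => ?_)
    have := (wt_pos x).ne'
    simp only
    field_simp
  have hgl' : ∀ φ : Euc N → Euc N, MemLp φ 2 volume →
        Tendsto (fun n => ∫ x, inner ℝ (φ x) (g (k₁ (k₂ n)) x)) atTop
          (𝓝 (∫ x, inner ℝ (φ x) (g₀ x))) :=
    fun φ hφ => (hgl φ hφ).comp hk₂.tendsto_atTop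
  exact ⟨k₁ ∘ k₂, fun x => (wt x)⁻¹ * f₀ x, g₀, hk₁.comp hk₂,
    hasWeakGradient_of_tendsto_inner (fun n => h (k₁ (k₂ n))) hl
      (hg₀.locallyIntegrable (by norm_num)) hul hgl', hg₀, hul, hgl'⟩

theorem moll_eq_integral_mul (φ : ContDiffBump (0 : Euc N)) (u : Euc N → ℝ) (x : Euc N) :
    moll φ u x = ∫ y, φ.normed volume (x - y) * u y := by
  unfold moll
  rw [← integral_sub_left_eq_self _ volume x]
  simp

/-- Weak convergence implies strong convergence in a weighted `Lᵖ` space. -/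
theorem tendsto_weighted_of_weak (hN : 1 ≤ N) {p : ℝ} (hp : 2 < p) (ha : singExp N p < 1)
    {u : ℕ → Euc N → ℝ} {g : ℕ → Euc N → Euc N} {u₀ : Euc N → ℝ} {g₀ : Euc N → Euc N}
    (h : ∀ n, HasWeakGradient (u n) (g n)) {M : ℝ≥0∞} (hM : M ≠ ⊤)
    (hgM : ∀ n, ∫⁻ x, ‖g n x‖ₑ ^ (2 : ℝ) ≤ M) (huM : ∀ n, ∫⁻ x, ‖u n x‖ₑ ^ p ≤ M)
    (h₀ : HasWeakGradient u₀ g₀) (hg₀ : ∫⁻ x, ‖g₀ x‖ₑ ^ (2 : ℝ) ≤ M)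
    (hul : ∀ φ : Euc N → ℝ, Continuous φ → HasCompactSupport φ →
        Tendsto (fun n => ∫ x, φ x * u n x) atTop (𝓝 (∫ x, φ x * u₀ x))) :
    Tendsto (fun n => ∫⁻ x, ‖wt x‖ₑ * ‖u n x - u₀ x‖ₑ ^ p) atTop (𝓝 0) := by
  have hp0 : 0 < p := by linarith
  have hmu := fun n => (h n).locallyIntegrable.aestronglyMeasurable
  have hmu₀ := h₀.locallyIntegrable.aestronglyMeasurable
  have hcm : ∀ m n, Continuous (moll (bumpSeq (Euc N) m) (u n)) :=
    fun m n => continuous_moll _ (h n).locallyIntegrable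
  have hcm₀ : ∀ m, Continuous (moll (bumpSeq (Euc N) m) u₀) :=
    fun m => continuous_moll _ h₀.locallyIntegrable
  have hmw : Measurable fun x : Euc N => ‖wt x‖ₑ := continuous_wt.enorm.measurable
  set c : ℝ≥0∞ := 2 ^ (p - 1) * 2 ^ (p - 1) with hc
  have hctop : c ≠ ⊤ := ENNReal.mul_ne_top
    (ENNReal.rpow_ne_top_of_nonneg (by linarith) (by simp))
    (ENNReal.rpow_ne_top_of_nonneg (by linarith) (by simp))
  set K : ℕ → ℝ≥0∞ := fun m => mollConst (Euc N) p (bumpSeq (Euc N) m).rOut * M ^ (p / 2) with hK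
  have hKlim : Tendsto K atTop (𝓝 0) := by
    have h2 := (tendsto_mollConst (E := Euc N) (by rwa [finrank_euc]) hp
      (by rwa [finrank_euc])).comp (tendsto_bumpSeq_rOut (E := Euc N))
    have := ENNReal.Tendsto.mul_const (b := M ^ (p / 2)) h2
      (Or.inr (ENNReal.rpow_ne_top_of_nonneg (by linarith) hM))
    rwa [zero_mul] at this
  -- A mollification at x is an integral against a continuous compactly supported kernel, so weak
  -- convergence becomes pointwise convergence.
  have hpt : ∀ m x, Tendsto (fun n => moll (bumpSeq (Euc N) m) (u n) x) atTop
      (𝓝 (moll (bumpSeq (Euc N) m) u₀ x)) := by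
    intro m x
    simp only [moll_eq_integral_mul]
    exact hul _ ((bumpSeq (Euc N) m).continuous_normed.comp (continuous_const.sub continuous_id))
      ((bumpSeq (Euc N) m).hasCompactSupport_normed.comp_homeomorph (Homeomorph.subLeft x))
  have hsup : ∀ m n x, ‖moll (bumpSeq (Euc N) m) (u n) x‖ₑ ^ p ≤
      kernelBound (Euc N) (bumpSeq (Euc N) m).rOut * M := fun m n x =>
    (enorm_moll_rpow_le_bound _ (bumpSeq_rOut_le m) (hmu n) (by linarith) x).trans
      (mul_le_mul_right (huM n) _)
  have hsup₀ : ∀ m x, ‖moll (bumpSeq (Euc N) m) u₀ x‖ₑ ^ p ≤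
      kernelBound (Euc N) (bumpSeq (Euc N) m).rOut * M := fun m x =>
    le_of_tendsto (((ENNReal.continuous_rpow_const (y := p)).tendsto _).comp (hpt m x).enorm)
      (Eventually.of_forall fun n => hsup m n x)
  -- At a fixed scale the mollifications are bounded uniformly in n and x. The integrable weight
  -- turns this bound into an integrable majorant.
  have hmid : ∀ m, Tendsto (fun n => ∫⁻ x, ‖wt x‖ₑ * ‖moll (bumpSeq (Euc N) m) (u n) x -
      moll (bumpSeq (Euc N) m) u₀ x‖ₑ ^ p) atTop (𝓝 0) := by
    intro m
    set B := kernelBound (Euc N) (bumpSeq (Euc N) m).rOut * M with hB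
    have hBt : B ≠ ⊤ := ENNReal.mul_ne_top (kernelBound_ne_top _) hM
    have h2t : (2 : ℝ≥0∞) ^ (p - 1) ≠ ⊤ := ENNReal.rpow_ne_top_of_nonneg (by linarith) (by simp)
    have := tendsto_lintegral_of_dominated_convergence (μ := (volume : Measure (Euc N)))
      (F := fun n x => ‖wt x‖ₑ * ‖moll (bumpSeq (Euc N) m) (u n) x -
        moll (bumpSeq (Euc N) m) u₀ x‖ₑ ^ p) (f := fun _ => 0)
      (fun x => ‖wt x‖ₑ * (2 ^ (p - 1) * (B + B)))
      (fun n => hmw.mul ((((hcm m n).sub (hcm₀ m)).enorm.measurable).pow_const p))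
      (fun n => ae_of_all _ fun x => by
        refine mul_le_mul_right ?_ _
        calc ‖moll (bumpSeq (Euc N) m) (u n) x - moll (bumpSeq (Euc N) m) u₀ x‖ₑ ^ p
            ≤ (‖moll (bumpSeq (Euc N) m) (u n) x‖ₑ + ‖moll (bumpSeq (Euc N) m) u₀ x‖ₑ) ^ p := by
              gcongr; exact enorm_sub_le
          _ ≤ 2 ^ (p - 1) * (‖moll (bumpSeq (Euc N) m) (u n) x‖ₑ ^ p +
              ‖moll (bumpSeq (Euc N) m) u₀ x‖ₑ ^ p) :=
            ENNReal.rpow_add_le_mul_rpow_add_rpow _ _ (by linarith)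
          _ ≤ _ := by
            gcongr
            · exact hsup m n x
            · exact hsup₀ m x)
      (by
        rw [lintegral_mul_const _ hmw]
        exact ENNReal.mul_ne_top lintegral_wt_ne_top (ENNReal.mul_ne_top h2t (by simp [hBt])))
      (ae_of_all _ fun x => by
        have h1 : Tendsto (fun n => moll (bumpSeq (Euc N) m) (u n) x -
            moll (bumpSeq (Euc N) m) u₀ x) atTop (𝓝 0) := by
          simpa using (hpt m x).sub_const (moll (bumpSeq (Euc N) m) u₀ x)
        have h2 := ((ENNReal.continuous_rpow_const (y := p)).tendsto _).comp h1.enorm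
        simp only [enorm_zero, ENNReal.zero_rpow_of_pos hp0] at h2
        have h3 := ENNReal.Tendsto.const_mul (a := ‖wt x‖ₑ) h2 (Or.inr (by simp))
        rw [mul_zero] at h3
        exact h3)
    simpa using this
  -- Splitting of u n - u₀ into two mollification errors, at most K m uniformly in n, and a
  -- difference of mollifications. The scale m is fixed first, and then n tends to infinity.
  have hbound : ∀ m n, ∫⁻ x, ‖wt x‖ₑ * ‖u n x - u₀ x‖ₑ ^ p ≤ c * (K m + K m) +
      c * ∫⁻ x, ‖wt x‖ₑ * ‖moll (bumpSeq (Euc N) m) (u n) x -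
        moll (bumpSeq (Euc N) m) u₀ x‖ₑ ^ p := by
    intro m n
    set v := moll (bumpSeq (Euc N) m) (u n) with hv
    set v₀ := moll (bumpSeq (Euc N) m) u₀ with hv₀
    have hm1 : AEMeasurable (fun x => ‖u n x - v x‖ₑ ^ p) volume :=
      ((hmu n).sub (hcm m n).aestronglyMeasurable).enorm.pow_const p
    have hm2 : AEMeasurable (fun x => ‖u₀ x - v₀ x‖ₑ ^ p) volume :=
      (hmu₀.sub (hcm₀ m).aestronglyMeasurable).enorm.pow_const p
    have hm12 : AEMeasurable (fun x => ‖u n x - v x‖ₑ ^ p + ‖u₀ x - v₀ x‖ₑ ^ p) volume :=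
      hm1.add hm2
    have b1 : ∫⁻ x, ‖u n x - v x‖ₑ ^ p ≤ K m :=
      ((h n).lintegral_sub_moll_rpow_le _ (bumpSeq_rOut_le m) hp).trans
        (mul_le_mul_right (ENNReal.rpow_le_rpow (hgM n) (by linarith)) _)
    have b2 : ∫⁻ x, ‖u₀ x - v₀ x‖ₑ ^ p ≤ K m :=
      (h₀.lintegral_sub_moll_rpow_le _ (bumpSeq_rOut_le m) hp).trans
        (mul_le_mul_right (ENNReal.rpow_le_rpow hg₀ (by linarith)) _)
    calc ∫⁻ x, ‖wt x‖ₑ * ‖u n x - u₀ x‖ₑ ^ p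
        ≤ ∫⁻ x, c * ((‖u n x - v x‖ₑ ^ p + ‖u₀ x - v₀ x‖ₑ ^ p) +
            ‖wt x‖ₑ * ‖v x - v₀ x‖ₑ ^ p) := by
          refine lintegral_mono fun x => ?_
          have hw := enorm_wt_le_one x
          have e : u n x - u₀ x = (u n x - v x) + (v x - v₀ x) + -(u₀ x - v₀ x) := by ring
          calc ‖wt x‖ₑ * ‖u n x - u₀ x‖ₑ ^ p
              ≤ ‖wt x‖ₑ * (‖u n x - v x‖ₑ + ‖v x - v₀ x‖ₑ + ‖u₀ x - v₀ x‖ₑ) ^ p := by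
                gcongr
                rw [e]
                refine (enorm_add_le _ _).trans ?_
                rw [enorm_neg]
                gcongr
                exact enorm_add_le _ _
            _ ≤ ‖wt x‖ₑ * (c * (‖u n x - v x‖ₑ ^ p + ‖v x - v₀ x‖ₑ ^ p +
                  ‖u₀ x - v₀ x‖ₑ ^ p)) := by
                gcongr; exact rpow_add_three_le _ _ _ (by linarith)
            _ = c * (‖wt x‖ₑ * (‖u n x - v x‖ₑ ^ p + ‖u₀ x - v₀ x‖ₑ ^ p) +
                  ‖wt x‖ₑ * ‖v x - v₀ x‖ₑ ^ p) := by ring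
            _ ≤ _ := by
                gcongr
                exact mul_le_of_le_one_left zero_le hw
      _ = c * (((∫⁻ x, ‖u n x - v x‖ₑ ^ p) + ∫⁻ x, ‖u₀ x - v₀ x‖ₑ ^ p) +
            ∫⁻ x, ‖wt x‖ₑ * ‖v x - v₀ x‖ₑ ^ p) := by
          rw [lintegral_const_mul' _ _ hctop, lintegral_add_left' hm12,
            lintegral_add_left' hm1]
      _ ≤ c * ((K m + K m) + ∫⁻ x, ‖wt x‖ₑ * ‖v x - v₀ x‖ₑ ^ p) := by gcongr
      _ = _ := mul_add _ _ _
  rw [ENNReal.tendsto_nhds_zero]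
  intro ε hε
  have hε2 : 0 < ε / 2 := ENNReal.div_pos hε.ne' (by simp)
  have hcK : Tendsto (fun m => c * (K m + K m)) atTop (𝓝 0) := by
    have := ENNReal.Tendsto.const_mul (a := c) (hKlim.add hKlim) (Or.inr hctop)
    simpa using this
  obtain ⟨m, hm⟩ := (ENNReal.tendsto_nhds_zero.1 hcK (ε / 2) hε2).exists
  have hcmid : Tendsto (fun n => c * ∫⁻ x, ‖wt x‖ₑ * ‖moll (bumpSeq (Euc N) m) (u n) x -
      moll (bumpSeq (Euc N) m) u₀ x‖ₑ ^ p) atTop (𝓝 0) := by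
    have := ENNReal.Tendsto.const_mul (a := c) (hmid m) (Or.inr hctop)
    rwa [mul_zero] at this
  filter_upwards [ENNReal.tendsto_nhds_zero.1 hcmid (ε / 2) hε2] with n hn
  calc _ ≤ _ := hbound m n
    _ ≤ ε / 2 + ε / 2 := add_le_add hm hn
    _ = ε := ENNReal.add_halves ε

end Compactness

/-! ### A priori bounds and compactness in E -/

section Sobolev

variable {N : ℕ}

theorem MemE.hasWeakGradient {p : ℝ} {u : Euc N → ℝ} (h : MemE p u) :
    HasWeakGradient u (weakGrad u) :=
  let ⟨_, _, hg, _⟩ := h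
  weakGrad_spec hg

theorem MemE.memLp_weakGrad {p : ℝ} {u : Euc N → ℝ} (h : MemE p u) :
    MemLp (weakGrad u) 2 volume :=
  let ⟨_, _, hg, hg2⟩ := h
  hg2.ae_eq hg.weakGrad_ae.symm

theorem memE_of_hasWeakGradient {p : ℝ} {u : Euc N → ℝ} {g : Euc N → Euc N}
    (hu : MemLp u (ENNReal.ofReal p) volume) (h : HasWeakGradient u g) (hg : MemLp g 2 volume) :
    MemE p u := ⟨hu, g, h, hg⟩

/-- The subcritical Sobolev embedding. -/
theorem memLp_of_memH1 {p : ℝ} (hp : 2 < p) (ha : singExp N p < 1) {u : Euc N → ℝ}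
    (h : MemH1 u) : MemLp u (ENNReal.ofReal p) volume := by
  obtain ⟨hu, g, hg, hg2⟩ := h
  have hp0 : 0 < p := by linarith
  set φ := bumpSeq (Euc N) 0
  have hφ : φ.rOut ≤ 2 * φ.rIn := bumpSeq_rOut_le 0
  have hmu := hu.aestronglyMeasurable
  have hmc := continuous_moll φ hg.locallyIntegrable
  have h1 : MemLp (fun x => u x - moll φ u x) (ENNReal.ofReal p) volume := by
    refine memLp_of_lintegral_rpow_ne_top hp0 (hmu.sub hmc.aestronglyMeasurable) ?_
    refine ne_top_of_le_ne_top (ENNReal.mul_ne_top ?_ ?_) (hg.lintegral_sub_moll_rpow_le φ hφ hp)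
    · exact mollConst_ne_top hp (by rwa [finrank_euc])
    · exact ENNReal.rpow_ne_top_of_nonneg (by linarith) (lintegral_sq_ne_top_of_memLp hg2)
  have h2 : MemLp (moll φ u) (ENNReal.ofReal p) volume := by
    refine memLp_of_lintegral_rpow_ne_top hp0 hmc.aestronglyMeasurable ?_
    refine ne_top_of_le_ne_top (ENNReal.mul_ne_top ?_ ?_)
      (lintegral_moll_rpow_le_of_sq φ hφ hmu hp)
    · exact ENNReal.rpow_ne_top_of_nonneg (by linarith) (kernelBound_ne_top _)
    · exact ENNReal.rpow_ne_top_of_nonneg (by linarith) (lintegral_sq_ne_top_of_memLp hu)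
  have := h1.add h2
  have e : ((fun x => u x - moll φ u x) + moll φ u) = u := by ext x; simp
  rwa [e] at this

/-- On a set of finite measure the `Lᵖ` norm is controlled by the Dirichlet integral up to an
arbitrarily small multiple of the global `Lᵖ` norm. -/
theorem exists_const_lintegral_rpow_le (hN : 1 ≤ N) {p : ℝ} (hp : 2 < p) (ha : singExp N p < 1)
    {Ω : Set (Euc N)} (hΩ : volume Ω ≠ ⊤) {η : ℝ≥0∞} (hη : 0 < η) :
    ∃ C : ℝ≥0∞, C ≠ ⊤ ∧ ∀ (u : Euc N → ℝ) (g : Euc N → Euc N), HasWeakGradient u g →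
      ∫⁻ x in Ω, ‖u x‖ₑ ^ p ≤ C * (∫⁻ x, ‖g x‖ₑ ^ (2 : ℝ)) ^ (p / 2) + η * ∫⁻ x, ‖u x‖ₑ ^ p := by
  have hp0 : 0 < p := by linarith
  set c : ℝ≥0∞ := 2 ^ (p - 1) with hc
  have hctop : c ≠ ⊤ := ENNReal.rpow_ne_top_of_nonneg (by linarith) (by simp)
  have hlim : Tendsto (fun R => c * volume Ω * kernelBound (Euc N) R) atTop (𝓝 0) := by
    have := ENNReal.Tendsto.const_mul (a := c * volume Ω)
      (tendsto_kernelBound_atTop (E := Euc N) (by rwa [finrank_euc]))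
      (Or.inr (ENNReal.mul_ne_top hctop hΩ))
    rwa [mul_zero] at this
  -- The scale R is taken large: on Ω the mollified part is bounded by the kernel bound times the
  -- full L^p mass, and this factor, multiplied by the volume of Ω, must not exceed η.
  obtain ⟨R, hR, hRη⟩ := ((eventually_gt_atTop (0 : ℝ)).and
    (ENNReal.tendsto_nhds_zero.1 hlim η hη)).exists
  set φ := stdBump (Euc N) R hR with hφd
  have hφ : φ.rOut ≤ 2 * φ.rIn := stdBump_rOut_le R hR
  have hφR : φ.rOut = R := rfl
  refine ⟨c * mollConst (Euc N) p R,
    ENNReal.mul_ne_top hctop (mollConst_ne_top hp (by rwa [finrank_euc])), fun u g h => ?_⟩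
  have hmu := h.locallyIntegrable.aestronglyMeasurable
  have hmc := continuous_moll φ h.locallyIntegrable
  have hm1 : AEMeasurable (fun x => ‖u x - moll φ u x‖ₑ ^ p) volume :=
    (hmu.sub hmc.aestronglyMeasurable).enorm.pow_const p
  calc ∫⁻ x in Ω, ‖u x‖ₑ ^ p
      ≤ ∫⁻ x in Ω, c * (‖u x - moll φ u x‖ₑ ^ p + ‖moll φ u x‖ₑ ^ p) := by
        refine lintegral_mono fun x => ?_
        calc ‖u x‖ₑ ^ p ≤ (‖u x - moll φ u x‖ₑ + ‖moll φ u x‖ₑ) ^ p := by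
              gcongr
              simpa using enorm_add_le (u x - moll φ u x) (moll φ u x)
          _ ≤ _ := ENNReal.rpow_add_le_mul_rpow_add_rpow _ _ (by linarith)
    _ = c * ((∫⁻ x in Ω, ‖u x - moll φ u x‖ₑ ^ p) + ∫⁻ x in Ω, ‖moll φ u x‖ₑ ^ p) := by
        rw [lintegral_const_mul' _ _ hctop, lintegral_add_left' hm1.restrict]
    _ ≤ c * ((∫⁻ x, ‖u x - moll φ u x‖ₑ ^ p) +
          ∫⁻ x in Ω, kernelBound (Euc N) R * ∫⁻ x, ‖u x‖ₑ ^ p) := by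
        exact mul_le_mul_right (add_le_add (setLIntegral_le_lintegral _ _)
          (lintegral_mono fun x => enorm_moll_rpow_le_bound φ hφ hmu (by linarith) x)) _
    _ ≤ c * (mollConst (Euc N) p R * (∫⁻ x, ‖g x‖ₑ ^ (2 : ℝ)) ^ (p / 2) +
          (kernelBound (Euc N) R * ∫⁻ x, ‖u x‖ₑ ^ p) * volume Ω) := by
        rw [setLIntegral_const]
        gcongr
        exact h.lintegral_sub_moll_rpow_le φ hφ hp
    _ = c * mollConst (Euc N) p R * (∫⁻ x, ‖g x‖ₑ ^ (2 : ℝ)) ^ (p / 2) +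
          (c * volume Ω * kernelBound (Euc N) R) * ∫⁻ x, ‖u x‖ₑ ^ p := by ring
    _ ≤ _ := by gcongr

/-- The Dirichlet integral `∫ |∇u|²`. -/
noncomputable def dir (u : Euc N → ℝ) : ℝ := ∫ x, ‖weakGrad u x‖ ^ 2

theorem dir_nonneg (u : Euc N → ℝ) : 0 ≤ dir u := integral_nonneg fun x => by positivity

theorem MemE.lintegral_weakGrad {p : ℝ} {u : Euc N → ℝ} (h : MemE p u) :
    ∫⁻ x, ‖weakGrad u x‖ₑ ^ (2 : ℝ) = ENNReal.ofReal (dir u) :=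
  lintegral_sq_eq_ofReal h.memLp_weakGrad

theorem MemE.lintegral_rpow {p : ℝ} (hp : 0 < p) {u : Euc N → ℝ} (h : MemE p u) :
    ∫⁻ x, ‖u x‖ₑ ^ p = ENNReal.ofReal (∫ x, |u x| ^ p) :=
  lintegral_rpow_eq_ofReal hp h.1

theorem MemE.integrable_rpow {p : ℝ} (hp : 0 < p) {u : Euc N → ℝ} (h : MemE p u) :
    Integrable fun x => |u x| ^ p := by
  have := h.1.integrable_norm_rpow (by simpa using hp) (by simp)
  rwa [ENNReal.toReal_ofReal hp.le] at this

theorem MemE.restrict_memLp {p : ℝ} {u : Euc N → ℝ} (h : MemE p u) (Ω : Set (Euc N)) :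
    MemLp u (ENNReal.ofReal p) (volume.restrict Ω) := h.1.restrict Ω

/-- A function whose `Lᵖ` mass sits at least half in `Ω` is controlled by its Dirichlet integral. -/
theorem exists_const_integral_rpow_le (hN : 1 ≤ N) {p : ℝ} (hp : 2 < p) (ha : singExp N p < 1)
    {Ω : Set (Euc N)} (hΩ : volume Ω ≠ ⊤) :
    ∃ C : ℝ, 0 < C ∧ ∀ u : Euc N → ℝ, MemE p u →
      ∫ x, |u x| ^ p ≤ 2 * ∫ x in Ω, |u x| ^ p → ∫ x, |u x| ^ p ≤ C * dir u ^ (p / 2) := by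
  have hp0 : 0 < p := by linarith
  -- With η = 1/4 the mass T satisfies T ≤ 2∫_Ω|u|^p ≤ 2C D^{p/2} + T/2, where D is the Dirichlet
  -- integral; hence T ≤ 4C D^{p/2}. The added 1 below only makes the constant positive.
  obtain ⟨C, hC, hCb⟩ := exists_const_lintegral_rpow_le hN hp ha hΩ
    (η := 4⁻¹) (by simp)
  refine ⟨4 * C.toReal + 1, by positivity, fun u hu h2 => ?_⟩
  have h1 := hCb u _ hu.hasWeakGradient
  set T := ∫ x, |u x| ^ p with hT
  have hT0 : 0 ≤ T := integral_nonneg fun x => by positivity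
  have e1 : ∫⁻ x in Ω, ‖u x‖ₑ ^ p = ENNReal.ofReal (∫ x in Ω, |u x| ^ p) :=
    lintegral_rpow_eq_ofReal hp0 (hu.restrict_memLp Ω)
  have e3 : (4⁻¹ : ℝ≥0∞) = ENNReal.ofReal 4⁻¹ := by
    rw [ENNReal.ofReal_inv_of_pos (by norm_num)]; simp
  have hD := dir_nonneg u
  rw [e1, hu.lintegral_weakGrad, hu.lintegral_rpow hp0,
    ENNReal.ofReal_rpow_of_nonneg hD (by linarith), ← ENNReal.ofReal_toReal hC, e3,
    ← ENNReal.ofReal_mul (by simp), ← ENNReal.ofReal_mul (by norm_num),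
    ← ENNReal.ofReal_add (by positivity) (by positivity),
    ENNReal.ofReal_le_ofReal_iff (by positivity)] at h1
  have : 0 ≤ dir u ^ (p / 2) := by positivity
  linarith

/-- Compactness: bounded sequences in `E` converge almost everywhere and locally in `Lᵖ`, with
weakly convergent gradients, along a subsequence. -/
theorem MemE.exists_subseq (hN : 1 ≤ N) {p : ℝ} (hp : 2 < p) (ha : singExp N p < 1)
    {u : ℕ → Euc N → ℝ} (hu : ∀ n, MemE p (u n)) {M : ℝ} (hD : ∀ n, dir (u n) ≤ M)
    (hP : ∀ n, ∫ x, |u n x| ^ p ≤ M) :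
    ∃ (k : ℕ → ℕ) (u₀ : Euc N → ℝ), StrictMono k ∧ MemE p u₀ ∧
      (∀ᵐ x, Tendsto (fun n => u (k n) x) atTop (𝓝 (u₀ x))) ∧
      (∀ Ω : Set (Euc N), Bornology.IsBounded Ω →
        Tendsto (fun n => ∫ x in Ω, |u (k n) x| ^ p) atTop (𝓝 (∫ x in Ω, |u₀ x| ^ p))) ∧
      (∀ φ : Euc N → Euc N, MemLp φ 2 volume →
        Tendsto (fun n => ∫ x, inner ℝ (φ x) (weakGrad (u (k n)) x)) atTop
          (𝓝 (∫ x, inner ℝ (φ x) (weakGrad u₀ x)))) := by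
  have hp0 : 0 < p := by linarith
  have hgM : ∀ n, ∫⁻ x, ‖weakGrad (u n) x‖ₑ ^ (2 : ℝ) ≤ ENNReal.ofReal M := fun n => by
    rw [(hu n).lintegral_weakGrad]; exact ENNReal.ofReal_le_ofReal (hD n)
  have huM : ∀ n, ∫⁻ x, ‖u n x‖ₑ ^ p ≤ ENNReal.ofReal M := fun n => by
    rw [(hu n).lintegral_rpow hp0]; exact ENNReal.ofReal_le_ofReal (hP n)
  obtain ⟨k, u₀, g₀, hk, h₀, hg₀, hul, hgl⟩ := exists_subseq_weak hp
    (fun n => (hu n).hasWeakGradient) (fun n => (hu n).memLp_weakGrad) ENNReal.ofReal_ne_top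
    hgM huM
  have hg₀t := lintegral_sq_ne_top_of_memLp hg₀
  -- Including the Dirichlet integral of the limit in the bound avoids an appeal to weak lower
  -- semicontinuity.
  have hw := tendsto_weighted_of_weak hN hp ha (fun n => (hu (k n)).hasWeakGradient)
    (M := max (ENNReal.ofReal M) (∫⁻ x, ‖g₀ x‖ₑ ^ (2 : ℝ))) (max_lt ENNReal.ofReal_lt_top hg₀t.lt_top).ne
    (fun n => (hgM _).trans (le_max_left _ _)) (fun n => (huM _).trans (le_max_left _ _))
    h₀ (le_max_right _ _) hul
  have hmu := fun n => (hu n).1.aestronglyMeasurable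
  have hmu₀ := h₀.locallyIntegrable.aestronglyMeasurable
  have hwc : Continuous fun x : Euc N => wt x ^ (1 / p) :=
    continuous_wt.rpow_const fun x => Or.inl (wt_pos x).ne'
  -- The weighted integral is the p-th power of the L^p norm of wt^{1/p}(u - u₀); the positive
  -- factor is divided out once almost everywhere convergence is known.
  obtain ⟨j, hj, hae⟩ := exists_subseq_ae_of_tendsto_lintegral (p := p)
    (f := fun n x => wt x ^ (1 / p) * (u (k n) x - u₀ x))
    (fun n => hwc.aestronglyMeasurable.mul ((hmu _).sub hmu₀)) hp0 (by
      refine hw.congr fun n => lintegral_congr fun x => ?_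
      rw [enorm_mul, ENNReal.mul_rpow_of_nonneg _ _ hp0.le]
      congr 1
      have h0 := wt_pos x
      rw [Real.enorm_eq_ofReal h0.le, Real.enorm_eq_ofReal (by positivity),
        ENNReal.ofReal_rpow_of_nonneg (by positivity) hp0.le, ← Real.rpow_mul h0.le,
        one_div_mul_cancel hp0.ne', Real.rpow_one])
  have hae' : ∀ᵐ x, Tendsto (fun n => u (k (j n)) x) atTop (𝓝 (u₀ x)) := by
    filter_upwards [hae] with x hx
    have h0 : wt x ^ (1 / p) ≠ 0 := (Real.rpow_pos_of_pos (wt_pos x) _).ne'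
    have h1 := (hx.const_mul (wt x ^ (1 / p))⁻¹).add_const (u₀ x)
    rw [mul_zero, zero_add] at h1
    refine h1.congr fun n => ?_
    rw [inv_mul_cancel_left₀ h0]; ring
  have hu₀p : MemLp u₀ (ENNReal.ofReal p) volume := by
    refine memLp_of_lintegral_rpow_ne_top hp0 hmu₀
      (ne_top_of_le_ne_top (ENNReal.ofReal_ne_top (r := M)) ?_)
    calc ∫⁻ x, ‖u₀ x‖ₑ ^ p = ∫⁻ x, liminf (fun n => ‖u (k (j n)) x‖ₑ ^ p) atTop := by
          refine lintegral_congr_ae ?_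
          filter_upwards [hae'] with x hx
          exact (((ENNReal.continuous_rpow_const (y := p)).tendsto _).comp hx.enorm).liminf_eq.symm
      _ ≤ liminf (fun n => ∫⁻ x, ‖u (k (j n)) x‖ₑ ^ p) atTop :=
          lintegral_liminf_le' fun n => (hmu _).enorm.pow_const p
      _ ≤ _ := by
          refine (liminf_le_liminf (Eventually.of_forall fun n => huM (k (j n)))).trans ?_
          simp
  have hE₀ : MemE p u₀ := memE_of_hasWeakGradient hu₀p h₀ hg₀
  refine ⟨k ∘ j, u₀, hk.comp hj, hE₀, hae', ?_, ?_⟩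
  · intro Ω hΩ
    refine tendsto_integral_rpow_of_tendsto_lintegral_sub (by linarith)
      (fun n => (hu _).restrict_memLp Ω) (hE₀.restrict_memLp Ω) ?_
    obtain ⟨r, hr⟩ := hΩ.subset_closedBall 0
    have hr' : Ω ⊆ Metric.closedBall 0 (max r 0) :=
      hr.trans (Metric.closedBall_subset_closedBall (le_max_left _ _))
    set s := max r 0 with hs
    -- The value of the weight on the sphere of radius s, hence its minimum on a ball containing Ω.
    set b : ℝ := (1 + s) ^ (-((N : ℝ) + 1)) with hb
    have hs0 : 0 ≤ s := le_max_right _ _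
    have hb0 : 0 < b := by positivity
    have hbw : ∀ x ∈ Metric.closedBall (0 : Euc N) s, ENNReal.ofReal b ≤ ‖wt x‖ₑ := by
      intro x hx
      rw [Real.enorm_eq_ofReal (wt_pos x).le]
      refine ENNReal.ofReal_le_ofReal ?_
      refine Real.rpow_le_rpow_of_nonpos (by positivity) ?_
        (by linarith [(Nat.cast_nonneg N : (0 : ℝ) ≤ N)])
      have := mem_closedBall_zero_iff.1 hx
      linarith
    have hbe : ENNReal.ofReal b ≠ 0 := by simpa using hb0
    have hw' := ENNReal.Tendsto.const_mul (a := (ENNReal.ofReal b)⁻¹)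
      (hw.comp hj.tendsto_atTop) (Or.inr (by simpa using hbe))
    rw [mul_zero] at hw'
    refine tendsto_of_tendsto_of_tendsto_of_le_of_le tendsto_const_nhds hw' (fun _ => zero_le)
      fun n => ?_
    calc ∫⁻ x in Ω, ‖u (k (j n)) x - u₀ x‖ₑ ^ p
        ≤ ∫⁻ x in Metric.closedBall 0 s, ‖u (k (j n)) x - u₀ x‖ₑ ^ p := lintegral_mono_set hr'
      _ ≤ ∫⁻ x in Metric.closedBall 0 s,
            (ENNReal.ofReal b)⁻¹ * (‖wt x‖ₑ * ‖u (k (j n)) x - u₀ x‖ₑ ^ p) := by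
          refine setLIntegral_mono' Metric.isClosed_closedBall.measurableSet fun x hx => ?_
          rw [← mul_assoc]
          refine le_mul_of_one_le_left zero_le ?_
          rw [← ENNReal.inv_mul_cancel hbe ENNReal.ofReal_ne_top]
          exact mul_le_mul_right (hbw x hx) _
      _ ≤ ∫⁻ x, (ENNReal.ofReal b)⁻¹ * (‖wt x‖ₑ * ‖u (k (j n)) x - u₀ x‖ₑ ^ p) :=
          setLIntegral_le_lintegral _ _
      _ = _ := by
          rw [lintegral_const_mul' _ _ (by simpa using hbe)]
          rfl
  · intro φ hφ
    have e : ∫ x, inner ℝ (φ x) (weakGrad u₀ x) = ∫ x, inner ℝ (φ x) (g₀ x) := by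
      refine integral_congr_ae ?_
      filter_upwards [h₀.weakGrad_ae] with x hx
      rw [hx]
    rw [e]
    exact (hgl φ hφ).comp hj.tendsto_atTop

end Sobolev

/-! ### The energy spaces and their stability under positive and negative parts -/

section FunctionSpace

variable {N : ℕ}

theorem weakGrad_add {p : ℝ} {u v : Euc N → ℝ} (hu : MemE p u) (hv : MemE p v) :
    weakGrad (u + v) =ᵐ[volume] weakGrad u + weakGrad v :=
  (hu.hasWeakGradient.add hv.hasWeakGradient).weakGrad_ae

theorem weakGrad_sub {p : ℝ} {u v : Euc N → ℝ} (hu : MemE p u) (hv : MemE p v) :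
    weakGrad (u - v) =ᵐ[volume] weakGrad u - weakGrad v :=
  (hu.hasWeakGradient.sub hv.hasWeakGradient).weakGrad_ae

theorem weakGrad_smul {p : ℝ} {u : Euc N → ℝ} (hu : MemE p u) (c : ℝ) :
    weakGrad (c • u) =ᵐ[volume] c • weakGrad u :=
  (hu.hasWeakGradient.const_smul c).weakGrad_ae

theorem weakGrad_congr {u v : Euc N → ℝ} (h : u =ᵐ[volume] v) :
    weakGrad u =ᵐ[volume] weakGrad v := by
  by_cases hu : ∃ g, HasWeakGradient u g
  · obtain ⟨g, hg⟩ := hu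
    exact (hg.weakGrad_ae).trans (hg.congr h (ae_eq_refl g)).weakGrad_ae.symm
  · have hv : ¬ ∃ g, HasWeakGradient v g := fun ⟨g, hg⟩ =>
      hu ⟨g, hg.congr h.symm (ae_eq_refl g)⟩
    unfold weakGrad
    rw [dif_neg hu, dif_neg hv]

theorem MemE.add {p : ℝ} {u v : Euc N → ℝ} (hu : MemE p u) (hv : MemE p v) : MemE p (u + v) :=
  memE_of_hasWeakGradient (hu.1.add hv.1) (hu.hasWeakGradient.add hv.hasWeakGradient)
    (hu.memLp_weakGrad.add hv.memLp_weakGrad)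

theorem MemE.const_smul {p : ℝ} {u : Euc N → ℝ} (hu : MemE p u) (c : ℝ) : MemE p (c • u) :=
  memE_of_hasWeakGradient (hu.1.const_smul c) (hu.hasWeakGradient.const_smul c)
    (hu.memLp_weakGrad.const_smul c)

theorem MemE.congr {p : ℝ} {u v : Euc N → ℝ} (hu : MemE p u) (h : u =ᵐ[volume] v) : MemE p v :=
  memE_of_hasWeakGradient (hu.1.ae_eq h) (hu.hasWeakGradient.congr h (ae_eq_refl _))
    hu.memLp_weakGrad

theorem nullMeasurableSet_pos {u : Euc N → ℝ} (hu : AEStronglyMeasurable u volume) :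
    NullMeasurableSet {x | 0 < u x} volume :=
  nullMeasurableSet_lt aemeasurable_const hu.aemeasurable

theorem MemE.hasWeakGradient_pos (hN : 1 ≤ N) {p : ℝ} {u : Euc N → ℝ} (hu : MemE p u) :
    HasWeakGradient (fun x => max (u x) 0) ({x | 0 < u x}.indicator (weakGrad u)) :=
  hu.hasWeakGradient.posPart hN hu.memLp_weakGrad

theorem MemE.pos (hN : 1 ≤ N) {p : ℝ} {u : Euc N → ℝ} (hu : MemE p u) :
    MemE p (fun x => max (u x) 0) := by
  refine memE_of_hasWeakGradient ?_ (hu.hasWeakGradient_pos hN) ?_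
  · exact hu.1.mono (hu.1.aestronglyMeasurable.sup aestronglyMeasurable_const)
      (ae_of_all _ fun x => by
        simp only [Real.norm_eq_abs]
        rcases le_total (u x) 0 with h | h
        · simp [h]
        · simp [h])
  · refine hu.memLp_weakGrad.mono (hu.memLp_weakGrad.aestronglyMeasurable.indicator₀
      (nullMeasurableSet_pos hu.1.aestronglyMeasurable)) (ae_of_all _ fun x => ?_)
    exact norm_indicator_le_norm_self _ _

theorem min_eq_neg_max (u : Euc N → ℝ) :
    (fun x => min (u x) 0) = (-1 : ℝ) • fun x => max (((-1 : ℝ) • u) x) 0 := by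
  ext x
  simp only [Pi.smul_apply, smul_eq_mul, neg_one_mul]
  rw [max_comm, ← neg_zero, ← min_neg_neg]
  simp [min_comm]

/-- The energy space of the problem with mass `μ`: `E`, intersected with `L²` if `μ ≠ 0`. -/
def MemS (μ p : ℝ) (u : Euc N → ℝ) : Prop := MemE p u ∧ (μ ≠ 0 → MemLp u 2 volume)

variable {μ p : ℝ} {u v : Euc N → ℝ}

theorem MemS.add (hu : MemS μ p u) (hv : MemS μ p v) : MemS μ p (u + v) :=
  ⟨hu.1.add hv.1, fun h => (hu.2 h).add (hv.2 h)⟩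

theorem MemS.const_smul (hu : MemS μ p u) (c : ℝ) : MemS μ p (c • u) :=
  ⟨hu.1.const_smul c, fun h => (hu.2 h).const_smul c⟩

theorem MemS.congr (hu : MemS μ p u) (h : u =ᵐ[volume] v) : MemS μ p v :=
  ⟨hu.1.congr h, fun h' => (hu.2 h').ae_eq h⟩

theorem MemS.pos (hN : 1 ≤ N) (hu : MemS μ p u) : MemS μ p (fun x => max (u x) 0) :=
  ⟨hu.1.pos hN, fun h => (hu.2 h).mono (hu.1.pos hN).1.aestronglyMeasurable
    (ae_of_all _ fun x => by
      simp only [Real.norm_eq_abs]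
      rcases le_total (u x) 0 with h | h
      · simp [h]
      · simp [h])⟩

theorem MemS.neg (hN : 1 ≤ N) (hu : MemS μ p u) : MemS μ p (fun x => min (u x) 0) := by
  rw [min_eq_neg_max]
  exact ((hu.const_smul (-1)).pos hN).const_smul (-1)

theorem memS_zero_iff : MemS (N := N) 0 p = MemE p := by
  ext u
  simp [MemS]

/-- The L^p condition is redundant once u and its gradient are in L², by the Sobolev embedding. -/
theorem memS_eq_memH1 (hp : 2 < p) (ha : singExp N p < 1) (hμ : μ ≠ 0) :
    MemS (N := N) μ p = MemH1 := by
  ext u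
  refine ⟨fun h => ⟨h.2 hμ, h.1.2⟩, fun h => ⟨⟨memLp_of_memH1 hp ha h, h.2⟩, fun _ => h.1⟩⟩

theorem max_add_min_zero (u : Euc N → ℝ) :
    ((fun x => max (u x) 0) + fun x => min (u x) 0) = u := by
  ext x
  simp [max_add_min]

end FunctionSpace

/-! ### The quadratic part and the potential part of the energy -/

section Functionals

variable {N : ℕ} {μ p : ℝ} {u v : Euc N → ℝ}

/-- The quadratic part `∫ (|∇u|² + μ u²)` of the energy. -/
noncomputable def quad (μ : ℝ) (u : Euc N → ℝ) : ℝ := ∫ x, (‖weakGrad u x‖ ^ 2 + μ * u x ^ 2)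

/-- The potential part `∫ q |u|ᵖ` of the energy. -/
noncomputable def pot (q : Euc N → ℝ) (p : ℝ) (u : Euc N → ℝ) : ℝ := ∫ x, q x * |u x| ^ p

theorem energy_eq (q : Euc N → ℝ) : energy μ q p u = 1 / 2 * quad μ u - 1 / p * pot q p u := rfl

theorem abs_rpow_sub_two_mul_self_mul_self (hp : 2 < p) (s : ℝ) :
    |s| ^ (p - 2) * s * s = |s| ^ p := by
  rw [mul_assoc, ← sq, ← sq_abs]
  rcases eq_or_ne s 0 with rfl | hs
  · simp [Real.zero_rpow (by linarith : p ≠ 0)]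
  · rw [← Real.rpow_natCast, ← Real.rpow_add (abs_pos.2 hs)]
    congr 1
    push_cast; ring

theorem energyDeriv_self (hp : 2 < p) (q : Euc N → ℝ) :
    energyDeriv μ q p u u = quad μ u - pot q p u := by
  unfold energyDeriv quad pot
  congr 1
  · refine integral_congr_ae (ae_of_all _ fun x => ?_)
    simp only [real_inner_self_eq_norm_sq]
    ring
  · refine integral_congr_ae (ae_of_all _ fun x => ?_)
    simp only
    rw [mul_assoc, abs_rpow_sub_two_mul_self_mul_self hp]

theorem quad_congr (h : u =ᵐ[volume] v) : quad μ u = quad μ v := by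
  refine integral_congr_ae ?_
  filter_upwards [h, weakGrad_congr h] with x h1 h2
  rw [h1, h2]

theorem pot_congr (q : Euc N → ℝ) (h : u =ᵐ[volume] v) : pot q p u = pot q p v := by
  refine integral_congr_ae ?_
  filter_upwards [h] with x h1
  rw [h1]

theorem quad_smul (hu : MemE p u) (c : ℝ) : quad μ (c • u) = c ^ 2 * quad μ u := by
  unfold quad
  rw [← integral_const_mul]
  refine integral_congr_ae ?_
  filter_upwards [weakGrad_smul hu c] with x hx
  rw [hx]
  simp only [Pi.smul_apply, norm_smul, smul_eq_mul, mul_pow, Real.norm_eq_abs, sq_abs]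
  ring

theorem pot_smul (q : Euc N → ℝ) (c : ℝ) : pot q p (c • u) = |c| ^ p * pot q p u := by
  unfold pot
  rw [← integral_const_mul]
  refine integral_congr_ae (ae_of_all _ fun x => ?_)
  simp only [Pi.smul_apply, smul_eq_mul, abs_mul]
  rw [Real.mul_rpow (abs_nonneg _) (abs_nonneg _)]
  ring

theorem MemE.integrable_grad_sq (hu : MemE p u) : Integrable fun x => ‖weakGrad u x‖ ^ 2 := by
  simpa using hu.memLp_weakGrad.integrable_norm_pow two_ne_zero

theorem MemS.integrable_mul_sq (hu : MemS μ p u) : Integrable fun x => μ * u x ^ 2 := by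
  by_cases h : μ = 0
  · simp [h]
  · exact (hu.2 h).integrable_sq.const_mul μ

theorem MemS.integrable_quad (hu : MemS μ p u) :
    Integrable fun x => ‖weakGrad u x‖ ^ 2 + μ * u x ^ 2 :=
  hu.1.integrable_grad_sq.add hu.integrable_mul_sq

theorem MemS.quad_eq (hu : MemS μ p u) : quad μ u = dir u + ∫ x, μ * u x ^ 2 :=
  integral_add hu.1.integrable_grad_sq hu.integrable_mul_sq

theorem quad_nonneg (hμ : 0 ≤ μ) (u : Euc N → ℝ) : 0 ≤ quad μ u :=
  integral_nonneg fun x => by positivity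

theorem MemS.dir_le_quad (hμ : 0 ≤ μ) (hu : MemS μ p u) : dir u ≤ quad μ u := by
  rw [hu.quad_eq]
  have : 0 ≤ ∫ x, μ * u x ^ 2 := integral_nonneg fun x => by positivity
  linarith

theorem quad_zero (u : Euc N → ℝ) : quad 0 u = dir u := by
  simp [quad, dir]

variable {Ω : Set (Euc N)}

theorem measurable_Q (hΩ : MeasurableSet Ω) : Measurable (Q Ω) := by
  unfold Q
  exact Measurable.ite hΩ measurable_const measurable_const

theorem abs_Q (Ω : Set (Euc N)) (x : Euc N) : |Q Ω x| = 1 := by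
  unfold Q
  split_ifs <;> simp

theorem MemE.integrable_pot (hp : 0 < p) (hΩ : MeasurableSet Ω) (hu : MemE p u) :
    Integrable fun x => Q Ω x * |u x| ^ p :=
  (hu.integrable_rpow hp).bdd_mul (measurable_Q hΩ).aestronglyMeasurable
    (ae_of_all _ fun x => (abs_Q Ω x).le)

/-- Since Q is twice the indicator of Ω minus 1, the potential splits into a term on a bounded set,
continuous under local L^p convergence, and a negative term that is upper semicontinuous. -/
theorem MemE.pot_eq (hp : 0 < p) (hΩ : MeasurableSet Ω) (hu : MemE p u) :
    pot (Q Ω) p u = 2 * (∫ x in Ω, |u x| ^ p) - ∫ x, |u x| ^ p := by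
  have hi := hu.integrable_rpow hp
  rw [← integral_indicator hΩ, ← integral_const_mul,
    ← integral_sub ((hi.indicator hΩ).const_mul 2) hi]
  refine integral_congr_ae (ae_of_all _ fun x => ?_)
  unfold Q
  by_cases hx : x ∈ Ω
  · simp only [hx, if_true, Set.indicator_of_mem]; ring
  · simp only [hx, if_false, not_false_eq_true, Set.indicator_of_notMem]; ring

theorem MemE.pot_le (hp : 0 < p) (hΩ : MeasurableSet Ω) (hu : MemE p u) :
    pot (Q Ω) p u ≤ ∫ x in Ω, |u x| ^ p := by
  have := setIntegral_le_integral (s := Ω) (hu.integrable_rpow hp)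
    (ae_of_all _ fun x => by positivity)
  rw [hu.pot_eq hp hΩ]
  linarith

theorem MemE.pot_le_integral (hp : 0 < p) (hΩ : MeasurableSet Ω) (hu : MemE p u) :
    pot (Q Ω) p u ≤ ∫ x, |u x| ^ p :=
  (hu.pot_le hp hΩ).trans (setIntegral_le_integral (s := Ω) (hu.integrable_rpow hp)
    (ae_of_all _ fun x => by positivity))

theorem MemE.weakGrad_ae_zero (hN : 1 ≤ N) (hu : MemE p u) :
    ∀ᵐ x, u x = 0 → weakGrad u x = 0 :=
  hu.hasWeakGradient.ae_eq_zero hN hu.memLp_weakGrad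

/-- A weak gradient vanishes almost everywhere on the zero set of its function. Functions with
product zero therefore have no cross terms. -/
theorem MemS.quad_add (hN : 1 ≤ N) (hu : MemS μ p u) (hv : MemS μ p v)
    (h : ∀ᵐ x, u x * v x = 0) : quad μ (u + v) = quad μ u + quad μ v := by
  unfold quad
  rw [← integral_add hu.integrable_quad hv.integrable_quad]
  refine integral_congr_ae ?_
  filter_upwards [weakGrad_add hu.1 hv.1, hu.1.weakGrad_ae_zero hN, hv.1.weakGrad_ae_zero hN, h]
    with x hx h1 h2 h3
  rw [hx]
  simp only [Pi.add_apply]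
  rcases mul_eq_zero.1 h3 with h0 | h0
  · simp [h0, h1 h0]
  · simp [h0, h2 h0]

theorem MemE.pot_add (hp : 0 < p) (hΩ : MeasurableSet Ω) (hu : MemE p u) (hv : MemE p v)
    (h : ∀ᵐ x, u x * v x = 0) : pot (Q Ω) p (u + v) = pot (Q Ω) p u + pot (Q Ω) p v := by
  unfold pot
  rw [← integral_add (hu.integrable_pot hp hΩ) (hv.integrable_pot hp hΩ)]
  refine integral_congr_ae ?_
  filter_upwards [h] with x h3
  simp only [Pi.add_apply]
  rcases mul_eq_zero.1 h3 with h0 | h0 <;> simp [h0, Real.zero_rpow hp.ne']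

theorem pos_mul_neg_zero (u : Euc N → ℝ) (x : Euc N) : max (u x) 0 * min (u x) 0 = 0 := by
  rcases le_total (u x) 0 with h | h <;> simp [h]

theorem MemS.quad_pos_add_neg (hN : 1 ≤ N) (hu : MemS μ p u) :
    quad μ u = quad μ (fun x => max (u x) 0) + quad μ (fun x => min (u x) 0) := by
  rw [← (hu.pos hN).quad_add hN (hu.neg hN) (ae_of_all _ (pos_mul_neg_zero u)),
    max_add_min_zero]

end Functionals

/-! ### Nehari sets and projection onto them -/

section Nehari

variable {N : ℕ} {μ p : ℝ} {u v : Euc N → ℝ} {Ω : Set (Euc N)}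

theorem mem_nehari_iff (hp : 2 < p) {X : (Euc N → ℝ) → Prop} {q : Euc N → ℝ} :
    u ∈ nehari X μ q p ↔ X u ∧ ¬ u =ᵐ[volume] 0 ∧ quad μ u = pot q p u := by
  unfold nehari
  rw [Set.mem_ofPred_eq, energyDeriv_self hp, sub_eq_zero]

theorem energy_of_nehari (hp : 2 < p) {X : (Euc N → ℝ) → Prop} {q : Euc N → ℝ}
    (h : u ∈ nehari X μ q p) : energy μ q p u = (1 / 2 - 1 / p) * quad μ u := by
  rw [energy_eq, ← ((mem_nehari_iff hp).1 h).2.2]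
  ring

theorem nehari_congr (hp : 2 < p) (h : u ∈ nehari (MemS μ p) μ (Q Ω) p) (huv : u =ᵐ[volume] v) :
    v ∈ nehari (MemS μ p) μ (Q Ω) p := by
  rw [mem_nehari_iff hp] at h ⊢
  refine ⟨h.1.congr huv, fun h0 => h.2.1 (huv.trans h0), ?_⟩
  rw [← quad_congr huv, ← pot_congr _ huv, h.2.2]

/-- The standing assumptions on the dimension, the exponent and the set `Ω`. -/
structure Setup (N : ℕ) (p : ℝ) (Ω : Set (Euc N)) : Prop where
  dim : 1 ≤ N
  two_lt : 2 < p
  subcrit : singExp N p < 1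
  meas : MeasurableSet Ω
  bdd : Bornology.IsBounded Ω

theorem Setup.p_pos (S : Setup N p Ω) : 0 < p := by linarith [S.two_lt]

/-- A nonnegative potential means exactly that Ω carries at least half of the L^p mass. The
resulting bound plays the part of a Sobolev inequality on Nehari sets, in all dimensions and for all
masses at once. -/
theorem Setup.exists_const (S : Setup N p Ω) : ∃ C : ℝ, 0 < C ∧ ∀ u : Euc N → ℝ, MemE p u →
    0 ≤ pot (Q Ω) p u → ∫ x, |u x| ^ p ≤ C * dir u ^ (p / 2) := by
  obtain ⟨C, hC, h⟩ := exists_const_integral_rpow_le S.dim S.two_lt S.subcrit (Ω := Ω)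
    S.bdd.measure_lt_top.ne
  refine ⟨C, hC, fun u hu h0 => h u hu ?_⟩
  rw [hu.pot_eq S.p_pos S.meas] at h0
  linarith

theorem MemE.ae_eq_zero_of_integral (hp : 0 < p) (hu : MemE p u) (h : ∫ x, |u x| ^ p ≤ 0) :
    u =ᵐ[volume] 0 := by
  have h0 : ∫ x, |u x| ^ p = 0 := le_antisymm h (integral_nonneg fun x => by positivity)
  rw [integral_eq_zero_iff_of_nonneg (fun x => by positivity) (hu.integrable_rpow hp)] at h0
  filter_upwards [h0] with x hx
  have : |u x| ^ p = 0 := hx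
  rw [Real.rpow_eq_zero (abs_nonneg _) hp.ne'] at this
  simpa using this

theorem Setup.dir_pos (S : Setup N p Ω) (hu : MemE p u) (h0 : ¬ u =ᵐ[volume] 0)
    (hpot : 0 ≤ pot (Q Ω) p u) : 0 < dir u := by
  obtain ⟨C, hC, h⟩ := S.exists_const
  refine lt_of_le_of_ne (dir_nonneg u) fun hd => h0 (hu.ae_eq_zero_of_integral S.p_pos ?_)
  have := h u hu hpot
  rw [← hd, Real.zero_rpow (by linarith [S.p_pos]), mul_zero] at this
  exact this

theorem Setup.ne_zero_of_pot_pos (S : Setup N p Ω) (hpot : 0 < pot (Q Ω) p u) :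
    ¬ u =ᵐ[volume] 0 := by
  intro h
  rw [pot_congr _ h] at hpot
  simp [pot, Real.zero_rpow S.p_pos.ne'] at hpot

theorem Setup.quad_pos (S : Setup N p Ω) (hμ : 0 ≤ μ) (hu : MemS μ p u)
    (hpot : 0 < pot (Q Ω) p u) : 0 < quad μ u :=
  (S.dir_pos hu.1 (S.ne_zero_of_pot_pos hpot) hpot.le).trans_le (hu.dir_le_quad hμ)

/-- A uniform lower bound on the Nehari manifolds. -/
theorem Setup.exists_quad_lower_bound (S : Setup N p Ω) : ∃ c : ℝ, 0 < c ∧ ∀ μ : ℝ, 0 ≤ μ →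
    ∀ u ∈ nehari (MemS μ p) μ (Q Ω) p, c ≤ quad μ u := by
  obtain ⟨C, hC, h⟩ := S.exists_const
  have hp := S.two_lt
  refine ⟨(1 / C) ^ (2 / (p - 2)), by positivity, fun μ hμ u hu => ?_⟩
  obtain ⟨hS, h0, hq⟩ := (mem_nehari_iff hp).1 hu
  have hpot : 0 ≤ pot (Q Ω) p u := hq ▸ quad_nonneg hμ u
  have hA : 0 < quad μ u := (S.dir_pos hS.1 h0 hpot).trans_le (hS.dir_le_quad hμ)
  have h1 : quad μ u ≤ C * quad μ u ^ (p / 2) :=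
    calc quad μ u = pot (Q Ω) p u := hq
      _ ≤ ∫ x, |u x| ^ p := hS.1.pot_le_integral S.p_pos S.meas
      _ ≤ C * dir u ^ (p / 2) := h u hS.1 hpot
      _ ≤ _ := mul_le_mul_of_nonneg_left (Real.rpow_le_rpow (dir_nonneg u)
        (hS.dir_le_quad hμ) (by linarith)) hC.le
  -- One power of the positive number A = quad is cancelled in A ≤ C A^{p/2}; since p > 2 this
  -- bounds A away from 0.
  have h2 : 1 / C ≤ quad μ u ^ ((p - 2) / 2) := by
    have e : quad μ u ^ (p / 2) = quad μ u ^ ((p - 2) / 2) * quad μ u := by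
      nth_rw 3 [← Real.rpow_one (quad μ u)]
      rw [← Real.rpow_add hA]
      congr 1; ring
    rw [e] at h1
    rw [div_le_iff₀ hC]
    by_contra hlt
    push Not at hlt
    nlinarith
  calc (1 / C) ^ (2 / (p - 2)) ≤ (quad μ u ^ ((p - 2) / 2)) ^ (2 / (p - 2)) :=
        Real.rpow_le_rpow (by positivity) h2 (div_nonneg (by norm_num) (by linarith))
    _ = quad μ u := by
        have : p - 2 ≠ 0 := by linarith
        rw [← Real.rpow_mul hA.le]
        have e : (p - 2) / 2 * (2 / (p - 2)) = 1 := by field_simp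
        rw [e, Real.rpow_one]

/-- The factor projecting onto the Nehari manifold. -/
noncomputable def proj (μ p : ℝ) (Ω : Set (Euc N)) (u : Euc N → ℝ) : ℝ :=
  (quad μ u / pot (Q Ω) p u) ^ (1 / (p - 2))

theorem Setup.proj_pos (S : Setup N p Ω) (hμ : 0 ≤ μ) (hu : MemS μ p u)
    (hpot : 0 < pot (Q Ω) p u) : 0 < proj μ p Ω u := by
  have := S.quad_pos hμ hu hpot
  unfold proj
  positivity

theorem ne_zero_smul {c : ℝ} (hc : c ≠ 0) (h : ¬ u =ᵐ[volume] 0) : ¬ (c • u) =ᵐ[volume] 0 := by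
  intro h'
  refine h ?_
  filter_upwards [h'] with x hx
  simpa [hc] using hx

/-- For t > 0 the Nehari identity t²·quad = t^p·pot has a single root, because p > 2 and both
coefficients are positive. -/
theorem Setup.smul_mem_nehari_iff (S : Setup N p Ω) (hμ : 0 ≤ μ) (hu : MemS μ p u)
    (hpot : 0 < pot (Q Ω) p u) {t : ℝ} (ht : 0 < t) :
    t • u ∈ nehari (MemS μ p) μ (Q Ω) p ↔ t = proj μ p Ω u := by
  have hp := S.two_lt
  have hA := S.quad_pos hμ hu hpot
  rw [mem_nehari_iff hp, quad_smul hu.1, pot_smul, abs_of_pos ht]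
  have e : t ^ p = t ^ 2 * t ^ (p - 2) := by
    rw [← Real.rpow_natCast, ← Real.rpow_add ht]
    congr 1; push_cast; ring
  have hp2 : p - 2 ≠ 0 := by linarith
  have key : t ^ 2 * quad μ u = t ^ p * pot (Q Ω) p u ↔ t = proj μ p Ω u := by
    rw [e, mul_assoc, mul_right_inj' (by positivity), ← div_eq_iff hpot.ne', proj]
    constructor
    · intro h
      rw [h, ← Real.rpow_mul ht.le, mul_one_div_cancel hp2, Real.rpow_one]
    · intro h
      rw [h, ← Real.rpow_mul (by positivity), one_div_mul_cancel hp2, Real.rpow_one]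
  rw [← key]
  exact ⟨fun h => h.2.2, fun h => ⟨hu.const_smul t,
    ne_zero_smul ht.ne' (S.ne_zero_of_pot_pos hpot), h⟩⟩

theorem Setup.proj_smul_mem (S : Setup N p Ω) (hμ : 0 ≤ μ) (hu : MemS μ p u)
    (hpot : 0 < pot (Q Ω) p u) : proj μ p Ω u • u ∈ nehari (MemS μ p) μ (Q Ω) p :=
  (S.smul_mem_nehari_iff hμ hu hpot (S.proj_pos hμ hu hpot)).2 rfl

/-- Limits of Nehari functions satisfy quad ≤ pot. Projecting them back shrinks them and so cannot
raise the quadratic part. -/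
theorem Setup.proj_le_one (S : Setup N p Ω) (hμ : 0 ≤ μ) (hpot : 0 < pot (Q Ω) p u)
    (h : quad μ u ≤ pot (Q Ω) p u) : proj μ p Ω u ≤ 1 := by
  have hp := S.two_lt
  unfold proj
  refine Real.rpow_le_one (div_nonneg (quad_nonneg hμ u) hpot.le) ?_
    (one_div_nonneg.2 (by linarith))
  rwa [div_le_one hpot]

theorem add_pos_part {U V : Euc N → ℝ} (hU : ∀ᵐ x, 0 ≤ U x) (hV : ∀ᵐ x, V x ≤ 0)
    (hUV : ∀ᵐ x, U x * V x = 0) : U =ᵐ[volume] (fun x => max ((U + V) x) 0) ∧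
      V =ᵐ[volume] (fun x => min ((U + V) x) 0) := by
  constructor <;>
  · filter_upwards [hU, hV, hUV] with x h1 h2 h3
    simp only [Pi.add_apply]
    rcases mul_eq_zero.1 h3 with h | h <;> simp [h, h1, h2]

/-- Two Nehari functions of opposite sign and disjoint support form a nodal Nehari function. -/
theorem Setup.add_mem_nodalNehari (S : Setup N p Ω) {U V : Euc N → ℝ}
    (hUm : U ∈ nehari (MemS μ p) μ (Q Ω) p) (hVm : V ∈ nehari (MemS μ p) μ (Q Ω) p)
    (hU : ∀ᵐ x, 0 ≤ U x) (hV : ∀ᵐ x, V x ≤ 0) (hUV : ∀ᵐ x, U x * V x = 0) :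
    U + V ∈ nodalNehari (MemS μ p) μ (Q Ω) p ∧
      energy μ (Q Ω) p (U + V) = (1 / 2 - 1 / p) * (quad μ U + quad μ V) := by
  have hp := S.two_lt
  obtain ⟨e1, e2⟩ := add_pos_part hU hV hUV
  obtain ⟨a1, a2, a3⟩ := (mem_nehari_iff hp).1 hUm
  obtain ⟨b1, b2, b3⟩ := (mem_nehari_iff hp).1 hVm
  have hn : U + V ∈ nehari (MemS μ p) μ (Q Ω) p := by
    rw [mem_nehari_iff hp]
    refine ⟨a1.add b1, fun h => a2 ?_, ?_⟩
    · filter_upwards [e1, h] with x h1 h2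
      rw [h1, h2]; simp
    · rw [a1.quad_add S.dim b1 hUV, a1.1.pot_add S.p_pos S.meas b1.1 hUV, a3, b3]
  refine ⟨⟨hn, nehari_congr hp hUm e1, nehari_congr hp hVm e2⟩, ?_⟩
  rw [energy_of_nehari hp hn, a1.quad_add S.dim b1 hUV]

theorem Setup.energy_nodal (S : Setup N p Ω) (h : u ∈ nodalNehari (MemS μ p) μ (Q Ω) p) :
    energy μ (Q Ω) p u =
      (1 / 2 - 1 / p) * (quad μ (fun x => max (u x) 0) + quad μ (fun x => min (u x) 0)) := by
  rw [energy_of_nehari S.two_lt h.1,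
    (((mem_nehari_iff S.two_lt).1 h.1).1).quad_pos_add_neg S.dim]

theorem Setup.coef_pos (S : Setup N p Ω) : 0 < 1 / 2 - 1 / p := by
  have := S.two_lt
  rw [sub_pos]
  exact one_div_lt_one_div_of_lt (by norm_num) this

end Nehari

/-! ### Fatou's lemma and the defect of Dirichlet integrals -/

section Limits

/-- Fatou's lemma for Bochner integrals of nonnegative functions with convergent integrals. -/
theorem integrable_and_integral_le_of_tendsto {α : Type*} [MeasurableSpace α] {ν : Measure α}
    {f : ℕ → α → ℝ} {f₀ : α → ℝ} (hf : ∀ n, Integrable (f n) ν) (h0 : ∀ n x, 0 ≤ f n x)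
    (hae : ∀ᵐ x ∂ν, Tendsto (fun n => f n x) atTop (𝓝 (f₀ x))) {b : ℝ}
    (hb : Tendsto (fun n => ∫ x, f n x ∂ν) atTop (𝓝 b)) :
    Integrable f₀ ν ∧ ∫ x, f₀ x ∂ν ≤ b := by
  have hm : AEStronglyMeasurable f₀ ν :=
    aestronglyMeasurable_of_tendsto_ae atTop (fun n => (hf n).aestronglyMeasurable) hae
  have hnn : ∀ᵐ x ∂ν, 0 ≤ f₀ x := by
    filter_upwards [hae] with x hx
    exact ge_of_tendsto' hx fun n => h0 n x
  have key : ∫⁻ x, ENNReal.ofReal (f₀ x) ∂ν ≤ ENNReal.ofReal b := by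
    calc ∫⁻ x, ENNReal.ofReal (f₀ x) ∂ν
        = ∫⁻ x, liminf (fun n => ENNReal.ofReal (f n x)) atTop ∂ν := by
          refine lintegral_congr_ae ?_
          filter_upwards [hae] with x hx
          exact (ENNReal.tendsto_ofReal hx).liminf_eq.symm
      _ ≤ liminf (fun n => ∫⁻ x, ENNReal.ofReal (f n x) ∂ν) atTop :=
          lintegral_liminf_le' fun n => (hf n).aestronglyMeasurable.aemeasurable.ennreal_ofReal
      _ = ENNReal.ofReal b := by
          refine Tendsto.liminf_eq ?_
          refine (ENNReal.tendsto_ofReal hb).congr fun n => ?_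
          exact ofReal_integral_eq_lintegral_ofReal (hf n) (ae_of_all _ (h0 n))
  have hb0 : 0 ≤ b := ge_of_tendsto' hb fun n => integral_nonneg (h0 n)
  refine ⟨⟨hm, ?_⟩, ?_⟩
  · rw [hasFiniteIntegral_iff_ofReal hnn]
    exact key.trans_lt ENNReal.ofReal_lt_top
  · rw [integral_eq_lintegral_of_nonneg_ae hnn hm]
    exact ENNReal.toReal_le_of_le_ofReal hb0 key

variable {N : ℕ} {p : ℝ}

theorem integrable_inner_of_memLp {f g : Euc N → Euc N} (hf : MemLp f 2 volume)
    (hg : MemLp g 2 volume) : Integrable fun x => inner ℝ (f x) (g x) := by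
  have h1 : Integrable (fun x => ‖f x‖ * ‖g x‖) := hf.norm.integrable_mul hg.norm
  refine h1.mono (hf.aestronglyMeasurable.inner hg.aestronglyMeasurable) (ae_of_all _ fun x => ?_)
  simp only [norm_mul, norm_norm]
  exact norm_inner_le_norm _ _

theorem dir_sub_eq {u v : Euc N → ℝ} (hu : MemE p u) (hv : MemE p v) :
    dir (u - v) = dir u - 2 * (∫ x, inner ℝ (weakGrad v x) (weakGrad u x)) + dir v := by
  have hi := integrable_inner_of_memLp hv.memLp_weakGrad hu.memLp_weakGrad
  have hi2 : Integrable fun x =>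
      ‖weakGrad u x‖ ^ 2 - 2 * inner ℝ (weakGrad v x) (weakGrad u x) :=
    hu.integrable_grad_sq.sub (hi.const_mul 2)
  unfold dir
  rw [← integral_const_mul, ← integral_sub hu.integrable_grad_sq (hi.const_mul 2),
    ← integral_add hi2 hv.integrable_grad_sq]
  refine integral_congr_ae ?_
  filter_upwards [weakGrad_sub hu hv] with x hx
  rw [hx]
  simp only [Pi.sub_apply]
  rw [norm_sub_sq_real, real_inner_comm]

/-- Expanding the square, the mixed term converges by weak convergence tested with the gradient of
u₀. The defect d - dir u₀ is nonnegative, and vanishes precisely when the gradients converge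
strongly. -/
theorem tendsto_dir_sub {u : ℕ → Euc N → ℝ} {u₀ : Euc N → ℝ} (hu : ∀ n, MemE p (u n))
    (hu₀ : MemE p u₀) {d : ℝ} (hd : Tendsto (fun n => dir (u n)) atTop (𝓝 d))
    (hw : ∀ φ : Euc N → Euc N, MemLp φ 2 volume →
        Tendsto (fun n => ∫ x, inner ℝ (φ x) (weakGrad (u n) x)) atTop
          (𝓝 (∫ x, inner ℝ (φ x) (weakGrad u₀ x)))) :
    Tendsto (fun n => dir (u n - u₀)) atTop (𝓝 (d - dir u₀)) := by
  simp only [fun n => dir_sub_eq (hu n) hu₀]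
  have h1 := ((hd.sub ((hw _ hu₀.memLp_weakGrad).const_mul 2)).add_const (dir u₀))
  have e : d - 2 * (∫ x, inner ℝ (weakGrad u₀ x) (weakGrad u₀ x)) + dir u₀ = d - dir u₀ := by
    have : ∫ x, inner ℝ (weakGrad u₀ x) (weakGrad u₀ x) = dir u₀ :=
      integral_congr_ae (ae_of_all _ fun x => real_inner_self_eq_norm_sq _)
    rw [this]; ring
  rwa [e] at h1

end Limits

/-! ### Compactness for Nehari and nodal Nehari sequences -/

section NehariCompactness

variable {N : ℕ} {p : ℝ} {Ω : Set (Euc N)}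

/-- Compactness for sequences on Nehari manifolds with bounded energy. -/
theorem Setup.exists_subseq_nehari (S : Setup N p Ω) {μ : ℕ → ℝ} {μ₀ : ℝ} (hμ : ∀ n, 0 ≤ μ n)
    (hlim : Tendsto μ atTop (𝓝 μ₀)) {u : ℕ → Euc N → ℝ}
    (hu : ∀ n, u n ∈ nehari (MemS (μ n) p) (μ n) (Q Ω) p) {M : ℝ} (hM : ∀ n, quad (μ n) (u n) ≤ M) :
    ∃ (k : ℕ → ℕ) (u₀ : Euc N → ℝ) (a : ℝ), StrictMono k ∧ MemS μ₀ p u₀ ∧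
      (∀ᵐ x, Tendsto (fun n => u (k n) x) atTop (𝓝 (u₀ x))) ∧
      Tendsto (fun n => quad (μ (k n)) (u (k n))) atTop (𝓝 a) ∧ 0 < a ∧
      quad μ₀ u₀ ≤ a ∧ a ≤ pot (Q Ω) p u₀ ∧
      (quad μ₀ u₀ = a → pot (Q Ω) p u₀ = a →
        Tendsto (fun n => dir (u (k n) - u₀)) atTop (𝓝 0) ∧
        Tendsto (fun n => ∫ x, |u (k n) x| ^ p) atTop (𝓝 (∫ x, |u₀ x| ^ p))) := by
  have hp := S.two_lt
  have hp0 := S.p_pos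
  have hmem := fun n => (mem_nehari_iff hp).1 (hu n)
  have hS := fun n => (hmem n).1
  obtain ⟨C, hC, hCb⟩ := S.exists_const
  obtain ⟨c, hc, hcb⟩ := S.exists_quad_lower_bound
  have hM0 : 0 ≤ M := (quad_nonneg (hμ 0) _).trans (hM 0)
  have hdM : ∀ n, dir (u n) ≤ M := fun n => ((hS n).dir_le_quad (hμ n)).trans (hM n)
  have hPM : ∀ n, ∫ x, |u n x| ^ p ≤ C * M ^ (p / 2) := fun n =>
    (hCb _ (hS n).1 ((hmem n).2.2 ▸ quad_nonneg (hμ n) _)).trans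
      (mul_le_mul_of_nonneg_left (Real.rpow_le_rpow (dir_nonneg _) (hdM n) (by linarith)) hC.le)
  have hBM : ∀ n, ∫ x, μ n * u n x ^ 2 ≤ M := fun n => by
    have := (hS n).quad_eq
    linarith [dir_nonneg (u n), hM n]
  set M' := max M (C * M ^ (p / 2)) with hM'
  obtain ⟨k₁, u₀, hk₁, hE₀, hae, hloc, hweak⟩ := MemE.exists_subseq S.dim hp S.subcrit
    (fun n => (hS n).1) (M := M') (fun n => (hdM n).trans (le_max_left _ _))
    (fun n => (hPM n).trans (le_max_right _ _))
  -- A further subsequence makes the Dirichlet integral, the mass term and the L^p integral converge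
  -- separately, to d, b and τ.
  have hcomp : IsCompact (Set.Icc (0 : ℝ) M' ×ˢ (Set.Icc (0 : ℝ) M' ×ˢ Set.Icc (0 : ℝ) M')) :=
    isCompact_Icc.prod (isCompact_Icc.prod isCompact_Icc)
  obtain ⟨⟨d, b, τ⟩, -, k₂, hk₂, hlim3⟩ := hcomp.tendsto_subseq
    (x := fun n => (dir (u (k₁ n)), ∫ x, μ (k₁ n) * u (k₁ n) x ^ 2, ∫ x, |u (k₁ n) x| ^ p))
    (fun n => ⟨⟨dir_nonneg _, (hdM _).trans (le_max_left _ _)⟩,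
      ⟨integral_nonneg fun x => mul_nonneg (hμ _) (sq_nonneg _), (hBM _).trans (le_max_left _ _)⟩,
      ⟨integral_nonneg fun x => by positivity, (hPM _).trans (le_max_right _ _)⟩⟩)
  have hd : Tendsto (fun n => dir (u (k₁ (k₂ n)))) atTop (𝓝 d) :=
    (continuous_fst.tendsto _).comp hlim3
  have hb : Tendsto (fun n => ∫ x, μ (k₁ (k₂ n)) * u (k₁ (k₂ n)) x ^ 2) atTop (𝓝 b) :=
    ((continuous_fst.comp continuous_snd).tendsto _).comp hlim3
  have hτ : Tendsto (fun n => ∫ x, |u (k₁ (k₂ n)) x| ^ p) atTop (𝓝 τ) :=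
    ((continuous_snd.comp continuous_snd).tendsto _).comp hlim3
  set k := k₁ ∘ k₂ with hk
  have hkm : StrictMono k := hk₁.comp hk₂
  have hae' : ∀ᵐ x, Tendsto (fun n => u (k n) x) atTop (𝓝 (u₀ x)) := by
    filter_upwards [hae] with x hx
    exact hx.comp hk₂.tendsto_atTop
  have hdsub : Tendsto (fun n => dir (u (k n) - u₀)) atTop (𝓝 (d - dir u₀)) :=
    tendsto_dir_sub (fun n => (hS (k n)).1) hE₀ hd
      (fun φ hφ => (hweak φ hφ).comp hk₂.tendsto_atTop)
  have hdle : dir u₀ ≤ d := by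
    have := ge_of_tendsto' hdsub fun n => dir_nonneg _
    linarith
  obtain ⟨hB1, hB2⟩ := integrable_and_integral_le_of_tendsto (f₀ := fun x => μ₀ * u₀ x ^ 2)
    (fun n => (hS (k n)).integrable_mul_sq)
    (fun n x => mul_nonneg (hμ _) (sq_nonneg _)) (by
      filter_upwards [hae'] with x hx
      exact (hlim.comp hkm.tendsto_atTop).mul (hx.pow 2)) hb
  have hτle : ∫ x, |u₀ x| ^ p ≤ τ :=
    (integrable_and_integral_le_of_tendsto (f₀ := fun x => |u₀ x| ^ p)
      (fun n => (hS (k n)).1.integrable_rpow hp0) (fun n x => by positivity) (by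
      filter_upwards [hae'] with x hx
      exact (Real.continuousAt_rpow_const _ _ (Or.inr hp0.le)).tendsto.comp hx.abs) hτ).2
  have hSm : MemS μ₀ p u₀ := by
    refine ⟨hE₀, fun hne => ?_⟩
    rw [memLp_two_iff_integrable_sq hE₀.1.aestronglyMeasurable]
    have := hB1.const_mul μ₀⁻¹
    simpa [hne] using this
  have hq : Tendsto (fun n => quad (μ (k n)) (u (k n))) atTop (𝓝 (d + b)) := by
    simp only [fun n => (hS (k n)).quad_eq]
    exact hd.add hb
  have hpl : Tendsto (fun n => pot (Q Ω) p (u (k n))) atTop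
      (𝓝 (2 * (∫ x in Ω, |u₀ x| ^ p) - τ)) := by
    simp only [fun n => (hS (k n)).1.pot_eq hp0 S.meas]
    exact (((hloc Ω S.bdd).comp hk₂.tendsto_atTop).const_mul 2).sub hτ
  -- The limit of the Nehari identity. Only the Ω term is evaluated at u₀; with dir u₀ ≤ d, the mass
  -- term at most b and ∫|u₀|^p ≤ τ, this gives quad u₀ ≤ d + b ≤ pot u₀.
  have heq : d + b = 2 * (∫ x in Ω, |u₀ x| ^ p) - τ :=
    tendsto_nhds_unique hq (hpl.congr fun n => ((hmem (k n)).2.2).symm)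
  refine ⟨k, u₀, d + b, hkm, hSm, hae', hq, ?_, ?_, ?_, ?_⟩
  · exact hc.trans_le (ge_of_tendsto' hq fun n => hcb _ (hμ _) _ (hu _))
  · rw [hSm.quad_eq]; exact add_le_add hdle hB2
  · rw [hE₀.pot_eq hp0 S.meas, heq]; linarith
  -- Equality throughout leaves no room for a defect: dir u₀ = d and ∫|u₀|^p = τ.
  · intro h1 h2
    rw [hSm.quad_eq] at h1
    rw [hE₀.pot_eq hp0 S.meas, heq] at h2
    have e1 : dir u₀ = d := by linarith
    have e2 : ∫ x, |u₀ x| ^ p = τ := by linarith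
    rw [e1, sub_self] at hdsub
    exact ⟨hdsub, e2 ▸ hτ⟩

/-- Compactness for sequences on nodal Nehari sets with bounded energy. -/
theorem Setup.exists_subseq_nodal (S : Setup N p Ω) {μ : ℕ → ℝ} {μ₀ : ℝ} (hμ : ∀ n, 0 ≤ μ n)
    (hlim : Tendsto μ atTop (𝓝 μ₀)) {u : ℕ → Euc N → ℝ}
    (hu : ∀ n, u n ∈ nodalNehari (MemS (μ n) p) (μ n) (Q Ω) p) {M : ℝ}
    (hM : ∀ n, energy (μ n) (Q Ω) p (u n) ≤ M) :
    ∃ (k : ℕ → ℕ) (w : Euc N → ℝ) (e : ℝ), StrictMono k ∧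
      w ∈ nodalNehari (MemS μ₀ p) μ₀ (Q Ω) p ∧
      Tendsto (fun n => energy (μ (k n)) (Q Ω) p (u (k n))) atTop (𝓝 e) ∧
      energy μ₀ (Q Ω) p w ≤ e ∧
      (e ≤ energy μ₀ (Q Ω) p w → (∀ᵐ x, Tendsto (fun n => u (k n) x) atTop (𝓝 (w x))) ∧
        Tendsto (fun n => dir (u (k n) - w)) atTop (𝓝 0) ∧
        Tendsto (fun n => ∫ x, |u (k n) x| ^ p) atTop (𝓝 (∫ x, |w x| ^ p))) := by
  have hp := S.two_lt
  have hp0 := S.p_pos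
  have hco := S.coef_pos
  have hμ₀ : 0 ≤ μ₀ := ge_of_tendsto' hlim hμ
  have hq : ∀ n, quad (μ n) (fun x => max (u n x) 0) + quad (μ n) (fun x => min (u n x) 0) ≤
      M / (1 / 2 - 1 / p) := fun n => by
    rw [le_div_iff₀ hco, mul_comm, ← S.energy_nodal (hu n)]
    exact hM n
  have hS := fun n => ((mem_nehari_iff hp).1 (hu n).1).1
  obtain ⟨k₁, U, a, hk₁, hUS, hUae, hUq, ha0, hUa, haU, hUst⟩ := S.exists_subseq_nehari hμ hlim
    (u := fun n x => max (u n x) 0) (fun n => (hu n).2.1) (M := M / (1 / 2 - 1 / p))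
    (fun n => by linarith [hq n, quad_nonneg (hμ n) (fun x => min (u n x) 0)])
  obtain ⟨k₂, V, b, hk₂, hVS, hVae, hVq, hb0, hVb, hbV, hVst⟩ := S.exists_subseq_nehari
    (fun n => hμ (k₁ n)) (hlim.comp hk₁.tendsto_atTop)
    (u := fun n x => min (u (k₁ n) x) 0) (fun n => (hu (k₁ n)).2.2) (M := M / (1 / 2 - 1 / p))
    (fun n => by linarith [hq (k₁ n), quad_nonneg (hμ (k₁ n)) (fun x => max (u (k₁ n) x) 0)])
  have hUae' : ∀ᵐ x, Tendsto (fun n => max (u (k₁ (k₂ n)) x) 0) atTop (𝓝 (U x)) := by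
    filter_upwards [hUae] with x hx
    exact hx.comp hk₂.tendsto_atTop
  have hU0 : ∀ᵐ x, 0 ≤ U x := by
    filter_upwards [hUae] with x hx
    exact ge_of_tendsto' hx fun n => le_max_right _ _
  have hV0 : ∀ᵐ x, V x ≤ 0 := by
    filter_upwards [hVae] with x hx
    exact le_of_tendsto' hx fun n => min_le_right _ _
  -- Positive and negative parts have product zero along the sequence, hence also in the almost
  -- everywhere limit.
  have hUV : ∀ᵐ x, U x * V x = 0 := by
    filter_upwards [hUae', hVae] with x h1 h2
    refine tendsto_nhds_unique (h1.mul h2) ?_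
    simp
  have hUp : 0 < pot (Q Ω) p U := ha0.trans_le haU
  have hVp : 0 < pot (Q Ω) p V := hb0.trans_le hbV
  -- The limits may miss the Nehari set. The factors s, t ≤ 1 correct this and can only lower the
  -- energy.
  set s := proj μ₀ p Ω U with hs
  set t := proj μ₀ p Ω V with ht
  have hs0 : 0 < s := S.proj_pos hμ₀ hUS hUp
  have ht0 : 0 < t := S.proj_pos hμ₀ hVS hVp
  have hs1 : s ≤ 1 := S.proj_le_one hμ₀ hUp (hUa.trans haU)
  have ht1 : t ≤ 1 := S.proj_le_one hμ₀ hVp (hVb.trans hbV)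
  obtain ⟨hw, hwe⟩ := S.add_mem_nodalNehari (S.proj_smul_mem hμ₀ hUS hUp)
    (S.proj_smul_mem hμ₀ hVS hVp)
    (by filter_upwards [hU0] with x hx; exact mul_nonneg hs0.le hx)
    (by filter_upwards [hV0] with x hx; exact mul_nonpos_of_nonneg_of_nonpos ht0.le hx)
    (by
      filter_upwards [hUV] with x hx
      simp only [Pi.smul_apply, smul_eq_mul]
      rw [mul_mul_mul_comm, hx, mul_zero])
  rw [quad_smul hUS.1, quad_smul hVS.1, ← hs, ← ht] at hwe
  rw [← hs, ← ht] at hw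
  have hUq0 := S.quad_pos hμ₀ hUS hUp
  have hVq0 := S.quad_pos hμ₀ hVS hVp
  have hs2 : s ^ 2 * quad μ₀ U ≤ quad μ₀ U :=
    mul_le_of_le_one_left hUq0.le (pow_le_one₀ hs0.le hs1)
  have ht2 : t ^ 2 * quad μ₀ V ≤ quad μ₀ V :=
    mul_le_of_le_one_left hVq0.le (pow_le_one₀ ht0.le ht1)
  refine ⟨k₁ ∘ k₂, s • U + t • V, (1 / 2 - 1 / p) * (a + b), hk₁.comp hk₂, hw, ?_, ?_, ?_⟩
  · have h1 := ((hUq.comp hk₂.tendsto_atTop).add hVq).const_mul (1 / 2 - 1 / p)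
    refine h1.congr fun n => ?_
    exact (S.energy_nodal (hu (k₁ (k₂ n)))).symm
  · rw [hwe]
    exact mul_le_mul_of_nonneg_left (by linarith) hco.le
  -- If the energy is not lowered, the chain s² quad U ≤ quad U ≤ a and its analogue for V consist
  -- of equalities. Then s = t = 1, both limits lie on the Nehari set, and each part converges
  -- strongly.
  · intro hle
    rw [hwe] at hle
    have hle' := le_of_mul_le_mul_left hle hco
    have e1 : quad μ₀ U = a := by linarith
    have e2 : quad μ₀ V = b := by linarith
    have e3 : s ^ 2 * quad μ₀ U = quad μ₀ U := by linarith
    have e4 : t ^ 2 * quad μ₀ V = quad μ₀ V := by linarith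
    have hs' : s = 1 := by
      have : s ^ 2 = 1 := by
        have := mul_right_cancel₀ hUq0.ne' (e3.trans (one_mul _).symm)
        exact this
      exact (pow_eq_one_iff_of_nonneg hs0.le two_ne_zero).1 this
    have ht' : t = 1 := by
      have : t ^ 2 = 1 := mul_right_cancel₀ hVq0.ne' (e4.trans (one_mul _).symm)
      exact (pow_eq_one_iff_of_nonneg ht0.le two_ne_zero).1 this
    have hUn := S.proj_smul_mem hμ₀ hUS hUp
    have hVn := S.proj_smul_mem hμ₀ hVS hVp
    rw [← hs, hs', one_smul] at hUn
    rw [← ht, ht', one_smul] at hVn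
    have f1 := ((mem_nehari_iff hp).1 hUn).2.2
    have f2 := ((mem_nehari_iff hp).1 hVn).2.2
    obtain ⟨hU1, hU2⟩ := hUst e1 (by linarith)
    obtain ⟨hV1, hV2⟩ := hVst e2 (by linarith)
    rw [hs', ht', one_smul, one_smul]
    refine ⟨?_, ?_, ?_⟩
    · filter_upwards [hUae', hVae] with x h1 h2
      refine (h1.add h2).congr fun n => ?_
      simp [max_add_min]
    · have hb : ∀ n, dir (u (k₁ (k₂ n)) - (U + V)) ≤
          2 * dir ((fun x => max (u (k₁ (k₂ n)) x) 0) - U) +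
          2 * dir ((fun x => min (u (k₁ (k₂ n)) x) 0) - V) := by
        intro n
        set j := k₁ (k₂ n)
        have m1 : MemE p ((fun x => max (u j x) 0) - U) := by
          have := ((hS j).1.pos S.dim).add (hUS.1.const_smul (-1))
          simpa [sub_eq_add_neg] using this
        have m2 : MemE p ((fun x => min (u j x) 0) - V) := by
          have := ((hS j).neg S.dim).1.add (hVS.1.const_smul (-1))
          simpa [sub_eq_add_neg] using this
        have e : u j - (U + V) =
            ((fun x => max (u j x) 0) - U) + ((fun x => min (u j x) 0) - V) := by
          rw [← add_sub_add_comm, max_add_min_zero]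
        unfold dir
        rw [e, ← integral_const_mul, ← integral_const_mul,
          ← integral_add (m1.integrable_grad_sq.const_mul 2) (m2.integrable_grad_sq.const_mul 2)]
        refine integral_mono_ae (m1.add m2).integrable_grad_sq
          ((m1.integrable_grad_sq.const_mul 2).add (m2.integrable_grad_sq.const_mul 2)) ?_
        filter_upwards [weakGrad_add m1 m2] with x hx
        rw [hx]
        simp only [Pi.add_apply]
        have h1 := norm_add_le (weakGrad ((fun x => max (u j x) 0) - U) x)
          (weakGrad ((fun x => min (u j x) 0) - V) x)
        have h2 := norm_nonneg (weakGrad ((fun x => max (u j x) 0) - U) x +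
          weakGrad ((fun x => min (u j x) 0) - V) x)
        nlinarith [sq_nonneg (‖weakGrad ((fun x => max (u j x) 0) - U) x‖ -
          ‖weakGrad ((fun x => min (u j x) 0) - V) x‖)]
      have hz := ((hU1.comp hk₂.tendsto_atTop).const_mul 2).add (hV1.const_mul 2)
      simp only [mul_zero, add_zero] at hz
      exact squeeze_zero (fun n => dir_nonneg _) hb hz
    · have esum : ∀ {f g : Euc N → ℝ}, MemE p f → MemE p g → (∀ᵐ x, f x * g x = 0) →
          ∫ x, |(f + g) x| ^ p = (∫ x, |f x| ^ p) + ∫ x, |g x| ^ p := by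
        intro f g hf hg h
        rw [← integral_add (hf.integrable_rpow hp0) (hg.integrable_rpow hp0)]
        refine integral_congr_ae ?_
        filter_upwards [h] with x hx
        rcases mul_eq_zero.1 hx with h0 | h0 <;> simp [h0, Real.zero_rpow hp0.ne']
      rw [esum hUS.1 hVS.1 hUV]
      refine ((hU2.comp hk₂.tendsto_atTop).add hV2).congr fun n => ?_
      have := esum ((hS (k₁ (k₂ n))).1.pos S.dim) ((hS (k₁ (k₂ n))).neg S.dim).1
        (ae_of_all _ (pos_mul_neg_zero _))
      rw [max_add_min_zero] at this
      exact this.symm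

end NehariCompactness

/-! ### Existence of minimizers -/

section Existence

variable {N : ℕ} {p μ : ℝ} {Ω : Set (Euc N)}

theorem memS_of_contDiff {f : Euc N → ℝ} (hf : ContDiff ℝ 1 f) (hc : HasCompactSupport f) :
    MemS μ p f :=
  ⟨memE_of_hasWeakGradient (hf.continuous.memLp_of_hasCompactSupport hc)
    (hasWeakGradient_of_contDiff hf)
    ((continuous_gradient hf).memLp_of_hasCompactSupport (hasCompactSupport_gradient hc)),
    fun _ => hf.continuous.memLp_of_hasCompactSupport hc⟩

theorem Setup.pot_bump_pos (S : Setup N p Ω) {c : Euc N} (f : ContDiffBump c)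
    (hf : Metric.ball c f.rOut ⊆ Ω) : 0 < pot (Q Ω) p f := by
  have hS : MemS 0 p (f : Euc N → ℝ) := memS_of_contDiff f.contDiff f.hasCompactSupport
  rw [hS.1.pot_eq S.p_pos S.meas]
  have e : ∫ x in Ω, |f x| ^ p = ∫ x, |f x| ^ p := by
    refine setIntegral_eq_integral_of_forall_compl_eq_zero fun x hx => ?_
    have : x ∉ Function.support f := by
      rw [f.support_eq]; exact fun h => hx (hf h)
    rw [Function.notMem_support.1 this, abs_zero, Real.zero_rpow S.p_pos.ne']
  rw [e]
  have h0 : 0 ≤ ∫ x, |f x| ^ p := integral_nonneg fun x => by positivity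
  have h1 : ∫ x, |f x| ^ p ≠ 0 := by
    intro h
    have h2 := hS.1.ae_eq_zero_of_integral S.p_pos h.le
    have h3 : (f : Euc N → ℝ) = 0 := (f.continuous.ae_eq_iff_eq volume continuous_const).1 h2
    have h4 : f c = 1 := f.one_of_mem_closedBall (Metric.mem_closedBall_self f.rIn_pos.le)
    rw [h3] at h4
    simp at h4
  have : 0 < ∫ x, |f x| ^ p := lt_of_le_of_ne h0 h1.symm
  linarith

/-- Ω need not be connected, but any ball of radius r inside it has room for two bumps of radius r/4
with centres r/2 apart. One is kept positive, the other negated, and each is projected onto the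
Nehari set. -/
theorem Setup.nodalNehari_nonempty (S : Setup N p Ω) (hμ : 0 ≤ μ) (hΩ : IsOpen Ω)
    (hne : Ω.Nonempty) : (nodalNehari (MemS μ p) μ (Q Ω) p).Nonempty := by
  obtain ⟨x, hx⟩ := hne
  obtain ⟨r, hr, hball⟩ := Metric.isOpen_iff.1 hΩ x hx
  have : Nonempty (Fin N) := ⟨⟨0, S.dim⟩⟩
  obtain ⟨e, he⟩ : ∃ e : Euc N, ‖e‖ = 1 := exists_norm_eq (Euc N) zero_le_one
  set y : Euc N := x + (r / 2) • e with hy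
  have hxy : dist x y = r / 2 := by
    rw [hy, dist_self_add_right, norm_smul, he, mul_one, Real.norm_of_nonneg (by linarith)]
  let f : ContDiffBump x := ⟨r / 8, r / 4, by linarith, by linarith⟩
  let g : ContDiffBump y := ⟨r / 8, r / 4, by linarith, by linarith⟩
  have hfS : MemS μ p (f : Euc N → ℝ) := memS_of_contDiff f.contDiff f.hasCompactSupport
  have hgS : MemS μ p ((-1 : ℝ) • (g : Euc N → ℝ)) :=
    (memS_of_contDiff g.contDiff g.hasCompactSupport).const_smul (-1)
  have hfp : 0 < pot (Q Ω) p f := S.pot_bump_pos f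
    ((Metric.ball_subset_ball (by change r / 4 ≤ r; linarith)).trans hball)
  have hgp : 0 < pot (Q Ω) p ((-1 : ℝ) • (g : Euc N → ℝ)) := by
    rw [pot_smul]
    simp only [abs_neg, abs_one, Real.one_rpow, one_mul]
    refine S.pot_bump_pos g (fun z hz => hball ?_)
    have h1 : dist z y < r / 4 := hz
    rw [Metric.mem_ball]
    have := dist_triangle z y x
    rw [dist_comm y x, hxy] at this
    linarith
  have hs := S.proj_pos hμ hfS hfp
  have ht := S.proj_pos hμ hgS hgp
  refine ⟨_, (S.add_mem_nodalNehari (S.proj_smul_mem hμ hfS hfp) (S.proj_smul_mem hμ hgS hgp)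
    (ae_of_all _ fun z => mul_nonneg hs.le f.nonneg)
    (ae_of_all _ fun z => mul_nonpos_of_nonneg_of_nonpos ht.le ?_)
    (ae_of_all _ fun z => ?_)).1⟩
  · have : 0 ≤ g z := g.nonneg
    simp only [Pi.smul_apply, smul_eq_mul]
    linarith
  · simp only [Pi.smul_apply, smul_eq_mul]
    have : f z * g z = 0 := by
      by_contra h
      have h1 : z ∈ Function.support f := left_ne_zero_of_mul h
      have h2 : z ∈ Function.support g := right_ne_zero_of_mul h
      rw [f.support_eq] at h1
      rw [g.support_eq] at h2
      have h1' : dist z x < r / 4 := h1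
      have h2' : dist z y < r / 4 := h2
      have := dist_triangle_left x y z
      linarith
    linear_combination (-(proj μ p Ω f * proj μ p Ω ((-1 : ℝ) • (g : Euc N → ℝ)))) * this

theorem Setup.energy_nonneg (S : Setup N p Ω) (hμ : 0 ≤ μ) {u : Euc N → ℝ}
    (h : u ∈ nodalNehari (MemS μ p) μ (Q Ω) p) : 0 ≤ energy μ (Q Ω) p u := by
  rw [energy_of_nehari S.two_lt h.1]
  exact mul_nonneg S.coef_pos.le (quad_nonneg hμ u)

/-- Existence of a minimizer on the nodal Nehari set. -/
theorem Setup.exists_isLeastEnergyNodal (S : Setup N p Ω) (hμ : 0 ≤ μ) (hΩ : IsOpen Ω)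
    (hne : Ω.Nonempty) : ∃ u, IsLeastEnergyNodal (MemS μ p) μ (Q Ω) p u := by
  set A := energy μ (Q Ω) p '' nodalNehari (MemS μ p) μ (Q Ω) p with hA
  have hAne : A.Nonempty := (S.nodalNehari_nonempty hμ hΩ hne).image _
  have hAbdd : BddBelow A := ⟨0, by
    rintro _ ⟨u, hu, rfl⟩
    exact S.energy_nonneg hμ hu⟩
  obtain ⟨e, -, he, heA⟩ := exists_seq_tendsto_sInf hAne hAbdd
  choose u hu hue using heA
  obtain ⟨M, hM⟩ := he.bddAbove_range
  -- The compactness statement is applied with constant mass; only the energy inequality for the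
  -- limit is needed.
  obtain ⟨k, w, e', hk, hw, hke, hle, -⟩ := S.exists_subseq_nodal (μ := fun _ => μ) (fun _ => hμ)
    tendsto_const_nhds hu (M := M) (fun n => by
      rw [hue]; exact hM ⟨n, rfl⟩)
  refine ⟨w, hw, fun v hv => hle.trans ?_⟩
  have : e' = sInf A := by
    refine tendsto_nhds_unique hke ((he.comp hk.tendsto_atTop).congr fun n => ?_)
    exact (hue (k n)).symm
  rw [this]
  exact csInf_le hAbdd ⟨v, hv, rfl⟩

end Existence

/-! ### Continuity and derivative of the energy on finite-dimensional families -/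

section Combination

variable {N : ℕ} {μ p : ℝ} {u v w φ : Euc N → ℝ} {Ω : Set (Euc N)}

/-- The bilinear form associated with `quad μ`. -/
noncomputable def bil (μ : ℝ) (u φ : Euc N → ℝ) : ℝ :=
  ∫ x, (inner ℝ (weakGrad u x) (weakGrad φ x) + μ * (u x * φ x))

theorem MemS.integrable_bil (hu : MemS μ p u) (hφ : MemS μ p φ) :
    Integrable fun x => inner ℝ (weakGrad u x) (weakGrad φ x) + μ * (u x * φ x) := by
  refine (integrable_inner_of_memLp hu.1.memLp_weakGrad hφ.1.memLp_weakGrad).add ?_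
  by_cases h : μ = 0
  · simp [h]
  · exact ((hu.2 h).integrable_mul (hφ.2 h)).const_mul μ

theorem bil_add_left (hu : MemS μ p u) (hv : MemS μ p v) (hφ : MemS μ p φ) :
    bil μ (u + v) φ = bil μ u φ + bil μ v φ := by
  unfold bil
  rw [← integral_add (hu.integrable_bil hφ) (hv.integrable_bil hφ)]
  refine integral_congr_ae ?_
  filter_upwards [weakGrad_add hu.1 hv.1] with x hx
  rw [hx]
  simp only [Pi.add_apply, inner_add_left]
  ring

theorem bil_smul_left (hu : MemS μ p u) (c : ℝ) : bil μ (c • u) φ = c * bil μ u φ := by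
  unfold bil
  rw [← integral_const_mul]
  refine integral_congr_ae ?_
  filter_upwards [weakGrad_smul hu.1 c] with x hx
  rw [hx]
  simp only [Pi.smul_apply, inner_smul_left, smul_eq_mul, conj_trivial]
  ring

theorem quad_add_smul (hu : MemS μ p u) (hφ : MemS μ p φ) (d : ℝ) :
    quad μ (u + d • φ) = quad μ u + 2 * d * bil μ u φ + d ^ 2 * quad μ φ := by
  have h1 := hu.integrable_quad
  have h2 := (hu.integrable_bil hφ).const_mul (2 * d)
  have h3 := hφ.integrable_quad.const_mul (d ^ 2)
  have h12 : Integrable fun x => ‖weakGrad u x‖ ^ 2 + μ * u x ^ 2 +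
      2 * d * (inner ℝ (weakGrad u x) (weakGrad φ x) + μ * (u x * φ x)) := h1.add h2
  unfold quad bil
  rw [← integral_const_mul, ← integral_const_mul, ← integral_add h1 h2, ← integral_add h12 h3]
  refine integral_congr_ae ?_
  filter_upwards [weakGrad_add hu.1 (hφ.const_smul d).1, weakGrad_smul hφ.1 d] with x hx hx'
  rw [hx]
  simp only [Pi.add_apply, Pi.smul_apply, hx', smul_eq_mul, norm_add_sq_real, inner_smul_right,
    norm_smul, mul_pow, Real.norm_eq_abs, sq_abs]
  ring

/-- The linear combination of three functions with coefficients `z`. -/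
def comb (u v φ : Euc N → ℝ) (z : ℝ × ℝ × ℝ) : Euc N → ℝ := z.1 • u + z.2.1 • v + z.2.2 • φ

theorem MemS.comb (hu : MemS μ p u) (hv : MemS μ p v) (hφ : MemS μ p φ) (z : ℝ × ℝ × ℝ) :
    MemS μ p (comb u v φ z) :=
  ((hu.const_smul _).add (hv.const_smul _)).add (hφ.const_smul _)

theorem norm_comb_le {F : Type*} [NormedAddCommGroup F] [NormedSpace ℝ F] (a b c : F)
    {z : ℝ × ℝ × ℝ} {K : ℝ} (hz : ‖z‖ ≤ K) :
    ‖z.1 • a + z.2.1 • b + z.2.2 • c‖ ≤ K * (‖a‖ + ‖b‖ + ‖c‖) := by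
  have h1 : ‖z.1‖ ≤ K := (norm_fst_le z).trans hz
  have h2 : ‖z.2.1‖ ≤ K := ((norm_fst_le z.2).trans (norm_snd_le z)).trans hz
  have h3 : ‖z.2.2‖ ≤ K := ((norm_snd_le z.2).trans (norm_snd_le z)).trans hz
  calc ‖z.1 • a + z.2.1 • b + z.2.2 • c‖ ≤ ‖z.1 • a‖ + ‖z.2.1 • b‖ + ‖z.2.2 • c‖ := norm_add₃_le
    _ = ‖z.1‖ * ‖a‖ + ‖z.2.1‖ * ‖b‖ + ‖z.2.2‖ * ‖c‖ := by simp only [norm_smul]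
    _ ≤ K * ‖a‖ + K * ‖b‖ + K * ‖c‖ := by gcongr
    _ = _ := by ring

theorem continuous_comb_apply (u v φ : Euc N → ℝ) (x : Euc N) :
    Continuous fun z => comb u v φ z x := by
  simp only [comb, Pi.add_apply, Pi.smul_apply, smul_eq_mul]
  fun_prop

theorem eventually_norm_le (z₀ : ℝ × ℝ × ℝ) : ∀ᶠ z in 𝓝 z₀, ‖z‖ ≤ ‖z₀‖ + 1 :=
  (continuous_norm.tendsto z₀).eventually (eventually_le_nhds (by linarith))

theorem integrable_sum_norm_sq {F : Type*} [NormedAddCommGroup F] {a b c : Euc N → F}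
    (ha : MemLp a 2 volume) (hb : MemLp b 2 volume) (hc : MemLp c 2 volume) :
    Integrable fun x => (‖a x‖ + ‖b x‖ + ‖c x‖) ^ 2 :=
  ((ha.norm.add hb.norm).add hc.norm).integrable_sq

theorem integrable_sum_abs_rpow (hp : 0 < p) (hu : MemE p u) (hv : MemE p v) (hφ : MemE p φ) :
    Integrable fun x => (|u x| + |v x| + |φ x|) ^ p := by
  have h := ((hu.1.norm.add hv.1.norm).add hφ.1.norm).integrable_norm_rpow (by simpa using hp)
    (by simp)
  rw [ENNReal.toReal_ofReal hp.le] at h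
  refine h.congr (ae_of_all _ fun x => ?_)
  simp only [Pi.add_apply, Real.norm_eq_abs]
  rw [abs_of_nonneg (by positivity : 0 ≤ |u x| + |v x| + |φ x|)]

/-- The quadratic part of the positive part depends continuously on the coefficients. -/
theorem continuous_quad_pos_comb (hN : 1 ≤ N) (hμ : 0 ≤ μ) (hu : MemS μ p u) (hv : MemS μ p v)
    (hφ : MemS μ p φ) : Continuous fun z => quad μ (fun x => max (comb u v φ z x) 0) := by
  set G : ℝ × ℝ × ℝ → Euc N → Euc N := fun z x =>
    z.1 • weakGrad u x + z.2.1 • weakGrad v x + z.2.2 • weakGrad φ x with hG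
  have hGae : ∀ z, weakGrad (comb u v φ z) =ᵐ[volume] G z := by
    intro z
    filter_upwards [weakGrad_add ((hu.const_smul z.1).add (hv.const_smul z.2.1)).1
      (hφ.const_smul z.2.2).1, weakGrad_add (hu.const_smul z.1).1 (hv.const_smul z.2.1).1,
      weakGrad_smul hu.1 z.1, weakGrad_smul hv.1 z.2.1, weakGrad_smul hφ.1 z.2.2]
      with x h1 h2 h3 h4 h5
    rw [comb, h1]
    simp only [Pi.add_apply, h2, h3, h4, h5, Pi.smul_apply, hG]
  have hmem := fun z => hu.comb hv hφ z
  set F : ℝ × ℝ × ℝ → Euc N → ℝ := fun z => {x | 0 < comb u v φ z x}.indicator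
    fun x => ‖G z x‖ ^ 2 + μ * comb u v φ z x ^ 2 with hF
  have hquad : (fun z => quad μ (fun x => max (comb u v φ z x) 0)) = fun z => ∫ x, F z x := by
    ext z
    refine integral_congr_ae ?_
    filter_upwards [((hmem z).1.hasWeakGradient_pos hN).weakGrad_ae, hGae z] with x h1 h2
    rw [h1, hF]
    by_cases hx : 0 < comb u v φ z x
    · simp [hx, h2, hx.le]
    · simp [hx, not_lt.1 hx]
  rw [hquad, continuous_iff_continuousAt]
  intro z₀
  set K := ‖z₀‖ + 1
  refine continuousAt_of_dominated (bound := fun x =>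
    (K * (‖weakGrad u x‖ + ‖weakGrad v x‖ + ‖weakGrad φ x‖)) ^ 2 +
      μ * (K * (‖u x‖ + ‖v x‖ + ‖φ x‖)) ^ 2) ?_ ?_ ?_ ?_
  · refine Eventually.of_forall fun z => ?_
    have h1 : AEStronglyMeasurable (G z) volume :=
      (hmem z).1.memLp_weakGrad.aestronglyMeasurable.congr (hGae z)
    have h2 := (hmem z).1.1.aestronglyMeasurable
    exact ((h1.norm.pow 2).add ((h2.pow 2).const_mul μ)).indicator₀ (nullMeasurableSet_pos h2)
  · filter_upwards [eventually_norm_le z₀] with z hz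
    refine ae_of_all _ fun x => ?_
    refine (norm_indicator_le_norm_self _ _).trans ?_
    have h1 := norm_comb_le (weakGrad u x) (weakGrad v x) (weakGrad φ x) hz
    have h2 : |comb u v φ z x| ≤ _ := norm_comb_le (u x) (v x) (φ x) hz
    rw [Real.norm_of_nonneg (by positivity), ← sq_abs (comb u v φ z x)]
    gcongr
  · simp only [mul_pow]
    refine ((integrable_sum_norm_sq hu.1.memLp_weakGrad hv.1.memLp_weakGrad
      hφ.1.memLp_weakGrad).const_mul _).add ?_
    by_cases h : μ = 0
    · simp [h]
    · exact ((integrable_sum_norm_sq (hu.2 h) (hv.2 h) (hφ.2 h)).const_mul _).const_mul _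
  · filter_upwards [(hmem z₀).1.weakGrad_ae_zero hN, hGae z₀] with x h1 h2
    have hc := continuous_comb_apply u v φ x
    have hGc : Continuous fun z => G z x := by simp only [hG]; fun_prop
    have hc2 : Continuous fun z => ‖G z x‖ ^ 2 + μ * comb u v φ z x ^ 2 := by fun_prop
    rcases lt_trichotomy (comb u v φ z₀ x) 0 with h | h | h
    · have : (fun z => F z x) =ᶠ[𝓝 z₀] fun _ => 0 := by
        filter_upwards [hc.continuousAt.eventually_lt continuousAt_const h] with z hz
        simp [hF, hz.le]
      exact (continuousAt_const.congr this.symm)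
    -- The indicator may jump where the combination at z₀ vanishes. Its gradient vanishes there too
    -- for almost every x, so the density it multiplies tends to 0 and the jump is harmless.
    · have h0 : F z₀ x = 0 := by simp [hF, h]
      have h3 : ‖G z₀ x‖ ^ 2 + μ * comb u v φ z₀ x ^ 2 = 0 := by
        rw [← h2, h1 h, h]; simp
      rw [ContinuousAt, h0]
      refine squeeze_zero (fun z => ?_) (fun z => ?_) (h3 ▸ hc2.tendsto z₀)
      · exact Set.indicator_nonneg (fun x _ => by positivity) _
      · exact Set.indicator_le_self' (fun x _ => by positivity) _
    · have : (fun z => F z x) =ᶠ[𝓝 z₀] fun z => ‖G z x‖ ^ 2 + μ * comb u v φ z x ^ 2 := by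
        filter_upwards [continuousAt_const.eventually_lt hc.continuousAt h] with z hz
        simp [hF, hz]
      exact hc2.continuousAt.congr this.symm

theorem continuous_pot_pos_comb (hp : 0 < p) (hΩ : MeasurableSet Ω) (hu : MemE p u)
    (hv : MemE p v) (hφ : MemE p φ) :
    Continuous fun z => pot (Q Ω) p (fun x => max (comb u v φ z x) 0) := by
  rw [continuous_iff_continuousAt]
  intro z₀
  set K := ‖z₀‖ + 1 with hK
  have hm : ∀ z, AEStronglyMeasurable (comb u v φ z) volume := fun z =>
    ((hu.1.aestronglyMeasurable.const_smul _).add (hv.1.aestronglyMeasurable.const_smul _)).add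
      (hφ.1.aestronglyMeasurable.const_smul _)
  refine continuousAt_of_dominated (bound := fun x => (K * (|u x| + |v x| + |φ x|)) ^ p)
    ?_ ?_ ?_ ?_
  · refine Eventually.of_forall fun z => ?_
    exact (measurable_Q hΩ).aestronglyMeasurable.mul
      ((((hm z).sup aestronglyMeasurable_const).norm.aemeasurable.pow_const p).aestronglyMeasurable)
  · filter_upwards [eventually_norm_le z₀] with z hz
    refine ae_of_all _ fun x => ?_
    rw [norm_mul, Real.norm_eq_abs, abs_Q, one_mul, Real.norm_of_nonneg (by positivity)]
    have h2 : |comb u v φ z x| ≤ K * (|u x| + |v x| + |φ x|) :=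
      norm_comb_le (u x) (v x) (φ x) hz
    refine Real.rpow_le_rpow (abs_nonneg _) (le_trans ?_ h2) hp.le
    rcases le_total (comb u v φ z x) 0 with h | h
    · simp [h]
    · simp [h]
  · have hK0 : 0 ≤ K := by positivity
    refine ((integrable_sum_abs_rpow hp hu hv hφ).const_mul (K ^ p)).congr
      (ae_of_all _ fun x => ?_)
    simp only
    rw [Real.mul_rpow hK0 (by positivity)]
  · refine ae_of_all _ fun x => ?_
    have hc := continuous_comb_apply u v φ x
    exact (continuous_const.mul (((hc.max continuous_const).abs).rpow_const
      fun _ => Or.inr hp.le)).continuousAt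

theorem energyDeriv_eq (q : Euc N → ℝ) :
    energyDeriv μ q p u φ = bil μ u φ - ∫ x, q x * (|u x| ^ (p - 2) * u x) * φ x := rfl

theorem abs_rpow_sub_two_mul_self (hp : 2 < p) (s : ℝ) : |s| ^ (p - 2) * |s| = |s| ^ (p - 1) := by
  nth_rw 2 [← Real.rpow_one |s|]
  rw [← Real.rpow_add_of_nonneg (abs_nonneg s) (by linarith) zero_le_one]
  congr 1; ring

theorem abs_nonlin_le (hp : 2 < p) {x : Euc N} {s t D K : ℝ} (hK : 0 ≤ K) (hD : 0 ≤ D)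
    (hs : |s| ≤ K * D) (ht : |t| ≤ D) :
    ‖Q Ω x * (|s| ^ (p - 2) * s) * t‖ ≤ K ^ (p - 1) * D ^ p := by
  rw [norm_mul, norm_mul, Real.norm_eq_abs, abs_Q, one_mul, norm_mul,
    Real.norm_of_nonneg (by positivity : 0 ≤ |s| ^ (p - 2)), Real.norm_eq_abs,
    abs_rpow_sub_two_mul_self hp, Real.norm_eq_abs]
  calc |s| ^ (p - 1) * |t| ≤ (K * D) ^ (p - 1) * D := by
        gcongr
        linarith
    _ = K ^ (p - 1) * D ^ p := by
        rw [Real.mul_rpow hK hD, mul_assoc]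
        congr 1
        nth_rw 2 [← Real.rpow_one D]
        rw [← Real.rpow_add_of_nonneg hD (by linarith) zero_le_one]
        congr 1; ring

theorem aestronglyMeasurable_nonlin (hΩ : MeasurableSet Ω)
    (hu : AEStronglyMeasurable u volume) (hφ : AEStronglyMeasurable φ volume) :
    AEStronglyMeasurable (fun x => Q Ω x * (|u x| ^ (p - 2) * u x) * φ x) volume :=
  ((measurable_Q hΩ).aestronglyMeasurable.mul
    ((hu.norm.aemeasurable.pow_const (p - 2)).aestronglyMeasurable.mul hu)).mul hφ

theorem continuous_energyDeriv_comb (hp : 2 < p) (hΩ : MeasurableSet Ω)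
    (hu : MemS μ p u) (hv : MemS μ p v) (hφ : MemS μ p φ) :
    Continuous fun z => energyDeriv μ (Q Ω) p (comb u v φ z) φ := by
  simp only [energyDeriv_eq]
  refine Continuous.sub ?_ ?_
  · have : (fun z => bil μ (comb u v φ z) φ) =
        fun z : ℝ × ℝ × ℝ => z.1 * bil μ u φ + z.2.1 * bil μ v φ + z.2.2 * bil μ φ φ := by
      ext z
      rw [comb, bil_add_left ((hu.const_smul _).add (hv.const_smul _)) (hφ.const_smul _) hφ,
        bil_add_left (hu.const_smul _) (hv.const_smul _) hφ, bil_smul_left hu, bil_smul_left hv,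
        bil_smul_left hφ]
    rw [this]
    fun_prop
  · rw [continuous_iff_continuousAt]
    intro z₀
    set K := ‖z₀‖ + 1 with hK
    refine continuousAt_of_dominated
      (bound := fun x => K ^ (p - 1) * (|u x| + |v x| + |φ x|) ^ p) ?_ ?_ ?_ ?_
    · exact Eventually.of_forall fun z => aestronglyMeasurable_nonlin hΩ
        (hu.comb hv hφ z).1.1.aestronglyMeasurable hφ.1.1.aestronglyMeasurable
    · filter_upwards [eventually_norm_le z₀] with z hz
      refine ae_of_all _ fun x => ?_
      exact abs_nonlin_le hp (by positivity) (by positivity)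
        (norm_comb_le (u x) (v x) (φ x) hz) (by linarith [abs_nonneg (u x), abs_nonneg (v x)])
    · exact (integrable_sum_abs_rpow (by linarith) hu.1 hv.1 hφ.1).const_mul _
    · refine ae_of_all _ fun x => ?_
      have hc := continuous_comb_apply u v φ x
      refine Continuous.continuousAt ?_
      exact (continuous_const.mul ((hc.abs.rpow_const fun _ => Or.inr (by linarith)).mul hc)).mul
        continuous_const

theorem hasDerivAt_energy (hp : 2 < p) (hΩ : MeasurableSet Ω) (hu : MemS μ p u)
    (hφ : MemS μ p φ) (d : ℝ) : HasDerivAt (fun d : ℝ => energy μ (Q Ω) p (u + d • φ))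
      (energyDeriv μ (Q Ω) p (u + d • φ) φ) d := by
  have hp0 : 0 < p := by linarith
  have hq : HasDerivAt (fun d : ℝ => quad μ (u + d • φ)) (2 * bil μ (u + d • φ) φ) d := by
    simp only [quad_add_smul hu hφ]
    rw [bil_add_left hu (hφ.const_smul d) hφ, bil_smul_left hφ]
    have e : bil μ φ φ = quad μ φ := by
      refine integral_congr_ae (ae_of_all _ fun x => ?_)
      simp only [real_inner_self_eq_norm_sq]
      ring
    rw [e]
    have h1 : HasDerivAt (fun d : ℝ => quad μ u + 2 * d * bil μ u φ + d ^ 2 * quad μ φ)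
        (2 * 1 * bil μ u φ + (2 : ℕ) * d ^ (2 - 1) * quad μ φ) d :=
      ((((hasDerivAt_id d).const_mul 2).mul_const (bil μ u φ)).const_add _).add
        ((hasDerivAt_pow 2 d).mul_const _)
    convert h1 using 1
    push_cast; ring
  have hP : HasDerivAt (fun d : ℝ => pot (Q Ω) p (u + d • φ))
      (∫ x, p * (Q Ω x * (|(u + d • φ) x| ^ (p - 2) * (u + d • φ) x) * φ x)) d := by
    -- For t within distance 1 of d one has |t| ≤ |d| + 1 ≤ K. In the majorant |u| occurs twice so
    -- that the bound for three functions can be reused.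
    set K := |d| + 2 with hK
    have hK0 : 0 ≤ K := by positivity
    refine (hasDerivAt_integral_of_dominated_loc_of_deriv_le
      (F := fun d x => Q Ω x * |(u + d • φ) x| ^ p)
      (F' := fun d x => p * (Q Ω x * (|(u + d • φ) x| ^ (p - 2) * (u + d • φ) x) * φ x))
      (bound := fun x => p * (K ^ (p - 1) * (|u x| + |u x| + |φ x|) ^ p))
      (Metric.ball_mem_nhds d one_pos) ?_ ?_ ?_ ?_ ?_ ?_).2
    · exact Eventually.of_forall fun d =>
        ((hu.add (hφ.const_smul d)).1.integrable_pot hp0 hΩ).aestronglyMeasurable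
    · exact (hu.add (hφ.const_smul d)).1.integrable_pot hp0 hΩ
    · exact (aestronglyMeasurable_nonlin hΩ
        (hu.add (hφ.const_smul d)).1.1.aestronglyMeasurable
        hφ.1.1.aestronglyMeasurable).const_mul p
    · refine ae_of_all _ fun x t ht => ?_
      rw [norm_mul, Real.norm_of_nonneg hp0.le]
      refine mul_le_mul_of_nonneg_left ?_ hp0.le
      refine abs_nonlin_le hp hK0 (by positivity) ?_
        (by linarith [abs_nonneg (u x), abs_nonneg (u x)])
      have ht' : |t| ≤ |d| + 1 := by
        have h1 : |t - d| < 1 := by simpa [Real.dist_eq] using ht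
        have := abs_add_le (t - d) d
        rw [sub_add_cancel] at this
        linarith
      calc |(u + t • φ) x| ≤ |u x| + |t| * |φ x| := by
            simp only [Pi.add_apply, Pi.smul_apply, smul_eq_mul]
            rw [← abs_mul]; exact abs_add_le _ _
        _ ≤ K * (|u x| + |u x| + |φ x|) := by
            have := abs_nonneg (u x)
            have := abs_nonneg (φ x)
            have := abs_nonneg d
            rw [hK]
            nlinarith [mul_le_mul_of_nonneg_right ht' (abs_nonneg (φ x)),
              mul_nonneg (abs_nonneg d) (abs_nonneg (u x))]
    · exact ((integrable_sum_abs_rpow hp0 hu.1 hu.1 hφ.1).const_mul _).const_mul _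
    · refine ae_of_all _ fun x t _ => ?_
      have h1 : HasDerivAt (fun t : ℝ => u x + t * φ x) (1 * φ x) t :=
        ((hasDerivAt_id t).mul_const (φ x)).const_add _
      have h2 := ((hasDerivAt_abs_rpow (u x + t * φ x) (by linarith : 1 < p)).comp t h1).const_mul
        (Q Ω x)
      refine h2.congr_deriv ?_
      simp only [Pi.add_apply, Pi.smul_apply, smul_eq_mul]
      ring
  have h := (hq.const_mul (1 / 2)).sub (hP.const_mul (1 / p))
  refine h.congr_deriv ?_
  rw [energyDeriv_eq, integral_const_mul]
  field_simp

end Combination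

/-! ### Minimizers are critical points -/

section CriticalPoint

variable {N : ℕ} {μ p : ℝ} {u φ : Euc N → ℝ} {Ω : Set (Euc N)}

theorem comb_neg (u v φ : Euc N → ℝ) (z : ℝ × ℝ × ℝ) :
    comb u v φ (-z) = (-1 : ℝ) • comb u v φ z := by
  ext x
  simp only [comb, Pi.add_apply, Pi.smul_apply, smul_eq_mul, Prod.fst_neg, Prod.snd_neg]
  ring

theorem comb_smul (u v φ : Euc N → ℝ) (t : ℝ) (z : ℝ × ℝ × ℝ) :
    comb u v φ (t • z) = t • comb u v φ z := by
  ext x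
  simp only [comb, Pi.add_apply, Pi.smul_apply, smul_eq_mul, Prod.smul_fst, Prod.smul_snd]
  ring

/-- Changing the sign of the coefficients exchanges positive and negative parts, so continuity need
only be proved for positive parts. -/
theorem quad_neg_comb (hN : 1 ≤ N) {v : Euc N → ℝ} (hu : MemS μ p u) (hv : MemS μ p v)
    (hφ : MemS μ p φ) (z : ℝ × ℝ × ℝ) : quad μ (fun x => min (comb u v φ z x) 0) =
      quad μ (fun x => max (comb u v φ (-z) x) 0) := by
  rw [min_eq_neg_max, ← comb_neg, quad_smul ((hu.comb hv hφ (-z)).pos hN).1]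
  norm_num

theorem pot_neg_comb (v : Euc N → ℝ) (z : ℝ × ℝ × ℝ) :
    pot (Q Ω) p (fun x => min (comb u v φ z x) 0) =
      pot (Q Ω) p (fun x => max (comb u v φ (-z) x) 0) := by
  rw [min_eq_neg_max, ← comb_neg, pot_smul]
  norm_num

theorem max_comb (u φ : Euc N → ℝ) {a b : ℝ} (ha : 0 < a) (hb : 0 < b) :
    (fun x => max (comb (fun x => max (u x) 0) (fun x => min (u x) 0) φ (a, b, 0) x) 0) =
      a • fun x => max (u x) 0 := by
  ext x
  simp only [comb, Pi.add_apply, Pi.smul_apply, smul_eq_mul, zero_mul, add_zero]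
  rcases le_total (u x) 0 with h | h
  · simp [h, mul_nonpos_of_nonneg_of_nonpos hb.le h]
  · simp [h, mul_nonneg ha.le h]

theorem min_comb (u φ : Euc N → ℝ) {a b : ℝ} (ha : 0 < a) (hb : 0 < b) :
    (fun x => min (comb (fun x => max (u x) 0) (fun x => min (u x) 0) φ (a, b, 0) x) 0) =
      b • fun x => min (u x) 0 := by
  ext x
  simp only [comb, Pi.add_apply, Pi.smul_apply, smul_eq_mul, zero_mul, add_zero]
  rcases le_total (u x) 0 with h | h
  · simp [h, mul_nonpos_of_nonneg_of_nonpos hb.le h]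
  · simp [h, mul_nonneg ha.le h]

/-- Bernoulli's inequality for (s²)^{p/2}, valid as p/2 ≥ 1. It says that a Nehari function
maximizes the energy on its own ray. -/
theorem half_sq_sub_rpow_le (hp : 2 < p) {s : ℝ} (hs : 0 < s) :
    1 / 2 * s ^ 2 - 1 / p * s ^ p ≤ 1 / 2 - 1 / p := by
  have h := one_add_mul_self_le_rpow_one_add (s := s ^ 2 - 1) (by nlinarith) (p := p / 2)
    (by linarith)
  have e : (1 + (s ^ 2 - 1)) ^ (p / 2) = s ^ p := by
    rw [add_sub_cancel, ← Real.rpow_natCast, ← Real.rpow_mul hs.le]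
    congr 1; push_cast; ring
  rw [e] at h
  have h2 := mul_le_mul_of_nonneg_left h (by positivity : 0 ≤ 1 / p)
  have e2 : 1 / p * (1 + p / 2 * (s ^ 2 - 1)) = 1 / p + 1 / 2 * (s ^ 2 - 1) := by
    field_simp
  linarith

/-- On the nodal Nehari set the energy is maximal along the two fibres. -/
theorem Setup.energy_fibre_le (S : Setup N p Ω) (hμ : 0 ≤ μ)
    (h : u ∈ nodalNehari (MemS μ p) μ (Q Ω) p) {a b : ℝ} (ha : 0 < a) (hb : 0 < b) :
    energy μ (Q Ω) p ((a • fun x => max (u x) 0) + b • fun x => min (u x) 0) ≤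
      energy μ (Q Ω) p u := by
  obtain ⟨h1, -, h3⟩ := (mem_nehari_iff S.two_lt).1 h.2.1
  obtain ⟨h1', -, h3'⟩ := (mem_nehari_iff S.two_lt).1 h.2.2
  have hd : ∀ᵐ x, (a • fun x => max (u x) 0) x * (b • fun x => min (u x) 0) x = 0 :=
    ae_of_all _ fun x => by
      simp only [Pi.smul_apply, smul_eq_mul]
      linear_combination a * b * pos_mul_neg_zero u x
  rw [S.energy_nodal h, energy_eq, (h1.const_smul a).quad_add S.dim (h1'.const_smul b) hd,
    (h1.const_smul a).1.pot_add S.p_pos S.meas (h1'.const_smul b).1 hd, quad_smul h1.1,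
    quad_smul h1'.1, pot_smul, pot_smul, ← h3, ← h3', abs_of_pos ha, abs_of_pos hb]
  have e1 := mul_le_mul_of_nonneg_right (half_sq_sub_rpow_le S.two_lt ha)
    (quad_nonneg hμ fun x => max (u x) 0)
  have e2 := mul_le_mul_of_nonneg_right (half_sq_sub_rpow_le S.two_lt hb)
    (quad_nonneg hμ fun x => min (u x) 0)
  linarith

/-- If the projection factors of both parts of `w` agree then a multiple of `w` lies in the nodal
Nehari set. -/
theorem Setup.smul_mem_nodalNehari (S : Setup N p Ω) (hμ : 0 ≤ μ) {w : Euc N → ℝ}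
    (hw : MemS μ p w) (h1 : 0 < pot (Q Ω) p fun x => max (w x) 0)
    (h2 : 0 < pot (Q Ω) p fun x => min (w x) 0)
    (h : proj μ p Ω (fun x => max (w x) 0) = proj μ p Ω (fun x => min (w x) 0)) :
    proj μ p Ω (fun x => max (w x) 0) • w ∈ nodalNehari (MemS μ p) μ (Q Ω) p := by
  have m1 := S.proj_smul_mem hμ (hw.pos S.dim) h1
  have m2 := S.proj_smul_mem hμ (hw.neg S.dim) h2
  have ht := S.proj_pos hμ (hw.pos S.dim) h1
  rw [← h] at m2
  have := (S.add_mem_nodalNehari m1 m2 (ae_of_all _ fun x => ?_) (ae_of_all _ fun x => ?_)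
    (ae_of_all _ fun x => ?_)).1
  · rwa [← smul_add, max_add_min_zero] at this
  · exact mul_nonneg ht.le (le_max_right _ _)
  · exact mul_nonpos_of_nonneg_of_nonpos ht.le (min_le_right _ _)
  · simp only [Pi.smul_apply, smul_eq_mul]
    linear_combination (proj μ p Ω fun x => max (w x) 0) ^ 2 * pos_mul_neg_zero w x

/-- Lagrange multipliers would need a manifold. Suppose instead the derivative along φ is negative.
The functions (1+t)u⁺ + (1-t)u⁻ + δφ with small t and δ > 0 contain, for a suitable t, one with a
multiple in the nodal Nehari set. Its energy is strictly less than that of the multiple without φ, a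
combination of u⁺ and u⁻, and this is at most the energy of u. Used for φ and -φ. -/
theorem Setup.energyDeriv_nonneg (S : Setup N p Ω) (hμ : 0 ≤ μ)
    (h : IsLeastEnergyNodal (MemS μ p) μ (Q Ω) p u) (hφ : MemS μ p φ) :
    0 ≤ energyDeriv μ (Q Ω) p u φ := by
  have hp := S.two_lt
  by_contra hneg
  push Not at hneg
  obtain ⟨hU, hU0, hUq⟩ := (mem_nehari_iff hp).1 h.1.2.1
  obtain ⟨hV, hV0, hVq⟩ := (mem_nehari_iff hp).1 h.1.2.2
  set U : Euc N → ℝ := fun x => max (u x) 0 with hUdef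
  set V : Euc N → ℝ := fun x => min (u x) 0 with hVdef
  have hApos : 0 < quad μ U :=
    (S.dir_pos hU.1 hU0 (hUq ▸ quad_nonneg hμ U)).trans_le (hU.dir_le_quad hμ)
  have hBpos : 0 < quad μ V :=
    (S.dir_pos hV.1 hV0 (hVq ▸ quad_nonneg hμ V)).trans_le (hV.dir_le_quad hμ)
  set W := comb U V φ with hW
  have hWm : ∀ z, MemS μ p (W z) := hU.comb hV hφ
  set z₀ : ℝ × ℝ × ℝ := (1, 1, 0) with hz₀
  have hW0 : W z₀ = u := by
    rw [hW, hz₀, comb, one_smul, one_smul, zero_smul, add_zero, max_add_min_zero]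
  set qp : ℝ × ℝ × ℝ → ℝ := fun z => quad μ (fun x => max (W z x) 0) with hqp
  set qm : ℝ × ℝ × ℝ → ℝ := fun z => quad μ (fun x => min (W z x) 0) with hqm
  set pp : ℝ × ℝ × ℝ → ℝ := fun z => pot (Q Ω) p (fun x => max (W z x) 0) with hpp
  set pm : ℝ × ℝ × ℝ → ℝ := fun z => pot (Q Ω) p (fun x => min (W z x) 0) with hpm
  have cqp : Continuous qp := continuous_quad_pos_comb S.dim hμ hU hV hφ
  have cpp : Continuous pp := continuous_pot_pos_comb S.p_pos S.meas hU.1 hV.1 hφ.1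
  have cqm : Continuous qm := by
    simp only [hqm, hW, quad_neg_comb S.dim hU hV hφ]
    exact cqp.comp continuous_neg
  have cpm : Continuous pm := by
    simp only [hpm, hW, pot_neg_comb]
    exact cpp.comp continuous_neg
  have cder : Continuous fun z => energyDeriv μ (Q Ω) p (W z) φ :=
    continuous_energyDeriv_comb hp S.meas hU hV hφ
  have vqp : ∀ a b : ℝ, 0 < a → 0 < b → qp (a, b, 0) = a ^ 2 * quad μ U := fun a b ha hb => by
    simp only [hqp, hW, hUdef, hVdef]
    rw [max_comb u φ ha hb, quad_smul hU.1]
  have vqm : ∀ a b : ℝ, 0 < a → 0 < b → qm (a, b, 0) = b ^ 2 * quad μ V := fun a b ha hb => by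
    simp only [hqm, hW, hUdef, hVdef]
    rw [min_comb u φ ha hb, quad_smul hV.1]
  have vpp : ∀ a b : ℝ, 0 < a → 0 < b → pp (a, b, 0) = a ^ p * quad μ U := fun a b ha hb => by
    simp only [hpp, hW, hUdef, hVdef]
    rw [max_comb u φ ha hb, pot_smul, abs_of_pos ha, ← hUq]
  have vpm : ∀ a b : ℝ, 0 < a → 0 < b → pm (a, b, 0) = b ^ p * quad μ V := fun a b ha hb => by
    simp only [hpm, hW, hUdef, hVdef]
    rw [min_comb u φ ha hb, pot_smul, abs_of_pos hb, ← hVq]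
  have hpp0 : pp z₀ = quad μ U := by
    rw [hz₀, vpp 1 1 one_pos one_pos, Real.one_rpow, one_mul]
  have hpm0 : pm z₀ = quad μ V := by
    rw [hz₀, vpm 1 1 one_pos one_pos, Real.one_rpow, one_mul]
  have hqp0 : qp z₀ = quad μ U := by
    rw [hz₀, vqp 1 1 one_pos one_pos, one_pow, one_mul]
  -- the neighbourhood on which the directional derivative is negative
  have evneg : ∀ᶠ z in 𝓝 z₀, energyDeriv μ (Q Ω) p (W z) φ < 0 :=
    (cder.tendsto z₀).eventually (eventually_lt_nhds (by rwa [hW0]))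
  obtain ⟨r, hr, hball⟩ := Metric.eventually_nhds_iff.1 evneg
  -- The projection factor of the positive part. It equals 1 at z₀, so by continuity τ z • z remains
  -- in the ball on which the derivative is negative.
  set τ : ℝ × ℝ × ℝ → ℝ := fun z => (qp z / pp z) ^ (1 / (p - 2)) with hτ
  have cτ : ContinuousAt (fun z => τ z • z) z₀ := by
    have c1 : ContinuousAt τ z₀ :=
      ((cqp.continuousAt (x := z₀)).div cpp.continuousAt
        (by rw [hpp0]; exact hApos.ne')).rpow_const
        (Or.inr (one_div_nonneg.2 (by linarith : 0 ≤ p - 2)))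
    exact c1.smul continuousAt_id
  have hτ0 : τ z₀ • z₀ = z₀ := by
    simp only [hτ]
    rw [hqp0, hpp0, div_self hApos.ne', Real.one_rpow, one_smul]
  have ev : ∀ᶠ z in 𝓝 z₀, dist (τ z • z) z₀ < r ∧ 0 < pp z ∧ 0 < pm z := by
    refine ((cτ.eventually (Metric.ball_mem_nhds _ (by simpa using hr))).mono ?_).and
      ((continuousAt_const.eventually_lt cpp.continuousAt ?_).and
      (continuousAt_const.eventually_lt cpm.continuousAt ?_))
    · intro z hz
      have hz' : dist (τ z • z) (τ z₀ • z₀) < r := hz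
      rwa [hτ0] at hz'
    · rw [hpp0]; exact hApos
    · rw [hpm0]; exact hBpos
  obtain ⟨s, hs, hsball⟩ := Metric.eventually_nhds_iff.1 ev
  set θ := min (s / 2) (1 / 2) with hθ
  have hθ0 : 0 < θ := by positivity
  have hθs : θ ≤ s / 2 := min_le_left _ _
  have hθ1 : θ ≤ 1 / 2 := min_le_right _ _
  -- H vanishes exactly when the ratios quad/pot of both parts agree (given positive potentials), so
  -- that one scalar projects both. For δ = 0 its sign is that of b^{p-2} - a^{p-2}, hence opposite
  -- at the two ends of the segment, and this persists for small δ.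
  set H : ℝ × ℝ × ℝ → ℝ := fun z => qp z * pm z - qm z * pp z with hH
  have cH : Continuous H := (cqp.mul cpm).sub (cqm.mul cpp)
  have vH : ∀ a b : ℝ, 0 < a → 0 < b →
      H (a, b, 0) = quad μ U * quad μ V * (a ^ 2 * b ^ 2) * (b ^ (p - 2) - a ^ (p - 2)) := by
    intro a b ha hb
    have e : ∀ t : ℝ, 0 < t → t ^ p = t ^ 2 * t ^ (p - 2) := fun t ht => by
      rw [← Real.rpow_natCast, ← Real.rpow_add ht]
      congr 1; push_cast; ring
    simp only [hH]
    rw [vqp a b ha hb, vqm a b ha hb, vpp a b ha hb, vpm a b ha hb, e a ha, e b hb]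
    ring
  have hcoef : ∀ a b : ℝ, 0 < a → 0 < b → 0 < quad μ U * quad μ V * (a ^ 2 * b ^ 2) :=
    fun a b ha hb => by positivity
  have H1 : H (1 + θ, 1 - θ, 0) < 0 := by
    rw [vH _ _ (by linarith) (by linarith)]
    refine mul_neg_of_pos_of_neg (hcoef _ _ (by linarith) (by linarith)) ?_
    exact sub_neg.2 (Real.rpow_lt_rpow (by linarith) (by linarith) (by linarith))
  have H2 : 0 < H (1 - θ, 1 + θ, 0) := by
    rw [vH _ _ (by linarith) (by linarith)]
    refine mul_pos (hcoef _ _ (by linarith) (by linarith)) ?_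
    exact sub_pos.2 (Real.rpow_lt_rpow (by linarith) (by linarith) (by linarith))
  obtain ⟨δ, hδ0, hδs, hδ1, hδ2⟩ : ∃ δ : ℝ, 0 < δ ∧ δ < s ∧ H (1 + θ, 1 - θ, δ) < 0 ∧
      0 < H (1 - θ, 1 + θ, δ) := by
    have c1 : Continuous fun δ : ℝ => H (1 + θ, 1 - θ, δ) := cH.comp (by fun_prop)
    have c2 : Continuous fun δ : ℝ => H (1 - θ, 1 + θ, δ) := cH.comp (by fun_prop)
    have e1 : ∀ᶠ δ in 𝓝 (0 : ℝ), δ < s ∧ H (1 + θ, 1 - θ, δ) < 0 ∧ 0 < H (1 - θ, 1 + θ, δ) :=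
      (eventually_lt_nhds hs).and ((c1.continuousAt.eventually_lt continuousAt_const H1).and
        (continuousAt_const.eventually_lt c2.continuousAt H2))
    obtain ⟨δ, hδ, h0⟩ := ((e1.filter_mono nhdsWithin_le_nhds).and
      (self_mem_nhdsWithin (s := Set.Ioi (0 : ℝ)))).exists
    exact ⟨δ, h0, hδ⟩
  -- One unknown suffices because only the equality of the two projection factors is imposed; their
  -- common value is scaled out afterwards.
  obtain ⟨t, ht, htH⟩ : ∃ t ∈ Set.Icc (-θ) θ, H (1 + t, 1 - t, δ) = 0 := by
    have c1 : Continuous fun t : ℝ => H (1 + t, 1 - t, δ) := cH.comp (by fun_prop)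
    refine intermediate_value_Icc' (by linarith) c1.continuousOn ⟨hδ1.le, ?_⟩
    rw [sub_neg_eq_add, ← sub_eq_add_neg]
    exact hδ2.le
  set z : ℝ × ℝ × ℝ := (1 + t, 1 - t, δ) with hz
  have habs : |t| ≤ θ := abs_le.2 ht
  have hzs : dist z z₀ < s := by
    rw [hz, hz₀, Prod.dist_eq, Prod.dist_eq, max_lt_iff, max_lt_iff, Real.dist_eq, Real.dist_eq,
      Real.dist_eq]
    refine ⟨?_, ?_, ?_⟩
    · rw [add_sub_cancel_left]; linarith
    · rw [sub_sub_cancel_left, abs_neg]; linarith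
    · rwa [sub_zero, abs_of_pos hδ0]
  obtain ⟨hzr, hzp, hzm⟩ := hsball hzs
  have hproj : proj μ p Ω (fun x => max (W z x) 0) = proj μ p Ω (fun x => min (W z x) 0) := by
    unfold proj
    congr 1
    rw [div_eq_div_iff hzp.ne' hzm.ne']
    exact sub_eq_zero.1 htH
  have hτpos : 0 < τ z := S.proj_pos hμ ((hWm z).pos S.dim) hzp
  have hmem : τ z • W z ∈ nodalNehari (MemS μ p) μ (Q Ω) p :=
    S.smul_mem_nodalNehari hμ (hWm z) hzp hzm hproj
  have hge := h.2 _ hmem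
  -- The function reached when the φ component of τ z • W z is removed; it lies on the two fibres
  -- through u.
  set v : Euc N → ℝ := (τ z * (1 + t)) • U + (τ z * (1 - t)) • V with hv
  have hvm : MemS μ p v := (hU.const_smul _).add (hV.const_smul _)
  have hvle : energy μ (Q Ω) p v ≤ energy μ (Q Ω) p u :=
    S.energy_fibre_le hμ h.1 (mul_pos hτpos (by linarith [ht.1])) (mul_pos hτpos
      (by linarith [ht.2]))
  have hvW : ∀ d : ℝ, v + d • φ = W (τ z * (1 + t), τ z * (1 - t), d) := fun d => rfl
  have hτW : τ z • W z = v + (τ z * δ) • φ := by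
    rw [hvW, hW, ← comb_smul, hz]
    rfl
  have hanti : StrictAntiOn (fun d : ℝ => energy μ (Q Ω) p (v + d • φ))
      (Set.Icc 0 (τ z * δ)) := by
    refine strictAntiOn_of_deriv_neg (convex_Icc _ _)
      (fun d _ => (hasDerivAt_energy hp S.meas hvm hφ d).continuousAt.continuousWithinAt)
      fun d hd => ?_
    rw [interior_Icc] at hd
    rw [(hasDerivAt_energy hp S.meas hvm hφ d).deriv, hvW]
    -- In the maximum metric, lowering the third coordinate from τδ to d only brings the point
    -- closer to z₀, whose third coordinate is 0. The whole segment stays in the ball.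
    refine hball (lt_of_le_of_lt ?_ hzr)
    rw [hz, hz₀, Prod.smul_mk, Prod.smul_mk, Prod.dist_eq, Prod.dist_eq, Prod.dist_eq,
      Prod.dist_eq]
    simp only [smul_eq_mul]
    refine max_le_max le_rfl (max_le_max le_rfl ?_)
    rw [Real.dist_eq, Real.dist_eq, sub_zero, sub_zero, abs_of_pos hd.1, abs_of_pos
      (hd.1.trans hd.2)]
    exact hd.2.le
  have hδ' : 0 < τ z * δ := mul_pos hτpos hδ0
  have hlt := hanti (Set.left_mem_Icc.2 hδ'.le) (Set.right_mem_Icc.2 hδ'.le) hδ'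
  simp only [zero_smul, add_zero] at hlt
  rw [hτW] at hge
  linarith

theorem energyDeriv_smul_neg (hφ : MemE p φ) (q : Euc N → ℝ) :
    energyDeriv μ q p u ((-1 : ℝ) • φ) = -energyDeriv μ q p u φ := by
  unfold energyDeriv
  rw [neg_sub', sub_neg_eq_add, sub_eq_add_neg, ← integral_neg, ← integral_neg]
  congr 1
  · refine integral_congr_ae ?_
    filter_upwards [weakGrad_smul hφ (-1)] with x hx
    rw [hx]
    simp only [Pi.smul_apply, inner_smul_right, smul_eq_mul]
    ring
  · refine integral_congr_ae (ae_of_all _ fun x => ?_)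
    simp only [Pi.smul_apply, smul_eq_mul]
    ring

/-- A minimizer on the nodal Nehari set is a critical point of the energy. -/
theorem Setup.isSolution (S : Setup N p Ω) (hμ : 0 ≤ μ)
    (h : IsLeastEnergyNodal (MemS μ p) μ (Q Ω) p u) : IsSolution (MemS μ p) μ (Q Ω) p u := by
  refine ⟨((mem_nehari_iff S.two_lt).1 h.1.1).1, fun φ hφ => le_antisymm ?_
    (S.energyDeriv_nonneg hμ h hφ)⟩
  have := S.energyDeriv_nonneg hμ h (hφ.const_smul (-1))
  rw [energyDeriv_smul_neg hφ.1] at this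
  linarith

end CriticalPoint

/-! ### Truncation and upper semicontinuity of the least energy -/

section Truncation

variable {N : ℕ} {μ p : ℝ} {u : Euc N → ℝ} {Ω : Set (Euc N)}

/-- The truncation `(u - δ)⁺`. -/
def trunc (δ : ℝ) (u : Euc N → ℝ) (x : Euc N) : ℝ := max (u x - δ) 0

theorem trunc_nonneg (δ : ℝ) (u : Euc N → ℝ) (x : Euc N) : 0 ≤ trunc δ u x := le_max_right _ _

theorem trunc_le_abs {δ : ℝ} (hδ : 0 ≤ δ) (u : Euc N → ℝ) (x : Euc N) : trunc δ u x ≤ |u x| :=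
  max_le (by linarith [le_abs_self (u x)]) (abs_nonneg _)

theorem abs_trunc_le {δ : ℝ} (hδ : 0 ≤ δ) (u : Euc N → ℝ) (x : Euc N) : |trunc δ u x| ≤ |u x| := by
  rw [abs_of_nonneg (trunc_nonneg δ u x)]
  exact trunc_le_abs hδ u x

/-- The truncation is nonzero only where u > δ, and there |u|^{2-p} ≤ δ^{2-p}. This puts truncations
of functions in E into L², whatever the mass. -/
theorem trunc_sq_le (hp : 2 < p) {δ : ℝ} (hδ : 0 < δ) (u : Euc N → ℝ) (x : Euc N) :
    trunc δ u x ^ 2 ≤ δ ^ (2 - p) * |u x| ^ p := by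
  rcases le_or_gt (u x) δ with h | h
  · rw [trunc, max_eq_right (by linarith), zero_pow two_ne_zero]
    positivity
  · have h0 : 0 < |u x| := abs_pos.2 (by linarith)
    have h1 : δ ≤ |u x| := h.le.trans (le_abs_self _)
    calc trunc δ u x ^ 2 ≤ |u x| ^ 2 := by
          have := trunc_nonneg δ u x
          have := trunc_le_abs hδ.le u x
          gcongr
      _ = |u x| ^ (2 - p) * |u x| ^ p := by
          rw [← Real.rpow_natCast, ← Real.rpow_add h0]
          congr 1; push_cast; ring
      _ ≤ δ ^ (2 - p) * |u x| ^ p := by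
          refine mul_le_mul_of_nonneg_right ?_ (by positivity)
          exact Real.rpow_le_rpow_of_nonpos hδ h1 (by linarith)

theorem MemE.hasWeakGradient_trunc (hN : 1 ≤ N) (hu : MemE p u) (δ : ℝ) :
    HasWeakGradient (trunc δ u) ({x | 0 < u x - δ}.indicator (weakGrad u)) :=
  (hu.hasWeakGradient.sub_const δ).posPart hN hu.memLp_weakGrad

theorem MemE.memS_trunc (hN : 1 ≤ N) (hp : 2 < p) (hu : MemE p u) {δ : ℝ} (hδ : 0 < δ) :
    MemS μ p (trunc δ u) := by
  have hm := hu.1.aestronglyMeasurable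
  have hm' : AEStronglyMeasurable (trunc δ u) volume :=
    (hm.sub aestronglyMeasurable_const).sup aestronglyMeasurable_const
  refine ⟨memE_of_hasWeakGradient (hu.1.mono hm' (ae_of_all _ (abs_trunc_le hδ.le u)))
    (hu.hasWeakGradient_trunc hN δ) ?_, fun _ => ?_⟩
  · refine hu.memLp_weakGrad.mono (hu.memLp_weakGrad.aestronglyMeasurable.indicator₀
      (nullMeasurableSet_pos (hm.sub aestronglyMeasurable_const)))
      (ae_of_all _ fun x => norm_indicator_le_norm_self _ _)
  · rw [memLp_two_iff_integrable_sq hm']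
    refine ((hu.integrable_rpow (by linarith)).const_mul (δ ^ (2 - p))).mono' (hm'.pow 2)
      (ae_of_all _ fun x => ?_)
    rw [Real.norm_of_nonneg (by positivity)]
    exact trunc_sq_le hp hδ u x

theorem MemE.dir_trunc_le (hN : 1 ≤ N) (hp : 2 < p) (hu : MemE p u) {δ : ℝ} (hδ : 0 < δ) :
    dir (trunc δ u) ≤ dir u := by
  refine integral_mono_ae (hu.memS_trunc (μ := 0) hN hp hδ).1.integrable_grad_sq
    hu.integrable_grad_sq ?_
  filter_upwards [(hu.hasWeakGradient_trunc hN δ).weakGrad_ae] with x hx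
  rw [hx]
  gcongr
  exact norm_indicator_le_norm_self _ _

theorem MemE.tendsto_pot_trunc (hp : 0 < p) (hΩ : MeasurableSet Ω) (hu : MemE p u)
    (h0 : ∀ x, 0 ≤ u x) :
    Tendsto (fun δ => pot (Q Ω) p (trunc δ u)) (𝓝[>] 0) (𝓝 (pot (Q Ω) p u)) := by
  have hm := hu.1.aestronglyMeasurable
  refine tendsto_integral_filter_of_dominated_convergence (fun x => |u x| ^ p) ?_ ?_
    (hu.integrable_rpow hp) ?_
  · refine Eventually.of_forall fun δ => ?_
    have hm' : AEStronglyMeasurable (trunc δ u) volume :=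
      (hm.sub aestronglyMeasurable_const).sup aestronglyMeasurable_const
    exact (measurable_Q hΩ).aestronglyMeasurable.mul
      ((hm'.norm.aemeasurable.pow_const p).aestronglyMeasurable)
  · filter_upwards [self_mem_nhdsWithin] with δ hδ
    refine ae_of_all _ fun x => ?_
    rw [norm_mul, Real.norm_eq_abs, abs_Q, one_mul, Real.norm_of_nonneg (by positivity)]
    exact Real.rpow_le_rpow (abs_nonneg _) (abs_trunc_le (le_of_lt hδ) u x) hp.le
  · refine ae_of_all _ fun x => ?_
    have hc : Continuous fun δ : ℝ => Q Ω x * |trunc δ u x| ^ p := by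
      refine continuous_const.mul (Continuous.rpow_const ?_ fun _ => Or.inr hp.le)
      unfold trunc
      fun_prop
    have h := (hc.tendsto 0).mono_left (nhdsWithin_le_nhds (s := Set.Ioi 0))
    simpa [trunc, h0 x] using h

/-- The quadratic part of the projection onto a Nehari manifold, in terms of the values
`a` and `b` of the quadratic part and of the potential. -/
noncomputable def projQuad (p a b : ℝ) : ℝ := ((a / b) ^ (1 / (p - 2))) ^ 2 * a

theorem quad_proj_smul (hu : MemS μ p u) :
    quad μ (proj μ p Ω u • u) = projQuad p (quad μ u) (pot (Q Ω) p u) :=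
  quad_smul hu.1 _

theorem continuousAt_projQuad (hp : 2 < p) {a b : ℝ} (hb : b ≠ 0) :
    ContinuousAt (fun z : ℝ × ℝ => projQuad p z.1 z.2) (a, b) :=
  (((continuousAt_fst.div continuousAt_snd hb).rpow_const
    (Or.inr (one_div_nonneg.2 (by linarith : 0 ≤ p - 2)))).pow 2).mul continuousAt_fst

theorem projQuad_mono (hp : 2 < p) {a a' b : ℝ} (ha : 0 ≤ a) (h : a ≤ a') (hb : 0 < b) :
    projQuad p a b ≤ projQuad p a' b := by
  unfold projQuad
  have h1 : 0 ≤ 1 / (p - 2) := one_div_nonneg.2 (by linarith)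
  have h2 : 0 ≤ a / b := by positivity
  gcongr

theorem projQuad_self {a : ℝ} (ha : a ≠ 0) : projQuad p a a = a := by
  unfold projQuad
  rw [div_self ha, Real.one_rpow, one_pow, one_mul]

/-- A nonnegative Nehari function of the limit problem is approximated by functions in `L²`. -/
theorem Setup.exists_truncation (S : Setup N p Ω) (hu : MemE p u) (h0 : ∀ x, 0 ≤ u x)
    (hpos : 0 < dir u) (hq : dir u = pot (Q Ω) p u) {η : ℝ} (hη : 0 < η) :
    ∃ T : Euc N → ℝ, (∀ μ, MemS μ p T) ∧ (∀ x, 0 ≤ T x) ∧ (∀ x, u x = 0 → T x = 0) ∧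
      0 < pot (Q Ω) p T ∧ projQuad p (dir T) (pot (Q Ω) p T) < dir u + η := by
  have hp := S.two_lt
  have h1 := hu.tendsto_pot_trunc S.p_pos S.meas h0
  -- The potential of the truncation converges as δ → 0, while its Dirichlet integral never exceeds
  -- that of u. By monotonicity of `projQuad` in its first value, only the potential needs a limit.
  have h2 : Tendsto (fun δ => projQuad p (dir u) (pot (Q Ω) p (trunc δ u))) (𝓝[>] 0)
      (𝓝 (dir u)) := by
    have := (continuousAt_projQuad hp (a := dir u) (b := pot (Q Ω) p u)
      (by rw [← hq]; exact hpos.ne')).tendsto.comp (tendsto_const_nhds.prodMk_nhds h1)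
    simpa only [Function.comp_def, ← hq, projQuad_self hpos.ne'] using this
  obtain ⟨δ, ⟨ha, hb⟩, hδ⟩ := (((h1.eventually (eventually_gt_nhds (hq ▸ hpos))).and
    (h2.eventually (eventually_lt_nhds (by linarith : dir u < dir u + η)))).and
    (self_mem_nhdsWithin (s := Set.Ioi (0 : ℝ)))).exists
  refine ⟨trunc δ u, fun μ => hu.memS_trunc S.dim hp hδ, trunc_nonneg δ u, fun x hx => ?_, ha, ?_⟩
  · have : (0 : ℝ) < δ := hδ
    rw [trunc, hx, max_eq_right (by linarith)]
  · exact (projQuad_mono hp (dir_nonneg _) (hu.dir_trunc_le S.dim hp hδ) ha).trans_lt hb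

/-- For a fixed T in L² the mass term μ n ∫T² disappears in the limit, and the projected quadratic
part depends continuously on quad and pot. -/
theorem Setup.eventually_quad_proj_lt (S : Setup N p Ω) {T : Euc N → ℝ} (hT : ∀ μ, MemS μ p T)
    (hpot : 0 < pot (Q Ω) p T) {μ : ℕ → ℝ} (hlim : Tendsto μ atTop (𝓝 0)) {c : ℝ}
    (hc : projQuad p (dir T) (pot (Q Ω) p T) < c) :
    ∀ᶠ n in atTop, quad (μ n) (proj (μ n) p Ω T • T) < c := by
  have h1 : Tendsto (fun n => quad (μ n) T) atTop (𝓝 (dir T)) := by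
    simp only [fun n => (hT (μ n)).quad_eq, integral_const_mul]
    simpa using (hlim.mul_const (∫ x, T x ^ 2)).const_add (dir T)
  have h2 := (continuousAt_projQuad S.two_lt (a := dir T) hpot.ne').tendsto.comp
    (h1.prodMk_nhds tendsto_const_nhds)
  filter_upwards [h2.eventually (eventually_lt_nhds hc)] with n hn
  rw [quad_proj_smul (hT (μ n))]
  exact hn

/-- Upper semicontinuity of the least nodal energy as the mass tends to zero. -/
theorem Setup.eventually_exists_nodal (S : Setup N p Ω) {μ : ℕ → ℝ} (hμ : ∀ n, 0 ≤ μ n)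
    (hlim : Tendsto μ atTop (𝓝 0)) {w : Euc N → ℝ}
    (hw : w ∈ nodalNehari (MemS 0 p) 0 (Q Ω) p) {η : ℝ} (hη : 0 < η) :
    ∀ᶠ n in atTop, ∃ z ∈ nodalNehari (MemS (μ n) p) (μ n) (Q Ω) p,
      energy (μ n) (Q Ω) p z ≤ energy 0 (Q Ω) p w + η := by
  have hp := S.two_lt
  obtain ⟨hU, hU0, hUq⟩ := (mem_nehari_iff hp).1 hw.2.1
  obtain ⟨hV, hV0, hVq⟩ := (mem_nehari_iff hp).1 hw.2.2
  set U : Euc N → ℝ := fun x => max (w x) 0 with hUdef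
  set V : Euc N → ℝ := fun x => min (w x) 0 with hVdef
  -- Truncation is set up for nonnegative functions, so the negative part is treated through -V and
  -- the sign restored after projection.
  have hV' : MemS 0 p ((-1 : ℝ) • V) := hV.const_smul (-1)
  have eq : quad 0 ((-1 : ℝ) • V) = quad 0 V := by rw [quad_smul hV.1]; norm_num
  have ep : pot (Q Ω) p ((-1 : ℝ) • V) = pot (Q Ω) p V := by rw [pot_smul]; norm_num
  have hUd : 0 < dir U := S.dir_pos hU.1 hU0 (hUq ▸ quad_nonneg le_rfl U)
  have hVd : 0 < dir ((-1 : ℝ) • V) :=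
    S.dir_pos hV'.1 (ne_zero_smul (by norm_num) hV0) (ep ▸ hVq ▸ quad_nonneg le_rfl V)
  obtain ⟨T, hT, hT0, hTz, hTp, hTc⟩ := S.exists_truncation hU.1 (fun x => le_max_right _ _) hUd
    (by rw [← quad_zero, hUq]) hη
  obtain ⟨T', hT', hT0', hTz', hTp', hTc'⟩ := S.exists_truncation hV'.1
    (fun x => by simp [hVdef]) hVd (by rw [← quad_zero, eq, ep, hVq]) hη
  have hTT : ∀ x, T x * T' x = 0 := fun x => by
    rcases le_total (w x) 0 with h | h
    · rw [hTz x (by simp [hUdef, h]), zero_mul]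
    · rw [hTz' x (by simp [hVdef, h]), mul_zero]
  filter_upwards [S.eventually_quad_proj_lt hT hTp hlim hTc,
    S.eventually_quad_proj_lt hT' hTp' hlim hTc'] with n h1 h2
  have m1 := S.proj_smul_mem (hμ n) (hT (μ n)) hTp
  have t1 := S.proj_pos (hμ n) (hT (μ n)) hTp
  have t2 := S.proj_pos (hμ n) (hT' (μ n)) hTp'
  have m2 : (-1 : ℝ) • proj (μ n) p Ω T' • T' ∈ nehari (MemS (μ n) p) (μ n) (Q Ω) p := by
    obtain ⟨a1, a2, a3⟩ := (mem_nehari_iff hp).1 (S.proj_smul_mem (hμ n) (hT' (μ n)) hTp')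
    refine (mem_nehari_iff hp).2 ⟨a1.const_smul _, ne_zero_smul (by norm_num) a2, ?_⟩
    rw [quad_smul a1.1, pot_smul, a3]
    norm_num
  obtain ⟨hz, he⟩ := S.add_mem_nodalNehari m1 m2
    (ae_of_all _ fun x => mul_nonneg t1.le (hT0 x))
    (ae_of_all _ fun x => by
      simp only [Pi.smul_apply, smul_eq_mul]
      nlinarith [mul_nonneg t2.le (hT0' x)])
    (ae_of_all _ fun x => by
      simp only [Pi.smul_apply, smul_eq_mul]
      linear_combination (-(proj (μ n) p Ω T * proj (μ n) p Ω T')) * hTT x)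
  refine ⟨_, hz, ?_⟩
  rw [he, S.energy_nodal hw, quad_smul ((hT' (μ n)).const_smul _).1, ← hUdef, ← hVdef, ← eq,
    quad_zero, quad_zero]
  have hc := S.coef_pos
  -- The two parts lose η each; the coefficient, being at most 1/2, reduces the total loss 2η to η.
  have hc' : 1 / 2 - 1 / p ≤ 1 / 2 := by linarith [one_div_pos.2 S.p_pos]
  have hkey : quad (μ n) (proj (μ n) p Ω T • T) +
      (-1) ^ 2 * quad (μ n) (proj (μ n) p Ω T' • T') ≤ dir U + dir ((-1 : ℝ) • V) + 2 * η := by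
    linarith
  calc (1 / 2 - 1 / p) * _ ≤ (1 / 2 - 1 / p) * (dir U + dir ((-1 : ℝ) • V) + 2 * η) :=
        mul_le_mul_of_nonneg_left hkey hc.le
    _ ≤ _ := by nlinarith

end Truncation

/-! ### Convergence of minimizers as the mass tends to zero -/

section Asymptotics

variable {N : ℕ} {p : ℝ} {Ω : Set (Euc N)}

theorem tendsto_lintegral_sub_of_integral {p : ℝ} (hp : 1 ≤ p) {u : ℕ → Euc N → ℝ}
    {w : Euc N → ℝ} (hu : ∀ n, MemLp (u n) (ENNReal.ofReal p) volume)
    (hw : MemLp w (ENNReal.ofReal p) volume)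
    (hae : ∀ᵐ x, Tendsto (fun n => u n x) atTop (𝓝 (w x)))
    (h : Tendsto (fun n => ∫ x, |u n x| ^ p) atTop (𝓝 (∫ x, |w x| ^ p))) :
    Tendsto (fun n => ∫⁻ x, ‖u n x - w x‖ₑ ^ p) atTop (𝓝 0) := by
  have hp0 : 0 < p := by linarith
  refine tendsto_lintegral_sub_rpow hp (fun n => (hu n).aestronglyMeasurable)
    hw.aestronglyMeasurable (lintegral_rpow_ne_top_of_memLp hp0 hw) hae ?_
  simp only [fun n => lintegral_rpow_eq_ofReal hp0 (hu n), lintegral_rpow_eq_ofReal hp0 hw]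
  exact (ENNReal.continuous_ofReal.tendsto _).comp h

theorem tendstoInE_of_tendsto (hp : 2 < p) {u : ℕ → Euc N → ℝ} {w : Euc N → ℝ}
    (hu : ∀ n, MemE p (u n)) (hw : MemE p w)
    (hd : Tendsto (fun n => dir (u n - w)) atTop (𝓝 0))
    (h : Tendsto (fun n => ∫⁻ x, ‖u n x - w x‖ₑ ^ p) atTop (𝓝 0)) :
    TendstoInE p u w := by
  refine ⟨hu, hw, ?_⟩
  have hp0 : 0 < p := by linarith
  have h1 : Tendsto (fun n => ∫ x, |(u n - w) x| ^ p) atTop (𝓝 0) := by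
    have e : ∀ n, ∫ x, |(u n - w) x| ^ p = (∫⁻ x, ‖u n x - w x‖ₑ ^ p).toReal := fun n =>
      integral_rpow_eq_toReal ((hu n).1.aestronglyMeasurable.sub hw.1.aestronglyMeasurable) hp0.le
    simp only [e]
    exact (ENNReal.tendsto_toReal ENNReal.zero_ne_top).comp h
  have h2 := (hd.add (h1.rpow_const (p := 2 / p) (Or.inr (by positivity)))).sqrt
  simpa [normE, dir, Real.zero_rpow (by positivity : 2 / p ≠ 0)] using h2

/-- Minimizers of the problems with mass `μ n → 0` converge along a subsequence. -/
theorem Setup.exists_subseq_isLeastEnergyNodal (S : Setup N p Ω)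
    {μ : ℕ → ℝ} (hμ : ∀ n, 0 ≤ μ n)
    (hlim : Tendsto μ atTop (𝓝 0)) {u : ℕ → Euc N → ℝ}
    (hu : ∀ n, IsLeastEnergyNodal (MemS (μ n) p) (μ n) (Q Ω) p (u n))
    (hne : (nodalNehari (MemS 0 p) 0 (Q Ω) p).Nonempty) :
    ∃ (k : ℕ → ℕ) (w : Euc N → ℝ), StrictMono k ∧
      IsLeastEnergyNodal (MemS 0 p) 0 (Q Ω) p w ∧
      Tendsto (fun n => dir (u (k n) - w)) atTop (𝓝 0) ∧
      Tendsto (fun n => ∫⁻ x, ‖u (k n) x - w x‖ₑ ^ p) atTop (𝓝 0) ∧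
      Tendsto (fun n => quad (μ (k n)) (u (k n))) atTop (𝓝 (dir w)) := by
  have hp := S.two_lt
  -- Minimality of u n compares it with the approximate competitors for the limit problem. This
  -- gives both the energy bound needed for compactness and the sharp upper bound for the limit
  -- energy.
  have hub : ∀ w ∈ nodalNehari (MemS 0 p) 0 (Q Ω) p, ∀ η > 0, ∀ᶠ n in atTop,
      energy (μ n) (Q Ω) p (u n) ≤ energy 0 (Q Ω) p w + η := by
    intro w hw η hη
    filter_upwards [S.eventually_exists_nodal hμ hlim hw hη] with n ⟨z, hz, hze⟩
    exact ((hu n).2 z hz).trans hze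
  obtain ⟨w₀, hw₀⟩ := hne
  obtain ⟨M, hM⟩ : ∃ M, ∀ n, energy (μ n) (Q Ω) p (u n) ≤ M := by
    obtain ⟨n₀, hn₀⟩ := eventually_atTop.1 (hub w₀ hw₀ 1 one_pos)
    obtain ⟨M, hM⟩ := ((Finset.range n₀).image fun n => energy (μ n) (Q Ω) p (u n)).bddAbove
    refine ⟨max M (energy 0 (Q Ω) p w₀ + 1), fun n => ?_⟩
    rcases lt_or_ge n n₀ with h | h
    · exact le_max_of_le_left (hM (by
        simp only [Finset.coe_image, Set.mem_image, Finset.coe_range, Set.mem_Iio]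
        exact ⟨n, h, rfl⟩))
    · exact le_max_of_le_right (hn₀ n h)
  obtain ⟨k, w, e, hk, hw, he, hwe, hconv⟩ := S.exists_subseq_nodal hμ hlim (fun n => (hu n).1) hM
  have hle : ∀ v ∈ nodalNehari (MemS 0 p) 0 (Q Ω) p, e ≤ energy 0 (Q Ω) p v := by
    intro v hv
    refine le_of_forall_pos_le_add fun η hη => ?_
    exact le_of_tendsto he (hk.tendsto_atTop.eventually (hub v hv η hη))
  -- The upper bound tested with w itself is the equality case of the compactness result, so the
  -- convergence is strong.
  obtain ⟨hae, hd, hi⟩ := hconv (hle w hw)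
  have hmem := fun n => ((mem_nehari_iff hp).1 (hu n).1.1).1
  have hwm := ((mem_nehari_iff hp).1 hw.1).1
  refine ⟨k, w, hk, ⟨hw, fun v hv => hwe.trans (hle v hv)⟩, hd,
    tendsto_lintegral_sub_of_integral (by linarith) (fun n => (hmem (k n)).1.1) hwm.1.1 hae hi, ?_⟩
  have hee : e = energy 0 (Q Ω) p w := le_antisymm (hle w hw) hwe
  have hc := S.coef_pos
  simp only [fun n => energy_of_nehari hp (hu n).1.1] at he
  rw [hee, energy_of_nehari hp hw.1, quad_zero] at he
  have := he.const_mul (1 / 2 - 1 / p)⁻¹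
  simpa only [inv_mul_cancel_left₀ hc.ne'] using this

end Asymptotics

/-! ### The rescaling between (1) and the problem with mass ε² -/

section Scaling

open scoped Pointwise

variable {N : ℕ} {p ε : ℝ} {u v : Euc N → ℝ} {Ω : Set (Euc N)}

theorem memLp_comp_smul {F : Type*} [NormedAddCommGroup F] {f : Euc N → F} {q : ℝ≥0∞}
    (hf : MemLp f q volume) {c : ℝ} (hc : c ≠ 0) : MemLp (fun x => f (c • x)) q volume := by
  refine MemLp.comp_of_map (g := f) (f := (c • · : Euc N → Euc N)) ?_ (by fun_prop)
  rw [Measure.map_addHaar_smul volume hc]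
  exact hf.smul_measure ENNReal.ofReal_ne_top

theorem locallyIntegrable_comp_smul {F : Type*} [NormedAddCommGroup F] {f : Euc N → F}
    (hf : LocallyIntegrable f volume) {c : ℝ} (hc : c ≠ 0) :
    LocallyIntegrable (fun x => f (c • x)) volume := by
  refine (locallyIntegrable_map_homeomorph (Homeomorph.smulOfNeZero c hc)).1 ?_
  have e : Measure.map (Homeomorph.smulOfNeZero c hc : Euc N → Euc N) volume =
      ENNReal.ofReal (abs (c ^ Module.finrank ℝ (Euc N))⁻¹) • volume :=
    Measure.map_addHaar_smul volume hc
  rw [e]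
  intro x
  obtain ⟨s, hs, h⟩ := hf x
  refine ⟨s, hs, ?_⟩
  rw [IntegrableOn, Measure.restrict_smul]
  exact Integrable.smul_measure h ENNReal.ofReal_ne_top

theorem ae_comp_smul {P : Euc N → Prop} (h : ∀ᵐ x, P x) {c : ℝ} (hc : c ≠ 0) :
    ∀ᵐ x : Euc N, P (c • x) :=
  (Measure.quasiMeasurePreserving_smul volume hc).ae h

theorem HasWeakGradient.comp_smul {g : Euc N → Euc N} (h : HasWeakGradient v g)
    {c : ℝ} (hc : 0 < c) : HasWeakGradient (fun x => v (c • x)) (fun x => c • g (c • x)) where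
  locallyIntegrable := locallyIntegrable_comp_smul h.locallyIntegrable hc.ne'
  locallyIntegrable_grad := (locallyIntegrable_comp_smul h.locallyIntegrable_grad hc.ne').smul c
  integral_eq φ hφ hcs := by
    set ψ : Euc N → ℝ := fun y => φ (c⁻¹ • y) with hψ
    have hψc : ContDiff ℝ ∞ ψ := hφ.comp (contDiff_const_smul _)
    have hψs : HasCompactSupport ψ := hcs.comp_smul (inv_ne_zero hc.ne')
    have hφψ : ∀ x, φ x = ψ (c • x) := fun x => by
      simp only [hψ]
      rw [smul_smul, inv_mul_cancel₀ hc.ne', one_smul]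
    have hgrad : ∀ x, gradient φ x = c • gradient ψ (c • x) := fun x => by
      have e : φ = fun x => ψ (c • x) := funext hφψ
      conv_lhs => rw [e]
      simp only [gradient_eq_toDual_symm]
      rw [fderiv_comp_smul, map_smulₛₗ]
      simp
    calc ∫ x, v (c • x) • gradient φ x = c • ∫ x, v (c • x) • gradient ψ (c • x) := by
          rw [← integral_smul]
          refine integral_congr_ae (ae_of_all _ fun x => ?_)
          simp only
          rw [hgrad, smul_comm]
      _ = -(c • ∫ x, ψ (c • x) • g (c • x)) := by
          rw [Measure.integral_comp_smul volume (fun y => v y • gradient ψ y) c,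
            h.integral_eq ψ hψc hψs, Measure.integral_comp_smul volume (fun y => ψ y • g y) c,
            smul_neg, smul_neg]
      _ = -∫ x, φ x • c • g (c • x) := by
          rw [← integral_smul]
          congr 1
          refine integral_congr_ae (ae_of_all _ fun x => ?_)
          simp only
          rw [hφψ, smul_comm]

theorem rescale_eq_smul (p ε : ℝ) (v : Euc N → ℝ) :
    rescale p ε v = ε ^ (2 / (p - 2)) • fun x => v (ε • x) := rfl

theorem MemH1.hasWeakGradient (h : MemH1 v) : HasWeakGradient v (weakGrad v) :=
  weakGrad_spec h.2.choose_spec.1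

theorem MemH1.memLp_weakGrad (h : MemH1 v) : MemLp (weakGrad v) 2 volume := by
  obtain ⟨g, hg, hg2⟩ := h.2
  exact hg2.ae_eq hg.weakGrad_ae.symm

theorem MemH1.comp_smul (h : MemH1 v) {c : ℝ} (hc : 0 < c) (a : ℝ) :
    MemH1 (a • fun x => v (c • x)) :=
  ⟨(memLp_comp_smul h.1 hc.ne').const_smul a,
    _, (h.hasWeakGradient.comp_smul hc).const_smul a,
    ((memLp_comp_smul h.memLp_weakGrad hc.ne').const_smul c).const_smul a⟩

theorem memH1_rescale (h : MemH1 v) (hε : 0 < ε) : MemH1 (rescale p ε v) := h.comp_smul hε _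

theorem exists_rescale_eq (hε : 0 < ε) (h : MemH1 u) : ∃ v, MemH1 v ∧ rescale p ε v = u := by
  refine ⟨(ε ^ (2 / (p - 2)))⁻¹ • fun x => u (ε⁻¹ • x), h.comp_smul (inv_pos.2 hε) _, ?_⟩
  have hc : ε ^ (2 / (p - 2)) ≠ 0 := (Real.rpow_pos_of_pos hε _).ne'
  ext x
  simp only [rescale, Pi.smul_apply, smul_eq_mul]
  rw [mul_inv_cancel_left₀ hc, smul_smul, inv_mul_cancel₀ hε.ne', one_smul]

/-- The pointwise scaling factor of both energy densities under `rescale`. -/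
noncomputable def scaleFactor (p ε : ℝ) : ℝ := (ε ^ (2 / (p - 2))) ^ 2 * ε ^ 2

theorem scaleFactor_pos (hε : 0 < ε) : 0 < scaleFactor p ε := by
  unfold scaleFactor
  positivity

theorem MemH1.quad_density_rescale (h : MemH1 v) (hε : 0 < ε) :
    ∀ᵐ x, ‖weakGrad (rescale p ε v) x‖ ^ 2 + ε ^ 2 * rescale p ε v x ^ 2 =
      scaleFactor p ε * (‖weakGrad v (ε • x)‖ ^ 2 + 1 * v (ε • x) ^ 2) := by
  filter_upwards [((h.hasWeakGradient.comp_smul hε).const_smul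
    (ε ^ (2 / (p - 2)))).weakGrad_ae] with x hx
  rw [rescale_eq_smul, hx]
  simp only [Pi.smul_apply, norm_smul, smul_eq_mul, mul_pow, Real.norm_eq_abs, sq_abs, scaleFactor]
  ring

/-- The exponent 2/(p-2) is determined by 2p/(p-2) = 4/(p-2) + 2: the L^p density and the quadratic
density acquire the same factor. -/
theorem abs_rescale_rpow (hp : 2 < p) (hε : 0 < ε) (v : Euc N → ℝ) (x : Euc N) :
    |rescale p ε v x| ^ p = scaleFactor p ε * |v (ε • x)| ^ p := by
  have hc : 0 < ε ^ (2 / (p - 2)) := Real.rpow_pos_of_pos hε _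
  have hp2 : p - 2 ≠ 0 := by linarith
  rw [rescale, abs_mul, abs_of_pos hc, Real.mul_rpow hc.le (abs_nonneg _), scaleFactor]
  congr 1
  rw [← Real.rpow_natCast ε 2, ← Real.rpow_natCast (ε ^ _) 2, ← Real.rpow_mul hε.le,
    ← Real.rpow_mul hε.le, ← Real.rpow_add hε]
  congr 1
  push_cast
  field_simp
  ring

theorem setIntegral_quad_rescale (h : MemH1 v) (hε : 0 < ε) (s : Set (Euc N)) :
    ∫ x in s, (‖weakGrad (rescale p ε v) x‖ ^ 2 + ε ^ 2 * rescale p ε v x ^ 2) =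
      scaleFactor p ε * (ε ^ N)⁻¹ * ∫ x in ε • s, (‖weakGrad v x‖ ^ 2 + 1 * v x ^ 2) := by
  rw [integral_congr_ae (ae_restrict_of_ae (h.quad_density_rescale hε)), integral_const_mul,
    Measure.setIntegral_comp_smul_of_pos volume (fun x => ‖weakGrad v x‖ ^ 2 + 1 * v x ^ 2) s hε,
    finrank_euc, smul_eq_mul, mul_assoc]

theorem setIntegral_rpow_rescale (hp : 2 < p) (hε : 0 < ε) (v : Euc N → ℝ) (s : Set (Euc N)) :
    ∫ x in s, |rescale p ε v x| ^ p =
      scaleFactor p ε * (ε ^ N)⁻¹ * ∫ x in ε • s, |v x| ^ p := by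
  simp only [abs_rescale_rpow hp hε]
  rw [integral_const_mul, Measure.setIntegral_comp_smul_of_pos volume (fun x => |v x| ^ p) s hε,
    finrank_euc, smul_eq_mul, mul_assoc]

theorem smul_univ_of_pos (hε : 0 < ε) : ε • (Set.univ : Set (Euc N)) = Set.univ :=
  Set.smul_set_univ₀ hε.ne'

theorem quad_rescale (h : MemH1 v) (hε : 0 < ε) :
    quad (ε ^ 2) (rescale p ε v) = scaleFactor p ε * (ε ^ N)⁻¹ * quad 1 v := by
  have := setIntegral_quad_rescale (p := p) h hε Set.univ
  rwa [smul_univ_of_pos hε, setIntegral_univ, setIntegral_univ] at this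

theorem pot_rescale (hp : 2 < p) (hε : 0 < ε) (v : Euc N → ℝ) :
    pot (Q Ω) p (rescale p ε v) = scaleFactor p ε * (ε ^ N)⁻¹ * pot (Qε Ω ε) p v := by
  have e : ∀ x, Q Ω x * |rescale p ε v x| ^ p =
      scaleFactor p ε * (Qε Ω ε (ε • x) * |v (ε • x)| ^ p) := fun x => by
    rw [abs_rescale_rpow hp hε, Qε, smul_smul, inv_mul_cancel₀ hε.ne', one_smul]
    ring
  unfold pot
  simp only [e]
  rw [integral_const_mul,
    Measure.integral_comp_smul_of_nonneg volume (fun x => Qε Ω ε x * |v x| ^ p) ε (hR := hε.le),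
    finrank_euc, smul_eq_mul, mul_assoc]

theorem rescale_ae_eq_zero_iff (hε : 0 < ε) : rescale p ε v =ᵐ[volume] 0 ↔ v =ᵐ[volume] 0 := by
  have hc : ε ^ (2 / (p - 2)) ≠ 0 := (Real.rpow_pos_of_pos hε _).ne'
  constructor
  · intro h
    filter_upwards [ae_comp_smul h (inv_ne_zero hε.ne')] with x hx
    rw [rescale, smul_smul, mul_inv_cancel₀ hε.ne', one_smul] at hx
    simpa [hc] using hx
  · intro h
    filter_upwards [ae_comp_smul h hε.ne'] with x hx
    rw [rescale, hx]
    simp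

theorem rescale_mem_nehari_iff (hp : 2 < p) (hε : 0 < ε) (h : MemH1 v) :
    rescale p ε v ∈ nehari MemH1 (ε ^ 2) (Q Ω) p ↔ v ∈ nehari MemH1 1 (Qε Ω ε) p := by
  have hk : scaleFactor p ε * (ε ^ N)⁻¹ ≠ 0 :=
    (mul_pos (scaleFactor_pos hε) (by positivity)).ne'
  rw [mem_nehari_iff hp, mem_nehari_iff hp, quad_rescale h hε, pot_rescale hp hε,
    mul_right_inj' hk, rescale_ae_eq_zero_iff hε]
  exact ⟨fun h' => ⟨h, h'.2⟩, fun h' => ⟨memH1_rescale h hε, h'.2⟩⟩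

theorem max_rescale (hε : 0 < ε) (v : Euc N → ℝ) :
    (fun x => max (rescale p ε v x) 0) = rescale p ε (fun x => max (v x) 0) := by
  have hc : 0 < ε ^ (2 / (p - 2)) := Real.rpow_pos_of_pos hε _
  ext x
  simp only [rescale]
  rw [mul_max_of_nonneg _ _ hc.le, mul_zero]

theorem min_rescale (hε : 0 < ε) (v : Euc N → ℝ) :
    (fun x => min (rescale p ε v x) 0) = rescale p ε (fun x => min (v x) 0) := by
  have hc : 0 < ε ^ (2 / (p - 2)) := Real.rpow_pos_of_pos hε _
  ext x
  simp only [rescale]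
  rw [mul_min_of_nonneg _ _ hc.le, mul_zero]

theorem rescale_mem_nodalNehari_iff (S : Setup N p Ω) (hε : 0 < ε) (h : MemH1 v) :
    rescale p ε v ∈ nodalNehari MemH1 (ε ^ 2) (Q Ω) p ↔
      v ∈ nodalNehari MemH1 1 (Qε Ω ε) p := by
  have hS : MemS 1 p v := by rwa [memS_eq_memH1 S.two_lt S.subcrit one_ne_zero]
  have h1 : MemH1 fun x => max (v x) 0 := by
    rw [← memS_eq_memH1 S.two_lt S.subcrit one_ne_zero]; exact hS.pos S.dim
  have h2 : MemH1 fun x => min (v x) 0 := by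
    rw [← memS_eq_memH1 S.two_lt S.subcrit one_ne_zero]; exact hS.neg S.dim
  unfold nodalNehari
  rw [Set.mem_ofPred_eq, Set.mem_ofPred_eq, max_rescale hε, min_rescale hε,
    rescale_mem_nehari_iff S.two_lt hε h, rescale_mem_nehari_iff S.two_lt hε h1,
    rescale_mem_nehari_iff S.two_lt hε h2]

theorem energy_rescale (hp : 2 < p) (hε : 0 < ε) (h : MemH1 v) :
    energy (ε ^ 2) (Q Ω) p (rescale p ε v) =
      scaleFactor p ε * (ε ^ N)⁻¹ * energy 1 (Qε Ω ε) p v := by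
  rw [energy_eq, energy_eq, quad_rescale h hε, pot_rescale hp hε]
  ring

theorem isLeastEnergyNodal_rescale (S : Setup N p Ω) (hε : 0 < ε)
    (h : IsLeastEnergyNodal MemH1 1 (Qε Ω ε) p v) :
    IsLeastEnergyNodal (MemS (ε ^ 2) p) (ε ^ 2) (Q Ω) p (rescale p ε v) := by
  have hp := S.two_lt
  rw [memS_eq_memH1 hp S.subcrit (by positivity)]
  have hv : MemH1 v := ((mem_nehari_iff hp).1 h.1.1).1
  refine ⟨(rescale_mem_nodalNehari_iff S hε hv).2 h.1, fun w hw => ?_⟩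
  obtain ⟨v', hv', rfl⟩ := exists_rescale_eq (p := p) hε ((mem_nehari_iff hp).1 hw.1).1
  rw [energy_rescale hp hε hv, energy_rescale hp hε hv']
  refine mul_le_mul_of_nonneg_left (h.2 v' ((rescale_mem_nodalNehari_iff S hε hv').1 hw)) ?_
  exact (mul_pos (scaleFactor_pos hε) (by positivity)).le

/-- Problem (1) is itself of the general form, with mass 1 and the bounded open set εΩ. Existence
and criticality need no rescaling. -/
theorem Qε_eq (hε : 0 < ε) (Ω : Set (Euc N)) : Qε Ω ε = Q (ε • Ω) := by
  ext x
  unfold Qε Q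
  congr 1
  exact propext (Set.mem_smul_set_iff_inv_smul_mem₀ hε.ne' Ω x).symm

theorem Setup.smul (S : Setup N p Ω) (ε : ℝ) : Setup N p (ε • Ω) :=
  ⟨S.dim, S.two_lt, S.subcrit, S.meas.const_smul₀ ε, S.bdd.smul₀ ε⟩

end Scaling

/-! ### Vanishing of mass outside growing balls -/

section Concentration

variable {N : ℕ} {p : ℝ}

theorem tendsto_setLIntegral_compl_closedBall {f : Euc N → ℝ≥0∞} (hm : AEMeasurable f volume)
    (hf : ∫⁻ x, f x ≠ ⊤) {R : ℕ → ℝ} (hR : Tendsto R atTop atTop) :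
    Tendsto (fun n => ∫⁻ x in (Metric.closedBall 0 (R n))ᶜ, f x) atTop (𝓝 0) := by
  have hms : ∀ n, MeasurableSet (Metric.closedBall (0 : Euc N) (R n))ᶜ :=
    fun n => measurableSet_closedBall.compl
  refine Tendsto.congr (fun n => lintegral_indicator (hms n) f) ?_
  have h0 : ∫⁻ _ : Euc N, (0 : ℝ≥0∞) = 0 := by simp
  rw [← h0]
  refine tendsto_lintegral_of_dominated_convergence' f (fun n => hm.indicator (hms n))
    (fun n => ae_of_all _ fun x => Set.indicator_le_self _ _ _) hf (ae_of_all _ fun x => ?_)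
  refine tendsto_const_nhds.congr' ?_
  filter_upwards [hR.eventually_ge_atTop ‖x‖] with n hn
  rw [Set.indicator_of_notMem]
  simpa using hn

/-- The mass at infinity of an `Lᵠ`-convergent sequence vanishes. -/
theorem tendsto_setIntegral_compl_closedBall {F : Type*} [NormedAddCommGroup F] {q : ℝ}
    (hq : 1 ≤ q) {f : ℕ → Euc N → F} {f₀ : Euc N → F}
    (hf : ∀ n, AEStronglyMeasurable (f n) volume) (hf₀ : AEStronglyMeasurable f₀ volume)
    (hfin : ∫⁻ x, ‖f₀ x‖ₑ ^ q ≠ ⊤)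
    (h : Tendsto (fun n => ∫⁻ x, ‖f n x - f₀ x‖ₑ ^ q) atTop (𝓝 0))
    {R : ℕ → ℝ} (hR : Tendsto R atTop atTop) :
    Tendsto (fun n => ∫ x in (Metric.closedBall 0 (R n))ᶜ, ‖f n x‖ ^ q) atTop (𝓝 0) := by
  have hq0 : 0 ≤ q := by linarith
  refine Tendsto.congr (fun n => (integral_rpow_eq_toReal (hf n).restrict hq0).symm) ?_
  refine (ENNReal.tendsto_toReal ENNReal.zero_ne_top).comp ?_
  have h1 := tendsto_setLIntegral_compl_closedBall (hf₀.enorm.pow_const q) hfin hR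
  have hc : (2 : ℝ≥0∞) ^ (q - 1) ≠ ⊤ := ENNReal.rpow_ne_top_of_nonneg (by linarith) (by simp)
  have h2 : Tendsto (fun n => (2 : ℝ≥0∞) ^ (q - 1) * ((∫⁻ x, ‖f n x - f₀ x‖ₑ ^ q) +
      ∫⁻ x in (Metric.closedBall 0 (R n))ᶜ, ‖f₀ x‖ₑ ^ q)) atTop (𝓝 0) := by
    simpa using ENNReal.Tendsto.const_mul (h.add h1) (Or.inr hc)
  refine tendsto_of_tendsto_of_tendsto_of_le_of_le tendsto_const_nhds h2 (fun n => zero_le)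
    fun n => ?_
  calc ∫⁻ x in (Metric.closedBall 0 (R n))ᶜ, ‖f n x‖ₑ ^ q
      ≤ ∫⁻ x in (Metric.closedBall 0 (R n))ᶜ,
          (2 : ℝ≥0∞) ^ (q - 1) * (‖f n x - f₀ x‖ₑ ^ q + ‖f₀ x‖ₑ ^ q) := by
        refine lintegral_mono fun x => ?_
        refine le_trans ?_ (ENNReal.rpow_add_le_mul_rpow_add_rpow _ _ hq)
        gcongr
        simpa using enorm_add_le (f n x - f₀ x) (f₀ x)
    _ = 2 ^ (q - 1) * ((∫⁻ x in (Metric.closedBall 0 (R n))ᶜ, ‖f n x - f₀ x‖ₑ ^ q) +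
          ∫⁻ x in (Metric.closedBall 0 (R n))ᶜ, ‖f₀ x‖ₑ ^ q) := by
        rw [lintegral_const_mul' _ _ hc,
          lintegral_add_right' _ (hf₀.enorm.pow_const q).restrict]
    _ ≤ _ := by
        gcongr
        exact Measure.restrict_le_self

theorem tendsto_ratio {g : ℕ → Euc N → ℝ} (hg : ∀ n, Integrable (g n)) {R : ℕ → ℝ} {D : ℝ}
    (hD : D ≠ 0) (h : Tendsto (fun n => ∫ x, g n x) atTop (𝓝 D))
    (h0 : Tendsto (fun n => ∫ x in (Metric.closedBall 0 (R n))ᶜ, g n x) atTop (𝓝 0)) :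
    Tendsto (fun n => (∫ x in Metric.closedBall 0 (R n), g n x) / ∫ x, g n x) atTop (𝓝 1) := by
  have e : ∀ n, ∫ x in Metric.closedBall 0 (R n), g n x =
      (∫ x, g n x) - ∫ x in (Metric.closedBall 0 (R n))ᶜ, g n x := fun n => by
    rw [← integral_add_compl measurableSet_closedBall (hg n), add_sub_cancel_right]
  simp only [e]
  have := (h.sub h0).div h hD
  rwa [sub_zero, div_self hD] at this

end Concentration

/-! ### Concentration of minimizers -/

section Ratios

open scoped Pointwise

variable {N : ℕ} {p : ℝ} {Ω : Set (Euc N)}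

theorem tendsto_lintegral_weakGrad_sub {u : ℕ → Euc N → ℝ} {w : Euc N → ℝ}
    (hu : ∀ n, MemE p (u n)) (hw : MemE p w)
    (hd : Tendsto (fun n => dir (u n - w)) atTop (𝓝 0)) :
    Tendsto (fun n => ∫⁻ x, ‖weakGrad (u n) x - weakGrad w x‖ₑ ^ (2 : ℝ)) atTop (𝓝 0) := by
  have h := (ENNReal.continuous_ofReal.tendsto _).comp hd
  rw [ENNReal.ofReal_zero] at h
  refine h.congr fun n => ?_
  have e := lintegral_sq_eq_ofReal ((hu n).memLp_weakGrad.sub hw.memLp_weakGrad)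
  have e2 : dir (u n - w) = ∫ x, ‖(weakGrad (u n) - weakGrad w) x‖ ^ 2 := by
    refine integral_congr_ae ?_
    filter_upwards [weakGrad_sub (hu n) hw] with x hx
    rw [hx]
  rw [Function.comp_apply, e2, ← e]
  rfl

/-- Along a subsequence, the energy densities of minimizers concentrate on growing balls. -/
theorem Setup.exists_subseq_ratio (S : Setup N p Ω) {μ : ℕ → ℝ} (hμ : ∀ n, 0 ≤ μ n)
    (hlim : Tendsto μ atTop (𝓝 0)) {u : ℕ → Euc N → ℝ}
    (hu : ∀ n, IsLeastEnergyNodal (MemS (μ n) p) (μ n) (Q Ω) p (u n))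
    (hne : (nodalNehari (MemS 0 p) 0 (Q Ω) p).Nonempty) {R : ℕ → ℝ}
    (hR : Tendsto R atTop atTop) :
    ∃ k : ℕ → ℕ,
      Tendsto (fun n => (∫ x in Metric.closedBall 0 (R (k n)),
          (‖weakGrad (u (k n)) x‖ ^ 2 + μ (k n) * u (k n) x ^ 2)) /
        ∫ x, (‖weakGrad (u (k n)) x‖ ^ 2 + μ (k n) * u (k n) x ^ 2)) atTop (𝓝 1) ∧
      Tendsto (fun n => (∫ x in Metric.closedBall 0 (R (k n)), |u (k n) x| ^ p) /
        ∫ x, |u (k n) x| ^ p) atTop (𝓝 1) := by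
  have hp := S.two_lt
  have hp0 := S.p_pos
  obtain ⟨k, w, hk, hw, hd, hi, hq⟩ := S.exists_subseq_isLeastEnergyNodal hμ hlim hu hne
  obtain ⟨hwm, hw0, hwq⟩ := (mem_nehari_iff hp).1 hw.1.1
  have hmem : ∀ n, MemS (μ (k n)) p (u (k n)) := fun n =>
    ((mem_nehari_iff hp).1 (hu (k n)).1.1).1
  have hdw : 0 < dir w := S.dir_pos hwm.1 hw0 (hwq ▸ quad_nonneg le_rfl w)
  have hRk := hR.comp hk.tendsto_atTop
  have hgrad := tendsto_lintegral_weakGrad_sub (fun n => (hmem n).1) hwm.1 hd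
  have htail := tendsto_setIntegral_compl_closedBall (by norm_num)
    (fun n => (hmem n).1.memLp_weakGrad.aestronglyMeasurable)
    hwm.1.memLp_weakGrad.aestronglyMeasurable
    (lintegral_sq_ne_top_of_memLp hwm.1.memLp_weakGrad) hgrad hRk
  have hdir : Tendsto (fun n => dir (u (k n))) atTop (𝓝 (dir w)) := by
    have := tendsto_integral_rpow_of_tendsto_lintegral_sub (p := 2) (by norm_num)
      (fun n => by rw [ofReal_two]; exact (hmem n).1.memLp_weakGrad)
      (by rw [ofReal_two]; exact hwm.1.memLp_weakGrad) hgrad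
    simp only [Real.rpow_two] at this
    exact this
  -- The full quadratic parts and the Dirichlet integrals have the same limit, so the mass terms
  -- tend to 0 and do not affect the tails.
  have hmass : Tendsto (fun n => ∫ x, μ (k n) * u (k n) x ^ 2) atTop (𝓝 0) := by
    have := hq.sub hdir
    rw [sub_self] at this
    refine this.congr fun n => ?_
    rw [(hmem n).quad_eq, add_sub_cancel_left]
  refine ⟨k, tendsto_ratio (fun n => (hmem n).integrable_quad) hdw.ne' hq ?_,
    tendsto_ratio (D := ∫ x, |w x| ^ p) (fun n => (hmem n).1.integrable_rpow hp0) ?_ ?_ ?_⟩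
  · simp only [Real.rpow_two] at htail
    have hmt : Tendsto (fun n => ∫ x in (Metric.closedBall 0 (R (k n)))ᶜ,
        μ (k n) * u (k n) x ^ 2) atTop (𝓝 0) := by
      refine squeeze_zero (fun n => integral_nonneg fun x => ?_) (fun n => ?_) hmass
      · exact mul_nonneg (hμ _) (sq_nonneg _)
      · exact setIntegral_le_integral (hmem n).integrable_mul_sq
          (ae_of_all _ fun x => mul_nonneg (hμ _) (sq_nonneg _))
    have := htail.add hmt
    rw [add_zero] at this
    refine this.congr fun n => ?_
    exact (integral_add (hmem n).1.integrable_grad_sq.integrableOn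
      (hmem n).integrable_mul_sq.integrableOn).symm
  · intro h
    exact hw0 (hwm.1.ae_eq_zero_of_integral hp0 h.le)
  · exact tendsto_integral_rpow_of_tendsto_lintegral_sub (by linarith)
      (fun n => (hmem n).1.1) hwm.1.1 hi
  · exact tendsto_setIntegral_compl_closedBall (by linarith)
      (fun n => (hmem n).1.1.aestronglyMeasurable) hwm.1.1.aestronglyMeasurable
      (lintegral_rpow_ne_top_of_memLp hp0 hwm.1.1) hi hRk

theorem smul_closedBall_inv_mul {ε ρ : ℝ} (hε : 0 < ε) :
    ε • Metric.closedBall (0 : Euc N) (ε⁻¹ * ρ) = Metric.closedBall 0 ρ := by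
  rw [smul_closedBall' hε.ne', smul_zero, Real.norm_of_nonneg hε.le, mul_inv_cancel_left₀ hε.ne']

theorem quad_ratio_rescale {ε : ℝ} {v : Euc N → ℝ} (hε : 0 < ε) (h : MemH1 v) (ρ : ℝ) :
    (∫ x in Metric.closedBall 0 (ε⁻¹ * ρ),
        (‖weakGrad (rescale p ε v) x‖ ^ 2 + ε ^ 2 * rescale p ε v x ^ 2)) /
      (∫ x, (‖weakGrad (rescale p ε v) x‖ ^ 2 + ε ^ 2 * rescale p ε v x ^ 2)) =
    (∫ x in Metric.closedBall 0 ρ, (‖weakGrad v x‖ ^ 2 + v x ^ 2)) /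
      ∫ x, (‖weakGrad v x‖ ^ 2 + v x ^ 2) := by
  have hk : scaleFactor p ε * (ε ^ N)⁻¹ ≠ 0 :=
    (mul_pos (scaleFactor_pos hε) (by positivity)).ne'
  have h1 := setIntegral_quad_rescale (p := p) h hε (Metric.closedBall 0 (ε⁻¹ * ρ))
  have h2 := setIntegral_quad_rescale (p := p) h hε Set.univ
  rw [smul_univ_of_pos hε, setIntegral_univ, setIntegral_univ] at h2
  rw [smul_closedBall_inv_mul hε] at h1
  rw [h1, h2, mul_div_mul_left _ _ hk]
  simp only [one_mul]

theorem rpow_ratio_rescale (hp : 2 < p) {ε : ℝ} {v : Euc N → ℝ} (hε : 0 < ε) (ρ : ℝ) :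
    (∫ x in Metric.closedBall 0 (ε⁻¹ * ρ), |rescale p ε v x| ^ p) /
      (∫ x, |rescale p ε v x| ^ p) =
    (∫ x in Metric.closedBall 0 ρ, |v x| ^ p) / ∫ x, |v x| ^ p := by
  have hk : scaleFactor p ε * (ε ^ N)⁻¹ ≠ 0 :=
    (mul_pos (scaleFactor_pos hε) (by positivity)).ne'
  have h1 := setIntegral_rpow_rescale hp hε v (Metric.closedBall 0 (ε⁻¹ * ρ))
  have h2 := setIntegral_rpow_rescale hp hε v Set.univ
  rw [smul_univ_of_pos hε, setIntegral_univ, setIntegral_univ] at h2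
  rw [smul_closedBall_inv_mul hε] at h1
  rw [h1, h2, mul_div_mul_left _ _ hk]

/-- The condition N(p-2) < 2p rearranges to (N-2)p < 2N: the subcritical bound for N ≥ 3, automatic
for N ≤ 2. -/
theorem singExp_lt_one {N : ℕ} (hp : 2 < p)
    (hp_sub : 3 ≤ N → p < 2 * (N : ℝ) / ((N : ℝ) - 2)) : singExp N p < 1 := by
  unfold singExp
  rw [div_lt_one (by linarith)]
  rcases le_or_gt 3 N with h | h
  · have h3 : (3 : ℝ) ≤ N := by exact_mod_cast h
    have := hp_sub h
    rw [lt_div_iff₀ (by linarith)] at this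
    linarith
  · have h2 : (N : ℝ) ≤ 2 := by exact_mod_cast Nat.lt_succ_iff.1 h
    nlinarith

end Ratios

end NodalCore

/-! ### The main theorem -/

open NodalCore
open scoped Pointwise

theorem theorem1p3 {N : ℕ} (hN : 1 ≤ N) (Ω : Set (EuclideanSpace ℝ (Fin N)))
    (hΩ_open : IsOpen Ω) (hΩ_bdd : Bornology.IsBounded Ω) (hΩ_ne : Ω.Nonempty)
    (p : ℝ) (hp : 2 < p) (hp_sub : 3 ≤ N → p < 2 * (N : ℝ) / ((N : ℝ) - 2))
    (ε : ℕ → ℝ) (hε_pos : ∀ n, 0 < ε n) (hε : Tendsto ε atTop (𝓝 0)) :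
    -- existence, for each `n`, of a least energy nodal solution
    (∀ n, ∃ v, NodalCore.IsLeastEnergyNodal NodalCore.MemH1 1 (NodalCore.Qε Ω (ε n)) p v ∧
      NodalCore.IsSolution NodalCore.MemH1 1 (NodalCore.Qε Ω (ε n)) p v) ∧
    -- behaviour of any sequence of least energy nodal solutions
    ∀ v : ℕ → EuclideanSpace ℝ (Fin N) → ℝ,
      (∀ n, NodalCore.IsLeastEnergyNodal NodalCore.MemH1 1 (NodalCore.Qε Ω (ε n)) p (v n)) →
      (∀ n, NodalCore.IsSolution NodalCore.MemH1 1 (NodalCore.Qε Ω (ε n)) p (v n)) ∧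
      (∃ (k : ℕ → ℕ) (w : EuclideanSpace ℝ (Fin N) → ℝ), StrictMono k ∧
        NodalCore.IsLeastEnergyNodal (NodalCore.MemE p) 0 (NodalCore.Q Ω) p w ∧
        NodalCore.IsSolution (NodalCore.MemE p) 0 (NodalCore.Q Ω) p w ∧
        NodalCore.TendstoInE p (fun n => NodalCore.rescale p (ε (k n)) (v (k n))) w) ∧
      ∀ ρ : ℝ, 0 < ρ →
        Tendsto (fun n =>
          (∫ x in Metric.closedBall 0 ρ, (‖NodalCore.weakGrad (v n) x‖ ^ 2 + v n x ^ 2)) /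
            ∫ x, (‖NodalCore.weakGrad (v n) x‖ ^ 2 + v n x ^ 2)) atTop (𝓝 1) ∧
        Tendsto (fun n =>
          (∫ x in Metric.closedBall 0 ρ, |v n x| ^ p) / ∫ x, |v n x| ^ p) atTop (𝓝 1) := by
  have S : Setup N p Ω :=
    ⟨hN, hp, singExp_lt_one hp hp_sub, hΩ_open.measurableSet, hΩ_bdd⟩
  have hH1 : MemS (N := N) 1 p = MemH1 := memS_eq_memH1 hp S.subcrit one_ne_zero
  have hsol : ∀ n v, IsLeastEnergyNodal MemH1 1 (Qε Ω (ε n)) p v →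
      IsSolution MemH1 1 (Qε Ω (ε n)) p v := by
    intro n v hv
    rw [Qε_eq (hε_pos n), ← hH1] at hv ⊢
    exact (S.smul (ε n)).isSolution zero_le_one hv
  refine ⟨fun n => ?_, fun v hv => ⟨fun n => hsol n _ (hv n), ?_, fun ρ hρ => ?_⟩⟩
  · obtain ⟨v, hv⟩ := (S.smul (ε n)).exists_isLeastEnergyNodal (μ := 1) zero_le_one
      (hΩ_open.smul₀ (hε_pos n).ne') (hΩ_ne.smul_set)
    rw [← Qε_eq (hε_pos n), hH1] at hv
    exact ⟨v, hv, hsol n v hv⟩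
  all_goals
    have hne : (nodalNehari (MemS 0 p) 0 (Q Ω) p).Nonempty :=
      S.nodalNehari_nonempty le_rfl hΩ_open hΩ_ne
    have hμlim : Tendsto (fun n => ε n ^ 2) atTop (𝓝 0) := by
      simpa using hε.pow 2
    have hmin := fun n => isLeastEnergyNodal_rescale S (hε_pos n) (hv n)
  · obtain ⟨k, w, hk, hw, hd, hi, -⟩ := S.exists_subseq_isLeastEnergyNodal
      (fun n => sq_nonneg (ε n)) hμlim hmin hne
    have hws := S.isSolution le_rfl hw
    have hconv : TendstoInE p (fun n => rescale p (ε (k n)) (v (k n))) w :=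
      tendstoInE_of_tendsto hp (fun n => ((mem_nehari_iff hp).1 (hmin (k n)).1.1).1.1)
        hws.1.1 hd hi
    rw [memS_zero_iff] at hw hws
    exact ⟨k, w, hk, hw, hws, hconv⟩
  · have hmem : ∀ n, MemH1 (v n) := fun n => ((mem_nehari_iff hp).1 (hv n).1.1).1
    have hR : Tendsto (fun n => (ε n)⁻¹ * ρ) atTop atTop :=
      (tendsto_inv_nhdsGT_zero.comp (tendsto_nhdsWithin_iff.2
        ⟨hε, Eventually.of_forall hε_pos⟩)).atTop_mul_const hρ
    -- The limits hold along the whole sequence: every subsequence has a further one with ratio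
    -- tending to 1, and this value does not depend on which minimizer of the limit problem is
    -- reached.
    have key : ∀ ns : ℕ → ℕ, Tendsto ns atTop atTop → ∃ ms : ℕ → ℕ, _ ∧ _ := fun ns hns =>
      S.exists_subseq_ratio (μ := fun n => ε (ns n) ^ 2) (fun n => sq_nonneg _)
        (hμlim.comp hns) (fun n => hmin (ns n)) hne (hR.comp hns)
    constructor
    · refine tendsto_of_subseq_tendsto fun ns hns => ?_
      obtain ⟨ms, h, -⟩ := key ns hns
      exact ⟨ms, h.congr fun n => quad_ratio_rescale (hε_pos _) (hmem _) ρ⟩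
    · refine tendsto_of_subseq_tendsto fun ns hns => ?_
      obtain ⟨ms, -, h⟩ := key ns hns
      exact ⟨ms, h.congr fun n => rpow_ratio_rescale hp (hε_pos _) ρ⟩
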